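/- Let $\lambda_q=2^q$ and fix a nonnegative radial function $\chi\in C_0^\infty(B(0,1))$ on $\mathbb R^2$ with $\chi(\xi)=1$ for $|\xi|\le 1/2$; put $\varphi(\xi)=\chi(\lambda_1^{-1}\xi)-\chi(\xi)$. For a tempered distribution $f$ on $\mathbb R^2$ let $\Delta_{-1}f=\mathcal F^{-1}(\chi\,\mathcal Ff)$, $\Delta_qf=\mathcal F^{-1}(\varphi(\lambda_q^{-1}\cdot)\,\mathcal Ff)$ for $q\ge 0$, and $S_Q=\sum_{q=-1}^{Q}\Delta_q$, where $\mathcal F f(\xi)=\int f(x)e^{-2\pi i x\cdot\xi}\,dx$. Let $\nabla^\perp=(-\partial_2,\partial_1)$. For a divergence-free vector field $u\in L^2(\mathbb R^2;\mathbb R^2)$ with vorticity $\omega=\nabla^\perp\cdot u=\partial_1u_2-\partial_2u_1$ (in the sense of distributions) define the enstrophy flux $$\Omega_Q=\int_{\mathbb R^2}\mathrm{Tr}\left[S_Q(u\otimes u)\cdot\nabla\nabla^\perp S_Q\omega\right]dx=\int_{\mathbb R^2}\sum_{i,j}S_Q(u_iu_j)\,\partial_i(\nabla^\perp)_jS_Q\omega\,dx,$$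 and put $c_q=\|\Delta_q\omega\|_{L^3}$ for $q\ge -1$, $W(q)=\lambda_q^{2}$ for $q\le 0$, $W(q)=\lambda_q^{-4}$ for $q>0$, and $(W*c^2)(Q)=\sum_{q\ge -1}W(Q-q)\,c_q^2\in[0,\infty]$. **Proposition.** (i) There is a constant $C$, depending only on $\chi$, such that for every divergence-free $u\in L^2(\mathbb R^2;\mathbb R^2)$ and every integer $Q\ge 0$ the integral defining $\Omega_Q$ converges absolutely and $$|\Omega_Q|\le C\left(\|S_Q\omega\|_{L^3}^2\,(W*c^2)^{1/2}(Q)+(W*c^2)^{3/2}(Q)\right).$$ (ii) Let $T>0$ and let $u\in C_w([0,T];L^2(\mathbb R^2))$ be a weak solution of the two-dimensional Euler equations, that is, $\nabla\cdot u(t)=0$ in the sense of distributions for every $t\in[0,T]$, and for every $\psi\in C^1([0,T];\mathcal S(\mathbb R^2))$ with $\nabla_x\cdot\psi=0$ and every $t\in[0,T]$ $$(u(t),\psi(t))-(u(0),\psi(0))-\int_0^t(u(s),\partial_s\psi(s))\,ds=\int_0^t\int_{\mathbb R^2}u\cdot\nabla\psi\cdot u\,dx\,ds,$$ where $(\cdot,\cdot)$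 is the $L^2$ inner product. If $\omega=\nabla^\perp\cdot u\in L^3([0,T];L^3(\mathbb R^2))$, then $u$ conserves enstrophy: $\|\omega(t)\|_{L^2}=\|\omega(0)\|_{L^2}$ for every $t\in[0,T]$, where the norm is $+\infty$ if the distribution is not in $L^2$ (so it is finite at all times or at none). -/

import Mathlib

open MeasureTheory Set Filter Topology
open scoped ENNReal NNReal ContDiff SchwartzMap LineDeriv

noncomputable section

namespace Enstrophy

/-- The Euclidean plane `ℝ²`. -/
abbrev Plane : Type := EuclideanSpace ℝ (Fin 2)

/-- Square-integrable (real) vector fields on the plane, `L²(ℝ²; ℝ²)`. -/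
abbrev VectorField : Type := Lp Plane 2 (volume : Measure Plane)

/-- Scalar tempered distributions on the plane. -/
abbrev Distr : Type := 𝓢'(Plane, ℂ)

/-- The standard basis vectors of the plane. -/
def e (i : Fin 2) : Plane := EuclideanSpace.single i 1

/-! ### Littlewood-Paley decomposition -/

/-- The dyadic wave numbers `λ_q = 2^q`. -/
def lam (q : ℤ) : ℝ := 2 ^ q

/-- `χ` is a nonnegative radial function in `C_0^∞(B(0,1))` with `χ = 1` on `|ξ| ≤ 1/2`. -/
structure IsCutoff (χ : Plane → ℝ) : Prop where
  contDiff : ContDiff ℝ ∞ χ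
  nonneg : ∀ ξ, 0 ≤ χ ξ
  radial : ∀ ξ η, ‖ξ‖ = ‖η‖ → χ ξ = χ η
  hasCompactSupport : HasCompactSupport χ
  tsupport_subset : tsupport χ ⊆ Metric.ball 0 1
  eq_one : ∀ ξ, ‖ξ‖ ≤ 1 / 2 → χ ξ = 1

/-- `φ(ξ) = χ(λ_1⁻¹ ξ) - χ(ξ)`. -/
def shell (χ : Plane → ℝ) (ξ : Plane) : ℝ := χ ((lam 1)⁻¹ • ξ) - χ ξ

/-- The symbol of the dyadic block `Δ_q`: `χ` for `q = -1`, `φ(λ_q⁻¹ ·)` for `q ≥ 0`, and `0`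
for `q < -1` (so that sequences over `q ≥ -1` are extended by zero to all integers). -/
def blockSymbol (χ : Plane → ℝ) (q : ℤ) (ξ : Plane) : ℝ :=
  if q < -1 then 0 else if q = -1 then χ ξ else shell χ ((lam q)⁻¹ • ξ)

/-- The Littlewood-Paley block `Δ_q T = 𝓕⁻¹(symbol · 𝓕 T)` of a tempered distribution. -/
def block (χ : Plane → ℝ) (q : ℤ) (T : Distr) : Distr :=
  TemperedDistribution.fourierMultiplierCLM ℂ (fun ξ => (blockSymbol χ q ξ : ℂ)) T

/-- `S_Q = ∑_{q=-1}^Q Δ_q`. -/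
def partialSum (χ : Plane → ℝ) (Q : ℕ) (T : Distr) : Distr :=
  ∑ q ∈ Finset.Icc (-1 : ℤ) Q, block χ q T

/-! ### Distributions that are functions -/

/-- The distribution `T` is given by integration against the function `f`. -/
def Represents (f : Plane → ℂ) (T : Distr) : Prop :=
  LocallyIntegrable f ∧ ∀ g : 𝓢(Plane, ℂ), Integrable (fun x => g x * f x) ∧
    T g = ∫ x, g x * f x

/-- The function representing `T`, which is unique almost everywhere
(and `0` if `T` is not a function). -/
def toFunction (T : Distr) : Plane → ℂ :=
  open Classical in if h : ∃ f, Represents f T then h.choose else 0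

/-- A function representing a distribution is unique almost everywhere. -/
theorem Represents.ae_eq {f g : Plane → ℂ} {T : Distr} (hf : Represents f T)
    (hg : Represents g T) : f =ᵐ[volume] g := by
  have key : ∀ᵐ x ∂(volume : Measure Plane), (f - g) x = 0 := by
    apply ae_eq_zero_of_integral_contDiff_smul_eq_zero (hf.1.sub hg.1)
    intro φ hφ hφc
    have h₁ : HasCompactSupport (Complex.ofRealCLM ∘ φ) := hφc.comp_left rfl
    have h₂ : ContDiff ℝ ∞ (Complex.ofRealCLM ∘ φ) := by fun_prop
    obtain ⟨i₁, e₁⟩ := hf.2 (h₁.toSchwartzMap h₂)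
    obtain ⟨i₂, e₂⟩ := hg.2 (h₁.toSchwartzMap h₂)
    have h := integral_sub i₁ i₂
    rw [← e₁, ← e₂, sub_self] at h
    rw [← h]
    congr 1
    ext x
    simp [mul_sub]
  filter_upwards [key] with x hx
  simpa [sub_eq_zero] using hx

theorem Represents.toFunction_ae_eq {f : Plane → ℂ} {T : Distr} (hf : Represents f T) :
    toFunction T =ᵐ[volume] f := by
  have h : ∃ f, Represents f T := ⟨f, hf⟩
  rw [toFunction, dif_pos h]
  exact h.choose_spec.ae_eq hf

instance factOneLeThree : Fact ((1 : ℝ≥0∞) ≤ 3) := ⟨by norm_num⟩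

/-- The `L^p` norm of a tempered distribution: the norm of the unique element of `L^p` that equals
`T` if there is one, and `∞` if there is none. -/
def distNorm (p : ℝ≥0∞) [Fact (1 ≤ p)] (T : Distr) : ℝ≥0∞ :=
  ⨅ (f : Lp ℂ p (volume : Measure Plane)) (_ : (f : Distr) = T), ‖f‖ₑ

theorem distNorm_coe (p : ℝ≥0∞) [Fact (1 ≤ p)] (f : Lp ℂ p (volume : Measure Plane)) :
    distNorm p (f : Distr) = ‖f‖ₑ := by
  refine le_antisymm (iInf_le_of_le f (iInf_le_of_le rfl le_rfl)) (le_iInf₂ fun g hg => ?_)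
  have hk := Lp.ker_toTemperedDistributionCLM_eq_bot (F := ℂ)
    (μ := (volume : Measure Plane)) (p := p)
  have : g = f := LinearMap.ker_eq_bot.1 hk hg
  rw [this]

/-! ### Velocity and vorticity -/

/-- The component `u_i`, as a complex-valued `L²` function. -/
def component (u : VectorField) (i : Fin 2) : Lp ℂ 2 (volume : Measure Plane) :=
  (Complex.ofRealCLM ∘L (EuclideanSpace.proj i : Plane →L[ℝ] ℝ)).compLp u

/-- `∇ · u = 0` in the sense of distributions. -/
def DivergenceFree (u : VectorField) : Prop :=
  ∑ i, ∂_{e i} (component u i : Distr) = 0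

/-- The vorticity `ω = ∇^⊥ · u = ∂₁ u₂ - ∂₂ u₁`, a tempered distribution. -/
def vorticity (u : VectorField) : Distr :=
  ∂_{e 0} (component u 1 : Distr) - ∂_{e 1} (component u 0 : Distr)

theorem memLp_tensor (u : VectorField) (i j : Fin 2) :
    MemLp (fun x => component u i x * component u j x) 1 volume :=
  (Lp.memLp (component u j)).mul' (Lp.memLp (component u i))

/-- The entry `u_i u_j ∈ L¹` of `u ⊗ u`, as a distribution. -/
def tensor (u : VectorField) (i j : Fin 2) : Distr :=
  ((memLp_tensor u i j).toLp : Lp ℂ 1 (volume : Measure Plane))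

/-- The components of `∇^⊥ T = (-∂₂ T, ∂₁ T)`. -/
def gradPerp (T : Distr) (j : Fin 2) : Distr :=
  if j = 0 then -∂_{e 1} T else ∂_{e 0} T

/-- The integrand `Tr [S_Q(u ⊗ u) · ∇ ∇^⊥ S_Q ω]` of the enstrophy flux. -/
def fluxDensity (χ : Plane → ℝ) (Q : ℕ) (u : VectorField) (x : Plane) : ℂ :=
  ∑ i, ∑ j, toFunction (partialSum χ Q (tensor u i j)) x *
    toFunction (∂_{e i} (gradPerp (partialSum χ Q (vorticity u)) j)) x

/-- The enstrophy flux `Ω_Q = ∫ Tr [S_Q(u ⊗ u) · ∇ ∇^⊥ S_Q ω] dx`. -/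
def flux (χ : Plane → ℝ) (Q : ℕ) (u : VectorField) : ℂ :=
  ∫ x, fluxDensity χ Q u x

/-- The localization kernel `W(q) = λ_q²` for `q ≤ 0` and `W(q) = λ_q⁻⁴` for `q > 0`. -/
def W (q : ℤ) : ℝ := if q ≤ 0 then lam q ^ 2 else (lam q ^ 4)⁻¹

/-- `c_q = ‖Δ_q ω‖_3` (which is `0` for `q < -1`). -/
def c (χ : Plane → ℝ) (u : VectorField) (q : ℤ) : ℝ≥0∞ :=
  distNorm 3 (block χ q (vorticity u))

/-- The convolution `(W * c²)(Q) = ∑_{q ≥ -1} W(Q - q) c_q²`. -/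
def Wc (χ : Plane → ℝ) (u : VectorField) (Q : ℤ) : ℝ≥0∞ :=
  ∑' q : ℤ, ENNReal.ofReal (W (Q - q)) * c χ u q ^ 2

/-! ### Weak solutions of the Euler equations -/

/-- The `L²` pairing `(u, ψ)` with a Schwartz field. -/
def pairing (u : VectorField) (ψ : 𝓢(Plane, Plane)) : ℝ :=
  ∫ x, inner ℝ (u x) (ψ x)

/-- `b(u, ψ, u) = ∫ u · ∇ψ · u dx = ∫ ∑_{i,j} u_i (∂_i ψ_j) u_j dx`. -/
def trilinear (u : VectorField) (ψ : 𝓢(Plane, Plane)) : ℝ :=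
  ∫ x, inner ℝ (fderiv ℝ ψ x (u x)) (u x)

/-- `u ∈ C_w([0,T]; L²)` is a weak solution of the two-dimensional Euler equations on `[0,T]`.
The test functions are the `ψ ∈ C¹([0,T]; 𝓢)` with `∇_x · ψ = 0`; `ψ'` is the time derivative. -/
structure IsWeakSolution (T : ℝ) (u : ℝ → VectorField) : Prop where
  weaklyContinuous : ∀ v : VectorField, ContinuousOn (fun t => inner ℝ (u t) v) (Icc 0 T)
  divergenceFree : ∀ t ∈ Icc 0 T, DivergenceFree (u t)
  momentum : ∀ ψ ψ' : ℝ → 𝓢(Plane, Plane),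
    (∀ t ∈ Icc 0 T, HasDerivWithinAt ψ (ψ' t) (Icc 0 T) t) →
    ContinuousOn ψ' (Icc 0 T) →
    (∀ t ∈ Icc 0 T, ∀ x, ∑ i, (fderiv ℝ (ψ t) x (e i)) i = 0) →
    ∀ t ∈ Icc 0 T,
      pairing (u t) (ψ t) - pairing (u 0) (ψ 0) - ∫ s in (0 : ℝ)..t, pairing (u s) (ψ' s)
        = ∫ s in (0 : ℝ)..t, trilinear (u s) (ψ s)

/-- `ω = ∇^⊥ · u ∈ L³([0,T]; L³)`. -/
def VorticityL3L3 (T : ℝ) (u : ℝ → VectorField) : Prop :=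
  ∃ w : ℝ → Lp ℂ 3 (volume : Measure Plane), MemLp w 3 (volume.restrict (Icc 0 T)) ∧
    ∀ᵐ t ∂volume.restrict (Icc 0 T), (w t : Distr) = vorticity (u t)

/-- The enstrophy: the `L²` norm of the vorticity (`∞` if the vorticity is not in `L²`). -/
def enstrophy (u : VectorField) : ℝ≥0∞ := distNorm 2 (vorticity u)

end Enstrophy

end

/-! Part (i). Let `h` be the kernel of `S_Q`, put v = S_Q u and λ = 2^(Q+1). Since `h` has integral
one, the Constantin–E–Titi identity (`cv_mul_eq`) writes S_Q(u_i u_j) as the average of (u_i(x-z) -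
u_i(x))(u_j(x-z) - u_j(x)) against h(z) dz, minus (u_i - v_i)(u_j - v_j), plus v_i v_j. Paired with
∇∇^⊥ S_Q ω, the last term integrates to zero: smooth planar Euler fields have no enstrophy flux,
because curl(v·∇v) = v·∇(curl v) when div v = 0 (`integral_cv_mul_hess`). What remains is quadratic
in increments of u, and Hölder's inequality with three exponents 3 applies. An increment is at most
|z| ‖∇v‖ + 2 ‖u - v‖ in L³, and the second moment of |h| is of order λ^(-2).

Three L³ bounds finish the estimate: ‖∇v‖ ≤ 6 ‖S_Q ω‖ (`eLpNorm_pd_cv_le`), ‖u - v‖² ≲ λ^(-2) W*c²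
(`eLpNorm_comp_sub_le`) and ‖∇² S_Q ω‖² ≲ λ⁴ W*c² (`eLpNorm_hess_le`). The two branches of the
kernel W are exactly the weights of the last two bounds, and all powers of λ cancel.

The first bound is a Calderón–Zygmund inequality, proved by a Bellman-type argument
(`n3_cube_le_of_heat`): if w and f evolve by the heat equation and Δw = ± ∂_i ∂_j f, then ‖w‖³ -
‖(w, 8f)‖³/16 is nondecreasing, because the dissipation of the pair dominates the dissipation that
the relation forces on w.

The other two rest on ‖∑ b_n‖² ≲ ∑ ‖b_n‖² for dyadic blocks in L³ (`n3_sum_sq_le`). It follows from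
the second-order expansion of the cube of the norm. The linear term pairs |A|A with b_n, where A is
the sum of the lower blocks. Writing b_n as the divergence of something smaller by 2^(-n) and moving
the derivative to A leaves a geometrically weighted interaction of scales.

Part (ii). Testing the equation with ∇^⊥ φ gives the vorticity equation, and S_Q ω becomes a
Lipschitz curve in L² driven by a bounded nonlinearity. The increments of ‖S_Q ω‖² are bounded by
twice the time integral of |Ω_Q| (`ofReal_abs_sub_le_lintegral`, `inner_vortL_eulerL`). For a
vorticity in L³, (W*c²)(Q) tends to zero and is bounded by a multiple of the squared norm, so (i)
and dominated convergence give a vanishing integrated flux (`tendsto_lintegral_flux`). By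
Plancherel, ‖S_Q ω‖ in L² tends to the enstrophy norm even when it is infinite
(`tendsto_enorm_vortL_sq`). -/

noncomputable section

namespace Enstrophy

open FourierTransform

section

/-! ### Convolution with a Schwartz kernel -/

/-- Convolution of a function with a Schwartz kernel. -/
def conv (K : 𝓢(Plane, ℂ)) (f : Plane → ℂ) (x : Plane) : ℂ := ∫ y, K (x - y) * f y

/-- Hölder for the splitting k = k^(1/q) k^(1/p). The weight is not normalized: it is a convolution
kernel in Young's inequality and the constant 1 on the unit interval in the translation estimate. -/
theorem lintegral_mul_rpow_le {α : Type*} [MeasurableSpace α] {μ : Measure α} {p : ℝ}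
    (hp : 1 ≤ p) {k g : α → ℝ≥0∞} (hk : AEMeasurable k μ) (hg : AEMeasurable g μ) :
    (∫⁻ y, k y * g y ∂μ) ^ p ≤ (∫⁻ y, k y ∂μ) ^ (p - 1) * ∫⁻ y, k y * g y ^ p ∂μ := by
  rcases hp.eq_or_lt with rfl | hp
  · simp
  have hp0 : 0 < p := zero_lt_one.trans hp
  have hpq := Real.HolderConjugate.conjExponent hp
  set q := p.conjExponent
  have hq0 : 0 < q := hpq.symm.pos
  have e1 : ∀ y, k y * g y = k y ^ (1 / q) * (k y ^ (1 / p) * g y) := fun y => by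
    rw [← mul_assoc, ← ENNReal.rpow_add_of_nonneg _ _ (by positivity) (by positivity)]
    have : 1 / q + 1 / p = 1 := by
      have := hpq.inv_add_inv_eq_one
      simp only [one_div]; linarith
    rw [this, ENNReal.rpow_one]
  have h := ENNReal.lintegral_mul_le_Lp_mul_Lq μ hpq.symm (hk.pow_const (1 / q))
    ((hk.pow_const (1 / p)).mul hg)
  simp only [Pi.mul_apply, ← e1, ← ENNReal.rpow_mul, one_div_mul_cancel hq0.ne',
    ENNReal.rpow_one, ENNReal.mul_rpow_of_nonneg _ _ hp0.le, one_div_mul_cancel hp0.ne'] at h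
  calc (∫⁻ y, k y * g y ∂μ) ^ p ≤ _ := ENNReal.rpow_le_rpow h hp0.le
    _ = _ := by
      rw [ENNReal.mul_rpow_of_nonneg _ _ hp0.le, ← ENNReal.rpow_mul, ← ENNReal.rpow_mul,
        one_div_mul_cancel hp0.ne', ENNReal.rpow_one]
      congr 2
      have := hpq.sub_one_mul_conj
      field_simp
      linarith

section

variable {p : ℝ≥0∞} [hp : Fact (1 ≤ p)] {f g : Plane → ℂ} (K : 𝓢(Plane, ℂ))

theorem memLp_kernel_comp_sub (q : ℝ≥0∞) (x : Plane) : MemLp (fun y => K (x - y)) q volume :=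
  (K.memLp q).comp_measurePreserving (Measure.measurePreserving_sub_left volume x)

/-- `(1 - p⁻¹)⁻¹` is the exponent conjugate to `p`, with the right values at `p = 1` and `p = ⊤`; a
Schwartz kernel lies in L^q for every q. -/
theorem integrable_kernel_mul (hf : MemLp f p volume) (x : Plane) :
    Integrable (fun y => K (x - y) * f y) := by
  have := ENNReal.HolderConjugate.inv_one_sub_inv' hp.out
  have h := hf.integrable_mul (memLp_kernel_comp_sub K (1 - p⁻¹)⁻¹ x)
  exact h.congr (ae_of_all _ fun y => mul_comm _ _)

theorem integrable_schwartz_mul (hf : MemLp f p volume) :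
    Integrable (fun y => K y * f y) := by
  have := ENNReal.HolderConjugate.inv_one_sub_inv' hp.out
  exact (hf.integrable_mul (K.memLp (1 - p⁻¹)⁻¹)).congr (ae_of_all _ fun y => mul_comm _ _)

theorem enorm_conv_le (hf : MemLp f p volume) (x : Plane) :
    ‖conv K f x‖ₑ ≤ eLpNorm K (1 - p⁻¹)⁻¹ volume * eLpNorm f p volume := by
  have := ENNReal.HolderConjugate.inv_one_sub_inv' hp.out
  have h1 : ‖conv K f x‖ₑ ≤ eLpNorm (fun y => K (x - y) * f y) 1 volume := by
    rw [eLpNorm_one_eq_lintegral_enorm]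
    exact enorm_integral_le_lintegral_enorm _
  have h2 := eLpNorm_smul_le_mul_eLpNorm (p := (1 - p⁻¹)⁻¹) (q := p) (r := 1) hf.1
    (memLp_kernel_comp_sub K (1 - p⁻¹)⁻¹ x).1
  refine h1.trans (h2.trans_eq ?_)
  congr 1
  exact eLpNorm_comp_measurePreserving (g := K) K.continuous.aestronglyMeasurable
    (Measure.measurePreserving_sub_left volume x)

theorem exists_norm_conv_le (hf : MemLp f p volume) : ∃ C : ℝ, ∀ x, ‖conv K f x‖ ≤ C := by
  refine ⟨(eLpNorm K (1 - p⁻¹)⁻¹ volume * eLpNorm f p volume).toReal, fun x => ?_⟩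
  rw [← toReal_enorm]
  exact ENNReal.toReal_mono (ENNReal.mul_ne_top (K.eLpNorm_lt_top _ volume).ne
    hf.eLpNorm_ne_top) (enorm_conv_le K hf x)

end

theorem conv_congr {f g : Plane → ℂ} (K : 𝓢(Plane, ℂ)) (h : f =ᵐ[volume] g) :
    conv K f = conv K g := by
  ext x
  exact integral_congr_ae (h.mono fun y hy => by simp only [hy])

/-- Differentiation under the integral. The decay of the derivative of the kernel supplies a weight
in the conjugate Lebesgue space, hence a dominating function that is uniform on a unit ball of base
points. -/
theorem integrable_and_hasFDerivAt_conv {p : ℝ≥0∞} [hp : Fact (1 ≤ p)] {f : Plane → ℂ} (K : 𝓢(Plane, ℂ))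
    (hf : MemLp f p volume) (x : Plane) :
    Integrable (fun y => f y • fderiv ℝ K (x - y)) ∧
      HasFDerivAt (conv K f) (∫ y, f y • fderiv ℝ K (x - y)) x := by
  have := ENNReal.HolderConjugate.inv_one_sub_inv' hp.out
  obtain ⟨k, hk⟩ := Measure.HasTemperateGrowth.exists_eLpNorm_lt_top (1 - p⁻¹)⁻¹
    (μ := (volume : Measure Plane)) inferInstance
  obtain ⟨C, hC⟩ : ∃ C : ℝ, ∀ z, (1 + ‖z‖) ^ k * ‖fderiv ℝ K z‖ ≤ C := by
    refine ⟨2 ^ k * (Finset.Iic (k, 1)).sup (fun m => SchwartzMap.seminorm ℝ m.1 m.2) K,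
      fun z => ?_⟩
    rw [← norm_iteratedFDeriv_one]
    exact SchwartzMap.one_add_le_sup_seminorm_apply (𝕜 := ℝ) (m := (k, 1)) le_rfl le_rfl K z
  have hC0 : 0 ≤ C := le_trans (by positivity) (hC 0)
  have hw : MemLp (fun y : Plane => (1 + ‖y‖) ^ (-k : ℝ)) (1 - p⁻¹)⁻¹ volume := by
    refine ⟨Continuous.aestronglyMeasurable ?_, hk⟩
    exact .rpow_const (by fun_prop) fun y => .inl (by positivity)
  have hw' : MemLp (fun y : Plane => (1 + ‖x - y‖) ^ (-k : ℝ)) (1 - p⁻¹)⁻¹ volume :=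
    hw.comp_measurePreserving (Measure.measurePreserving_sub_left volume x)
  have hint : Integrable (fun y => C * 2 ^ k * (‖f y‖ * (1 + ‖x - y‖) ^ (-k : ℝ))) :=
    (hf.norm.integrable_mul hw').const_mul _
  have hpt : ∀ z, ‖fderiv ℝ K z‖ ≤ C * (1 + ‖z‖) ^ (-k : ℝ) := fun z => by
    have h0 : (0 : ℝ) < 1 + ‖z‖ := by positivity
    rw [Real.rpow_neg h0.le, Real.rpow_natCast, ← div_eq_mul_inv, le_div_iff₀ (by positivity),
      mul_comm]
    exact hC z
  have hmeas : AEStronglyMeasurable (fun y => f y • fderiv ℝ K (x - y)) volume := by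
    have : Continuous (fderiv ℝ K) := (K.smooth 1).continuous_fderiv one_ne_zero
    exact hf.1.smul (this.comp (by fun_prop : Continuous fun y => x - y)).aestronglyMeasurable
  -- For |z - x| < 1 one has 1 + |x - y| ≤ 2 (1 + |z - y|), which costs the factor `2 ^ k`.
  have hb : ∀ y, ∀ z ∈ Metric.ball x 1, ‖f y • fderiv ℝ K (z - y)‖ ≤
      C * 2 ^ k * (‖f y‖ * (1 + ‖x - y‖) ^ (-k : ℝ)) := fun y z hz => by
    rw [norm_smul, mul_comm, mul_comm (‖f y‖), ← mul_assoc]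
    gcongr
    refine (hpt _).trans ?_
    rw [mul_assoc]
    gcongr
    have h1 : (0 : ℝ) < 1 + ‖z - y‖ := by positivity
    have h2 : (0 : ℝ) < 1 + ‖x - y‖ := by positivity
    rw [Real.rpow_neg h1.le, Real.rpow_neg h2.le, Real.rpow_natCast, Real.rpow_natCast,
      ← div_eq_mul_inv, inv_le_comm₀ (by positivity) (by positivity), inv_div, ← div_pow]
    gcongr
    rw [div_le_iff₀ two_pos]
    have h3 : ‖x - y‖ ≤ ‖x - z‖ + ‖z - y‖ := by
      simpa using norm_add_le (x - z) (z - y)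
    have h4 : ‖x - z‖ < 1 := by
      rw [← dist_eq_norm, dist_comm]; exact hz
    nlinarith [norm_nonneg (z - y)]
  refine ⟨hint.mono' hmeas (ae_of_all _ fun y => hb y x (Metric.mem_ball_self one_pos)), ?_⟩
  refine hasFDerivAt_integral_of_dominated_of_fderiv_le (F := fun x y => K (x - y) * f y)
    (F' := fun x y => f y • fderiv ℝ K (x - y)) (Metric.ball_mem_nhds x one_pos)
    (Eventually.of_forall fun z => (integrable_kernel_mul K hf z).1)
    (integrable_kernel_mul K hf x) hmeas (ae_of_all _ hb) hint ?_
  · refine ae_of_all _ fun y z _ => ?_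
    have h1 : HasFDerivAt (fun w => K (w - y)) (fderiv ℝ K (z - y)) z := by
      have := (K.hasFDerivAt (z - y)).comp z ((hasFDerivAt_id z).sub_const y)
      simpa using! this
    simpa using! h1.mul_const (f y)

theorem fderiv_conv_apply {p : ℝ≥0∞} [hp : Fact (1 ≤ p)] {f : Plane → ℂ} (K : 𝓢(Plane, ℂ))
    (hf : MemLp f p volume) (x v : Plane) :
    fderiv ℝ (conv K f) x v = conv (∂_{v} K) f x := by
  obtain ⟨hi, hd⟩ := integrable_and_hasFDerivAt_conv K hf x
  rw [hd.fderiv, ContinuousLinearMap.integral_apply hi]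
  refine integral_congr_ae (ae_of_all _ fun y => ?_)
  simp [SchwartzMap.lineDerivOp_apply_eq_fderiv, mul_comm]

theorem differentiable_conv {p : ℝ≥0∞} [hp : Fact (1 ≤ p)] {f : Plane → ℂ} (K : 𝓢(Plane, ℂ))
    (hf : MemLp f p volume) : Differentiable ℝ (conv K f) :=
  fun x => (integrable_and_hasFDerivAt_conv K hf x).2.differentiableAt

theorem continuous_conv {p : ℝ≥0∞} [hp : Fact (1 ≤ p)] {f : Plane → ℂ} (K : 𝓢(Plane, ℂ))
    (hf : MemLp f p volume) : Continuous (conv K f) :=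
  (differentiable_conv K hf).continuous

/-- Young's inequality `‖K * f‖_p ≤ ‖K‖_1 ‖f‖_p`. -/
theorem eLpNorm_conv_le {p : ℝ≥0∞} [hp : Fact (1 ≤ p)] (hpt : p ≠ ⊤) {f : Plane → ℂ}
    (K : 𝓢(Plane, ℂ)) (hf : MemLp f p volume) :
    eLpNorm (conv K f) p volume ≤ eLpNorm K 1 volume * eLpNorm f p volume := by
  have hp0 : p ≠ 0 := (zero_lt_one.trans_le hp.out).ne'
  set r := p.toReal
  have hr : 1 ≤ r := by
    have := ENNReal.toReal_mono hpt hp.out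
    simpa using this
  have hr0 : 0 < r := zero_lt_one.trans_le hr
  rw [eLpNorm_eq_lintegral_rpow_enorm_toReal hp0 hpt, eLpNorm_eq_lintegral_rpow_enorm_toReal hp0 hpt,
    eLpNorm_one_eq_lintegral_enorm]
  have hfm : AEMeasurable (fun y => ‖f y‖ₑ) volume := hf.1.enorm
  have hKm : Measurable (fun y => ‖K y‖ₑ) := K.continuous.enorm.measurable
  -- Hölder against the weight |K(x - ·)| already yields `r - 1` of the `r` powers of ‖K‖₁; Tonelli
  -- gives the last one.
  have key : ∀ x, ‖conv K f x‖ₑ ^ r ≤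
      (∫⁻ y, ‖K y‖ₑ) ^ (r - 1) * ∫⁻ y, ‖K (x - y)‖ₑ * ‖f y‖ₑ ^ r := fun x => by
    have h1 : ‖conv K f x‖ₑ ≤ ∫⁻ y, ‖K (x - y)‖ₑ * ‖f y‖ₑ := by
      refine (enorm_integral_le_lintegral_enorm _).trans_eq ?_
      simp [enorm_mul]
    refine (ENNReal.rpow_le_rpow h1 hr0.le).trans
      ((lintegral_mul_rpow_le hr (by fun_prop) hfm).trans_eq ?_)
    rw [lintegral_sub_left_eq_self (fun y => ‖K y‖ₑ) x]
  have hsum : ∫⁻ x, ‖conv K f x‖ₑ ^ r ≤ (∫⁻ y, ‖K y‖ₑ) ^ r * ∫⁻ y, ‖f y‖ₑ ^ r := by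
    calc ∫⁻ x, ‖conv K f x‖ₑ ^ r
        ≤ ∫⁻ x, (∫⁻ y, ‖K y‖ₑ) ^ (r - 1) * ∫⁻ y, ‖K (x - y)‖ₑ * ‖f y‖ₑ ^ r :=
          lintegral_mono key
      _ = (∫⁻ y, ‖K y‖ₑ) ^ (r - 1) * ∫⁻ x, ∫⁻ y, ‖K (x - y)‖ₑ * ‖f y‖ₑ ^ r := by
          refine lintegral_const_mul' _ _ (ENNReal.rpow_ne_top_of_nonneg (by linarith) ?_)
          have := (K.memLp 1 volume).eLpNorm_ne_top
          rwa [eLpNorm_one_eq_lintegral_enorm] at this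
      _ = (∫⁻ y, ‖K y‖ₑ) ^ (r - 1) * ∫⁻ y, ∫⁻ x, ‖K (x - y)‖ₑ * ‖f y‖ₑ ^ r := by
          rw [lintegral_lintegral_swap]
          have h1 : AEMeasurable (fun z : Plane × Plane => ‖f z.2‖ₑ ^ r) (volume.prod volume) :=
            (hfm.pow_const r).comp_quasiMeasurePreserving Measure.quasiMeasurePreserving_snd
          have h2 : Measurable (fun z : Plane × Plane => ‖K (z.1 - z.2)‖ₑ) :=
            hKm.comp (by fun_prop)
          exact h2.aemeasurable.mul h1
      _ = (∫⁻ y, ‖K y‖ₑ) ^ (r - 1) * ((∫⁻ y, ‖K y‖ₑ) * ∫⁻ y, ‖f y‖ₑ ^ r) := by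
          congr 1
          rw [← lintegral_const_mul'' _ (hfm.pow_const r)]
          refine lintegral_congr fun y => ?_
          rw [lintegral_mul_const _ (f := fun x => ‖K (x - y)‖ₑ) (hKm.comp (by fun_prop)),
            lintegral_sub_right_eq_self (fun x => ‖K x‖ₑ) y]
      _ = _ := by
          rw [← mul_assoc]
          congr 1
          nth_rw 2 [← ENNReal.rpow_one (∫⁻ y, ‖K y‖ₑ)]
          rw [← ENNReal.rpow_add_of_nonneg _ _ (by linarith) zero_le_one]
          congr 1; ring
  calc (∫⁻ x, ‖conv K f x‖ₑ ^ r) ^ (1 / r)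
      ≤ ((∫⁻ y, ‖K y‖ₑ) ^ r * ∫⁻ y, ‖f y‖ₑ ^ r) ^ (1 / r) :=
        ENNReal.rpow_le_rpow hsum (by positivity)
    _ = _ := by
        rw [ENNReal.mul_rpow_of_nonneg _ _ (by positivity), ← ENNReal.rpow_mul,
          mul_one_div_cancel hr0.ne', ENNReal.rpow_one]

theorem memLp_conv {p : ℝ≥0∞} [hp : Fact (1 ≤ p)] (hpt : p ≠ ⊤) {f : Plane → ℂ}
    (K : 𝓢(Plane, ℂ)) (hf : MemLp f p volume) : MemLp (conv K f) p volume :=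
  ⟨(continuous_conv K hf).aestronglyMeasurable, (eLpNorm_conv_le hpt K hf).trans_lt
    (ENNReal.mul_lt_top (K.eLpNorm_lt_top 1 volume) hf.eLpNorm_lt_top)⟩


end

section

/-! ### Fourier multipliers with Schwartz symbols -/

theorem fourierInv_apply_neg (m : 𝓢(Plane, ℂ)) (x : Plane) : 𝓕⁻ m x = 𝓕 m (-x) := by
  simp [SchwartzMap.fourierInv_apply_eq]

theorem fourier_apply_neg (m : 𝓢(Plane, ℂ)) (x : Plane) : 𝓕 m x = 𝓕⁻ m (-x) := by
  simp [fourierInv_apply_neg]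

/-- The Fourier multiplier with Schwartz symbol `m` on tempered distributions. -/
def mult (m : 𝓢(Plane, ℂ)) : Distr →L[ℂ] Distr :=
  TemperedDistribution.fourierMultiplierCLM ℂ m

/-- The Fourier multiplier with Schwartz symbol `m` on functions, as a convolution. -/
def cv (m : 𝓢(Plane, ℂ)) (f : Plane → ℂ) : Plane → ℂ := conv (𝓕⁻ m) f

/-- By the convolution theorem, the transposed multiplier applied to a test function is its
convolution with the reflected kernel. -/
theorem fourier_smul_fourierInv_apply (m g : 𝓢(Plane, ℂ)) (y : Plane) :
    𝓕 (SchwartzMap.smulLeftCLM ℂ m (𝓕⁻ g)) y = ∫ x, g x * 𝓕⁻ m (x - y) := by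
  set c := SchwartzMap.convolution (ContinuousLinearMap.mul ℂ ℂ) g (𝓕 m) with hc
  have h1 : 𝓕⁻ c = SchwartzMap.smulLeftCLM ℂ m (𝓕⁻ g) := by
    ext ξ
    rw [fourierInv_apply_neg, hc, SchwartzMap.fourier_convolution,
      SchwartzMap.pairing_apply_apply,
      SchwartzMap.smulLeftCLM_apply_apply m.hasTemperateGrowth, fourierInv_apply_neg,
      ContinuousLinearMap.mul_apply', ← fourierInv_apply_neg (𝓕 m), FourierTransform.fourierInv_fourier_eq,
      smul_eq_mul, mul_comm]
  rw [← h1, FourierTransform.fourier_fourierInv_eq, hc, SchwartzMap.convolution_apply]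
  refine integral_congr_ae (ae_of_all _ fun x => ?_)
  simp only [ContinuousLinearMap.mul_apply']
  rw [fourier_apply_neg, neg_sub]

/-- The function `f ∈ L^p` represents the distribution `T`. -/
structure Rep (p : ℝ≥0∞) (f : Plane → ℂ) (T : Distr) : Prop where
  memLp : MemLp f p volume
  apply : ∀ g : 𝓢(Plane, ℂ), T g = ∫ x, g x * f x

section Rep

variable {p q : ℝ≥0∞} [hp : Fact (1 ≤ p)] [hq : Fact (1 ≤ q)] {f g : Plane → ℂ} {S T : Distr}

theorem rep_Lp (F : Lp ℂ p (volume : Measure Plane)) : Rep p F (F : Distr) :=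
  ⟨Lp.memLp F, fun g => by simp⟩

theorem rep_toLp (hf : MemLp f p volume) :
    Rep p f ((hf.toLp : Lp ℂ p (volume : Measure Plane)) : Distr) := by
  refine ⟨hf, fun g => ?_⟩
  simp only [Lp.toTemperedDistribution_apply, smul_eq_mul]
  exact integral_congr_ae (hf.coeFn_toLp.mono fun x hx => by simp only [hx])

theorem Rep.eq_toLp (h : Rep p f T) :
    T = ((h.memLp.toLp : Lp ℂ p (volume : Measure Plane)) : Distr) := by
  ext g
  rw [h.apply, (rep_toLp h.memLp).apply]

theorem Rep.represents (h : Rep p f T) : Represents f T :=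
  ⟨h.memLp.locallyIntegrable hp.out, fun g => ⟨integrable_schwartz_mul g h.memLp, h.apply g⟩⟩

theorem Rep.ae_eq (h : Rep p f T) (h' : Rep q g T) : f =ᵐ[volume] g :=
  h.represents.ae_eq h'.represents

theorem Rep.distNorm_eq (h : Rep p f T) : distNorm p T = eLpNorm f p volume := by
  rw [h.eq_toLp, distNorm_coe, Lp.enorm_toLp]

theorem Rep.distribution_eq (h : Rep p f S) (h' : Rep q f T) : S = T := by
  ext g
  rw [h.apply, h'.apply]

theorem Rep.congr (h : Rep p f T) (hfg : f =ᵐ[volume] g) : Rep p g T :=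
  ⟨(memLp_congr_ae hfg).1 h.memLp, fun φ => by
    rw [h.apply]
    exact integral_congr_ae (hfg.mono fun x hx => by simp only [hx])⟩

theorem Rep.zero : Rep p 0 0 := ⟨MemLp.zero', fun g => by simp⟩

theorem Rep.add (h : Rep p f S) (h' : Rep p g T) : Rep p (f + g) (S + T) :=
  ⟨h.memLp.add h'.memLp, fun φ => by
    have := integral_add (integrable_schwartz_mul φ h.memLp) (integrable_schwartz_mul φ h'.memLp)
    simp only [Pi.add_apply, mul_add, this, ← h.apply, ← h'.apply]
    rfl⟩

theorem Rep.neg (h : Rep p f S) : Rep p (-f) (-S) :=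
  ⟨h.memLp.neg, fun φ => by
    simp only [Pi.neg_apply, mul_neg, integral_neg, ← h.apply]
    rfl⟩

theorem Rep.sub (h : Rep p f S) (h' : Rep p g T) : Rep p (f - g) (S - T) := by
  rw [sub_eq_add_neg, sub_eq_add_neg]
  exact h.add h'.neg

/-- The distributional multiplier acts on the test function; Fubini transfers it to `f`. The double
integral converges absolutely because Hölder bounds the inner integral uniformly in the outer
variable. -/
theorem Rep.cv (hpt : p ≠ ⊤) (m : 𝓢(Plane, ℂ)) (h : Rep p f T) :
    Rep p (cv m f) (mult m T) := by
  refine ⟨memLp_conv hpt _ h.memLp, fun g => ?_⟩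
  rw [mult, TemperedDistribution.fourierMultiplierCLM_apply_apply, h.apply]
  have hK := (𝓕⁻ m : 𝓢(Plane, ℂ)).continuous
  have hmeas : AEStronglyMeasurable (fun z : Plane × Plane => g z.1 * (𝓕⁻ m (z.1 - z.2) * f z.2))
      (volume.prod volume) := by
    have h1 : Continuous (fun z : Plane × Plane => g z.1) := g.continuous.comp continuous_fst
    have h2 : Continuous (fun z : Plane × Plane => 𝓕⁻ m (z.1 - z.2)) :=
      hK.comp (continuous_fst.sub continuous_snd)
    have h3 : AEStronglyMeasurable (fun z : Plane × Plane => f z.2) (volume.prod volume) :=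
      h.memLp.1.comp_quasiMeasurePreserving Measure.quasiMeasurePreserving_snd
    exact h1.aestronglyMeasurable.mul (h2.aestronglyMeasurable.mul h3)
  have hint : Integrable (fun z : Plane × Plane => g z.1 * (𝓕⁻ m (z.1 - z.2) * f z.2))
      (volume.prod volume) := by
    rw [integrable_prod_iff hmeas]
    refine ⟨ae_of_all _ fun x =>
      (integrable_kernel_mul (𝓕⁻ m) h.memLp x).const_mul (g x), ?_⟩
    set C := (eLpNorm (𝓕⁻ m : 𝓢(Plane, ℂ)) (1 - p⁻¹)⁻¹ volume * eLpNorm f p volume).toReal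
    have := ENNReal.HolderConjugate.inv_one_sub_inv' hp.out
    refine (g.integrable.norm.mul_const C).mono' hmeas.norm.integral_prod_right'
      (ae_of_all _ fun x => ?_)
    rw [Real.norm_of_nonneg (integral_nonneg fun _ => norm_nonneg _)]
    simp only [norm_mul (g x), integral_const_mul]
    gcongr
    have hi := integrable_kernel_mul (𝓕⁻ m) h.memLp x
    rw [integral_norm_eq_lintegral_enorm hi.1]
    refine ENNReal.toReal_mono (ENNReal.mul_ne_top (SchwartzMap.eLpNorm_lt_top _ _ volume).ne
      h.memLp.eLpNorm_ne_top) ?_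
    have h2 := eLpNorm_smul_le_mul_eLpNorm (p := (1 - p⁻¹)⁻¹) (q := p) (r := 1) h.memLp.1
      (memLp_kernel_comp_sub (𝓕⁻ m) (1 - p⁻¹)⁻¹ x).1
    rw [eLpNorm_one_eq_lintegral_enorm] at h2
    refine h2.trans_eq ?_
    congr 1
    exact eLpNorm_comp_measurePreserving (g := (𝓕⁻ m : 𝓢(Plane, ℂ)))
      hK.aestronglyMeasurable (Measure.measurePreserving_sub_left volume x)
  calc ∫ y, 𝓕 (SchwartzMap.smulLeftCLM ℂ m (𝓕⁻ g)) y * f y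
      = ∫ y, ∫ x, g x * (𝓕⁻ m (x - y) * f y) := by
        refine integral_congr_ae (ae_of_all _ fun y => ?_)
        simp only [fourier_smul_fourierInv_apply, ← integral_mul_const, mul_assoc]
    _ = ∫ x, ∫ y, g x * (𝓕⁻ m (x - y) * f y) := (integral_integral_swap hint).symm
    _ = _ := by simp only [integral_const_mul]; rfl

end Rep

/-! ### Calculus of symbols -/

/-- The symbol `2πi ξ_k m(ξ)` of `∂_k ∘ m(D)`. -/
def dsym (k : Fin 2) (m : 𝓢(Plane, ℂ)) : 𝓢(Plane, ℂ) :=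
  (2 * Real.pi * Complex.I) • SchwartzMap.smulLeftCLM ℂ (inner ℝ · (e k)) m

theorem dsym_apply (k : Fin 2) (m : 𝓢(Plane, ℂ)) (ξ : Plane) :
    dsym k m ξ = 2 * Real.pi * Complex.I * ξ k * m ξ := by
  have : (fun ξ : Plane => inner ℝ ξ (e k)).HasTemperateGrowth := by fun_prop
  rw [dsym, smul_apply, SchwartzMap.smulLeftCLM_apply_apply this]
  simp [e, EuclideanSpace.inner_single_right]
  ring

/-- The product of two Schwartz symbols. -/
def smul' (m n : 𝓢(Plane, ℂ)) : 𝓢(Plane, ℂ) := SchwartzMap.smulLeftCLM ℂ m n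

theorem smul'_apply (m n : 𝓢(Plane, ℂ)) (ξ : Plane) : smul' m n ξ = m ξ * n ξ := by
  simp [smul', SchwartzMap.smulLeftCLM_apply_apply m.hasTemperateGrowth]

theorem mult_mult (m n : 𝓢(Plane, ℂ)) (T : Distr) : mult m (mult n T) = mult (smul' m n) T := by
  rw [mult, mult, TemperedDistribution.fourierMultiplierCLM_fourierMultiplierCLM_apply
    n.hasTemperateGrowth m.hasTemperateGrowth, mult]
  congr 2
  ext ξ
  simp [smul'_apply, mul_comm]

theorem lineDeriv_mult (k : Fin 2) (m : 𝓢(Plane, ℂ)) (T : Distr) :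
    ∂_{e k} (mult m T) = mult (dsym k m) T := by
  have h1 : (fun ξ : Plane => ((inner ℝ ξ (e k) : ℝ) : ℂ)).HasTemperateGrowth := by fun_prop
  rw [TemperedDistribution.lineDeriv_eq_fourierMultiplierCLM, mult,
    TemperedDistribution.fourierMultiplierCLM_fourierMultiplierCLM_apply
    m.hasTemperateGrowth h1, mult, ← smul_apply,
    ← TemperedDistribution.fourierMultiplierCLM_smul (m.hasTemperateGrowth.mul h1)]
  congr 2
  ext ξ
  simp [dsym_apply, e, EuclideanSpace.inner_single_right]
  ring

theorem mult_lineDeriv (k : Fin 2) (m : 𝓢(Plane, ℂ)) (T : Distr) :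
    mult m (∂_{e k} T) = mult (dsym k m) T := by
  have h1 : (fun ξ : Plane => ((inner ℝ ξ (e k) : ℝ) : ℂ)).HasTemperateGrowth := by fun_prop
  rw [TemperedDistribution.lineDeriv_eq_fourierMultiplierCLM, mult, map_smul,
    TemperedDistribution.fourierMultiplierCLM_fourierMultiplierCLM_apply
    h1 m.hasTemperateGrowth, mult, ← smul_apply,
    ← TemperedDistribution.fourierMultiplierCLM_smul (h1.mul m.hasTemperateGrowth)]
  congr 2
  ext ξ
  simp [dsym_apply, e, EuclideanSpace.inner_single_right]
  ring

theorem mult_add (m n : 𝓢(Plane, ℂ)) (T : Distr) : mult (m + n) T = mult m T + mult n T := by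
  ext g
  simp only [mult, TemperedDistribution.fourierMultiplierCLM_apply_apply,
    add_apply, ← map_add, ← FourierTransform.fourier_add]
  congr 2
  ext ξ
  simp [SchwartzMap.smulLeftCLM_add, SchwartzMap.smulLeftCLM_apply_apply,
    SchwartzMap.hasTemperateGrowth]

theorem mult_smul (c : ℂ) (m : 𝓢(Plane, ℂ)) (T : Distr) : mult (c • m) T = c • mult m T := by
  have := TemperedDistribution.fourierMultiplierCLM_smul (F := ℂ) m.hasTemperateGrowth c
  exact congrArg (· T) this

/-- The partial derivative of a function on the plane. -/
def pd {E : Type*} [NormedAddCommGroup E] [NormedSpace ℝ E] (k : Fin 2) (f : Plane → E)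
    (x : Plane) : E := fderiv ℝ f x (e k)

theorem pd_conv {p : ℝ≥0∞} [Fact (1 ≤ p)] {f : Plane → ℂ} (K : 𝓢(Plane, ℂ))
    (hf : MemLp f p volume) (k : Fin 2) : pd k (conv K f) = conv (∂_{e k} K) f := by
  ext x
  exact fderiv_conv_apply K hf x (e k)

theorem pd_cv {p : ℝ≥0∞} [Fact (1 ≤ p)] {f : Plane → ℂ} (m : 𝓢(Plane, ℂ))
    (hf : MemLp f p volume) (k : Fin 2) : pd k (cv m f) = cv (dsym k m) f := by
  rw [cv, pd_conv _ hf, SchwartzMap.lineDerivOp_fourierInv_eq]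
  rfl

end

section

/-! ### Cubic integrals -/

theorem eLpNorm_three_pow {α F : Type*} [MeasurableSpace α] [NormedAddCommGroup F] {μ : Measure α}
    (f : α → F) :
    eLpNorm f 3 μ ^ 3 = ∫⁻ x, ‖f x‖ₑ ^ 3 ∂μ := by
  have := eLpNorm_nnreal_pow_eq_lintegral (f := f) (μ := μ) (p := 3) (by norm_num)
  simpa using! this

theorem eLpNorm_two_pow {α F : Type*} [MeasurableSpace α] [NormedAddCommGroup F] {μ : Measure α}
    (f : α → F) :
    eLpNorm f 2 μ ^ 2 = ∫⁻ x, ‖f x‖ₑ ^ 2 ∂μ := by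
  have := eLpNorm_nnreal_pow_eq_lintegral (f := f) (μ := μ) (p := 2) (by norm_num)
  simpa using! this

/-- Interpolation of `L³` between `L²` and `L^∞`. -/
theorem eLpNorm_three_pow_le {F : Type*} [NormedAddCommGroup F] {f : Plane → F} {B : ℝ≥0∞}
    (hB : ∀ x, ‖f x‖ₑ ≤ B) (hBt : B ≠ ⊤) :
    eLpNorm f 3 volume ^ 3 ≤ B * eLpNorm f 2 volume ^ 2 := by
  rw [eLpNorm_three_pow, eLpNorm_two_pow, ← lintegral_const_mul' _ _ hBt]
  refine lintegral_mono fun x => ?_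
  rw [pow_succ' _ 2]
  gcongr
  exact hB x

theorem memLp_three_of_two_of_bounded {F : Type*} [NormedAddCommGroup F] {f : Plane → F}
    (hf : MemLp f 2 volume) {C : ℝ} (hC : ∀ x, ‖f x‖ ≤ C) : MemLp f 3 volume := by
  refine ⟨hf.1, ?_⟩
  have h := eLpNorm_three_pow_le (f := f) (B := ENNReal.ofReal C)
    (fun x => by rw [← ofReal_norm]; exact ENNReal.ofReal_le_ofReal (hC x)) ENNReal.ofReal_ne_top
  have h2 : eLpNorm f 3 volume ^ 3 < ⊤ := h.trans_lt
    (ENNReal.mul_lt_top ENNReal.ofReal_lt_top (ENNReal.pow_lt_top hf.2))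
  by_contra hcon
  rw [not_lt_top_iff.1 hcon] at h2
  simp at h2

theorem memLp_two_of_one_of_bounded {F : Type*} [NormedAddCommGroup F] {f : Plane → F}
    (hf : MemLp f 1 volume) {C : ℝ} (hC : ∀ x, ‖f x‖ ≤ C) : MemLp f 2 volume := by
  refine ⟨hf.1, ?_⟩
  have h2 : eLpNorm f 2 volume ^ 2 < ⊤ := by
    refine lt_of_le_of_lt (b := ENNReal.ofReal C * eLpNorm f 1 volume) ?_
      (ENNReal.mul_lt_top ENNReal.ofReal_lt_top hf.2)
    rw [eLpNorm_two_pow, eLpNorm_one_eq_lintegral_enorm,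
      ← lintegral_const_mul' _ _ ENNReal.ofReal_ne_top]
    refine lintegral_mono fun x => ?_
    rw [sq]
    gcongr
    rw [← ofReal_norm]; exact ENNReal.ofReal_le_ofReal (hC x)
  by_contra hcon
  rw [not_lt_top_iff.1 hcon] at h2
  simp at h2

/-- Hölder's inequality for three functions in `L³`. -/
theorem lintegral_mul_mul_le {α : Type*} [MeasurableSpace α] {μ : Measure α} {f g h : α → ℝ≥0∞}
    (hf : AEMeasurable f μ) (hg : AEMeasurable g μ) (hh : AEMeasurable h μ) :
    ∫⁻ x, f x * g x * h x ∂μ ≤ eLpNorm f 3 μ * eLpNorm g 3 μ * eLpNorm h 3 μ := by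
  -- Hölder with exponents 3 and 3/2, then Cauchy–Schwarz for the 3/2 powers of `f` and `g`.
  have h1 := ENNReal.lintegral_mul_le_Lp_mul_Lq μ
    (p := 3) (q := 3 / 2) (by constructor <;> norm_num) hh (hf.mul hg)
  have h2 := ENNReal.lintegral_mul_le_Lp_mul_Lq μ
    (p := 2) (q := 2) (by constructor <;> norm_num) (hf.pow_const (3 / 2 : ℝ)) (hg.pow_const (3 / 2 : ℝ))
  have e3 : ∀ k : α → ℝ≥0∞, eLpNorm k 3 μ = (∫⁻ x, k x ^ 3 ∂μ) ^ (1 / 3 : ℝ) := fun k => by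
    rw [eLpNorm_eq_lintegral_rpow_enorm_toReal (by norm_num) (by norm_num)]
    simp
  simp only [Pi.mul_apply, ← ENNReal.rpow_mul, ENNReal.mul_rpow_of_nonneg _ _
    (by norm_num : (0 : ℝ) ≤ 3 / 2)] at h1 h2
  norm_num at h1 h2
  rw [e3, e3, e3, mul_comm _ ((∫⁻ x, h x ^ 3 ∂μ) ^ (1 / 3 : ℝ))]
  calc ∫⁻ x, f x * g x * h x ∂μ = ∫⁻ x, h x * (f x * g x) ∂μ := by simp only [mul_comm]
    _ ≤ _ := h1
    _ ≤ (∫⁻ x, h x ^ 3 ∂μ) ^ (1 / 3 : ℝ) *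
        ((∫⁻ x, f x ^ 3 ∂μ) ^ (1 / 2 : ℝ) * (∫⁻ x, g x ^ 3 ∂μ) ^ (1 / 2 : ℝ)) ^
          (2 / 3 : ℝ) := by
        exact mul_le_mul' le_rfl (ENNReal.rpow_le_rpow h2 (by norm_num))
    _ = _ := by
        rw [ENNReal.mul_rpow_of_nonneg _ _ (by norm_num), ← ENNReal.rpow_mul, ← ENNReal.rpow_mul]
        norm_num

/-! ### Pointwise calculus of ‖a‖³ and of ‖a‖ a -/

section Cubic

variable {E : Type*} [NormedAddCommGroup E] [InnerProductSpace ℝ E]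

/-- Second-order expansion of the cube of the norm. -/
theorem abs_norm_add_cube_sub_le (a b : E) :
    |‖a + b‖ ^ 3 - ‖a‖ ^ 3 - 3 * ‖a‖ * inner ℝ a b| ≤ 6 * (‖a‖ * ‖b‖ ^ 2 + ‖b‖ ^ 3) := by
  set r := ‖a‖ with hr
  set s := ‖b‖ with hs
  set t := ‖a + b‖ with ht
  have h1 : t ^ 2 = r ^ 2 + 2 * inner ℝ a b + s ^ 2 := norm_add_sq_real a b
  have h2 : |t - r| ≤ s := by
    have := abs_norm_sub_norm_le (a + b) a
    simpa using this
  have hr0 : 0 ≤ r := norm_nonneg _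
  have hs0 : 0 ≤ s := norm_nonneg _
  have ht0 : 0 ≤ t := norm_nonneg _
  have h3 : 2 * inner ℝ a b = t ^ 2 - r ^ 2 - s ^ 2 := by linarith
  -- With 2⟨a,b⟩ = t² - r² - s² the remainder is explicit, and its first factor is at most s² by the
  -- reverse triangle inequality.
  have h4 : t ^ 3 - r ^ 3 - 3 * r * inner ℝ a b =
      (t - r) ^ 2 * (t + r / 2) + 3 / 2 * r * s ^ 2 := by
    have : 3 * r * inner ℝ a b = 3 / 2 * r * (2 * inner ℝ a b) := by ring
    rw [this, h3]; ring
  obtain ⟨h5, h6⟩ := abs_le.1 h2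
  have h7 : (t - r) ^ 2 ≤ s ^ 2 := sq_le_sq' h5 h6
  rw [h4, abs_of_nonneg (by positivity)]
  have h8 : (t - r) ^ 2 * (t + r / 2) ≤ s ^ 2 * (s + r + r / 2) :=
    mul_le_mul h7 (by linarith) (by positivity) (by positivity)
  nlinarith [mul_nonneg hr0 (sq_nonneg s), pow_nonneg hs0 3]

/-- The derivative of `a ↦ ‖a‖ a`. -/
def normSmulDeriv (a : E) : E →L[ℝ] E :=
  ‖a‖ • ContinuousLinearMap.id ℝ E + (‖a‖⁻¹ • innerSL ℝ a).smulRight a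

theorem normSmulDeriv_apply (a b : E) :
    normSmulDeriv a b = ‖a‖ • b + (‖a‖⁻¹ * inner ℝ a b) • a := by
  simp [normSmulDeriv]

/-- At the origin the map is quadratically small, and `normSmulDeriv` vanishes there by its formula;
elsewhere this is the product rule, with the norm written as the root of its square. -/
theorem hasFDerivAt_norm_smul (a : E) :
    HasFDerivAt (fun a : E => ‖a‖ • a) (normSmulDeriv a) a := by
  by_cases ha : a = 0
  · subst ha
    have : normSmulDeriv (0 : E) = 0 := by ext b; simp [normSmulDeriv_apply]
    rw [this, hasFDerivAt_iff_isLittleO_nhds_zero]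
    simp only [norm_zero, zero_add, zero_smul, sub_zero, zero_apply]
    rw [Asymptotics.isLittleO_iff]
    intro c hc
    filter_upwards [Metric.ball_mem_nhds (0 : E) hc] with x hx
    rw [norm_smul, norm_norm]
    gcongr
    simpa using (mem_ball_zero_iff.1 hx).le
  · have h1 : HasFDerivAt (fun a : E => ‖a‖) (‖a‖⁻¹ • innerSL ℝ a) a := by
      have h0 := (hasStrictFDerivAt_norm_sq a).hasFDerivAt.sqrt (by simpa using ha)
      have h2 : (fun a : E => √(‖a‖ ^ 2)) = fun a => ‖a‖ := by
        ext a; exact Real.sqrt_sq (norm_nonneg a)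
      rw [h2] at h0
      convert! h0 using 1
      rw [Real.sqrt_sq (norm_nonneg a)]
      ext b
      simp
      field_simp
    exact h1.smul (hasFDerivAt_id a)

theorem norm_normSmulDeriv_apply_le (a b : E) : ‖normSmulDeriv a b‖ ≤ 2 * ‖a‖ * ‖b‖ := by
  rw [normSmulDeriv_apply]
  refine (norm_add_le _ _).trans ?_
  rw [norm_smul, norm_smul, norm_norm, norm_mul, norm_inv, norm_norm]
  by_cases ha : ‖a‖ = 0
  · simp [ha]
  have := norm_inner_le_norm (𝕜 := ℝ) a b
  have h2 : ‖a‖⁻¹ * ‖inner ℝ a b‖ * ‖a‖ ≤ ‖a‖⁻¹ * (‖a‖ * ‖b‖) * ‖a‖ := by gcongr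
  have h3 : ‖a‖⁻¹ * (‖a‖ * ‖b‖) * ‖a‖ = ‖a‖ * ‖b‖ := by field_simp
  linarith

/-- The rank-one part contributes ⟨a,b⟩²/‖a‖ ≥ 0. This coercivity is the source of the dissipation
along the heat flow. -/
theorem inner_normSmulDeriv_self_ge (a b : E) : ‖a‖ * ‖b‖ ^ 2 ≤ inner ℝ (normSmulDeriv a b) b := by
  rw [normSmulDeriv_apply, inner_add_left, real_inner_smul_left, real_inner_smul_left,
    real_inner_self_eq_norm_sq, mul_assoc]
  have : 0 ≤ ‖a‖⁻¹ * (inner ℝ a b * inner ℝ a b) :=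
    mul_nonneg (inv_nonneg.2 (norm_nonneg _)) (mul_self_nonneg _)
  linarith

end Cubic

end

section

/-! ### Integration by parts -/

/-- Smooth functions in `L² ∩ L^∞`, with all their derivatives: the algebra generated by
convolutions with Schwartz kernels. -/
inductive Nice : (Plane → ℂ) → Prop
  | conv1 (K : 𝓢(Plane, ℂ)) {f : Plane → ℂ} (hf : MemLp f 1 volume) : Nice (conv K f)
  | conv2 (K : 𝓢(Plane, ℂ)) {f : Plane → ℂ} (hf : MemLp f 2 volume) : Nice (conv K f)
  | add {f g : Plane → ℂ} : Nice f → Nice g → Nice (fun x => f x + g x)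
  | const_mul (c : ℂ) {f : Plane → ℂ} : Nice f → Nice (fun x => c * f x)
  | mul {f g : Plane → ℂ} : Nice f → Nice g → Nice (fun x => f x * g x)

namespace Nice

variable {f g : Plane → ℂ}

theorem differentiable (hf : Nice f) : Differentiable ℝ f := by
  induction hf with
  | conv1 K hf => exact differentiable_conv K hf
  | conv2 K hf => exact differentiable_conv K hf
  | add _ _ h1 h2 => exact h1.add h2
  | const_mul c _ h => exact h.const_mul c
  | mul _ _ h1 h2 => exact h1.mul h2

theorem continuous (hf : Nice f) : Continuous f := hf.differentiable.continuous

theorem pd_add (hf : Nice f) (hg : Nice g) (k : Fin 2) (x : Plane) :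
    pd k (fun x => f x + g x) x = pd k f x + pd k g x := by
  simp only [pd]
  rw [fderiv_fun_add (hf.differentiable x) (hg.differentiable x)]
  rfl

theorem pd_const_mul (c : ℂ) (hf : Nice f) (k : Fin 2) (x : Plane) :
    pd k (fun x => c * f x) x = c * pd k f x := by
  simp only [pd]
  rw [fderiv_const_mul (hf.differentiable x)]
  rfl

theorem pd_mul (hf : Nice f) (hg : Nice g) (k : Fin 2) (x : Plane) :
    pd k (fun x => f x * g x) x = f x * pd k g x + g x * pd k f x := by
  simp only [pd]
  rw [fderiv_fun_mul (hf.differentiable x) (hg.differentiable x)]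
  rfl

/-- Derivatives fall on the kernels, so the class is closed under differentiation, and integrations
by parts can be iterated without boundary terms. -/
theorem pd_nice (hf : Nice f) (k : Fin 2) : Nice (pd k f) := by
  induction hf with
  | conv1 K hf => rw [pd_conv K hf]; exact .conv1 _ hf
  | conv2 K hf => rw [pd_conv K hf]; exact .conv2 _ hf
  | add h1 h2 i1 i2 => rw [funext (pd_add h1 h2 k)]; exact i1.add i2
  | const_mul c h i => rw [funext (pd_const_mul c h k)]; exact i.const_mul c
  | mul h1 h2 i1 i2 => rw [funext (pd_mul h1 h2 k)]; exact (h1.mul i2).add (h2.mul i1)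

theorem bounded (hf : Nice f) : ∃ C : ℝ, ∀ x, ‖f x‖ ≤ C := by
  induction hf with
  | conv1 K hf => exact exists_norm_conv_le K hf
  | conv2 K hf => exact exists_norm_conv_le K hf
  | add _ _ i1 i2 =>
    obtain ⟨C, hC⟩ := i1
    obtain ⟨D, hD⟩ := i2
    exact ⟨C + D, fun x => (norm_add_le _ _).trans (add_le_add (hC x) (hD x))⟩
  | const_mul c _ i =>
    obtain ⟨C, hC⟩ := i
    exact ⟨‖c‖ * C, fun x => by rw [norm_mul]; gcongr; exact hC x⟩
  | mul _ _ i1 i2 =>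
    obtain ⟨C, hC⟩ := i1
    obtain ⟨D, hD⟩ := i2
    exact ⟨C * D, fun x => by
      rw [norm_mul]
      exact mul_le_mul (hC x) (hD x) (norm_nonneg _) ((norm_nonneg _).trans (hC x))⟩

theorem memLp_top (hf : Nice f) : MemLp f ⊤ volume := by
  obtain ⟨C, hC⟩ := hf.bounded
  exact memLp_top_of_bound hf.continuous.aestronglyMeasurable C (ae_of_all _ hC)

theorem memLp_two (hf : Nice f) : MemLp f 2 volume := by
  induction hf with
  | conv1 K hf =>
    obtain ⟨C, hC⟩ := exists_norm_conv_le K hf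
    exact memLp_two_of_one_of_bounded (memLp_conv (by simp) K hf) hC
  | conv2 K hf => exact memLp_conv (by simp) K hf
  | add _ _ i1 i2 => exact i1.add i2
  | const_mul c _ i => exact i.const_mul c
  | mul h1 h2 i1 i2 => exact i2.mul' h1.memLp_top

theorem memLp_three (hf : Nice f) : MemLp f 3 volume := by
  obtain ⟨C, hC⟩ := hf.bounded
  exact memLp_three_of_two_of_bounded hf.memLp_two hC

theorem integrable_mul (hf : Nice f) (hg : Nice g) : Integrable (fun x => f x * g x) :=
  hf.memLp_two.integrable_mul hg.memLp_two

/-- Integration by parts. -/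
theorem integral_mul_pd (hf : Nice f) (hg : Nice g) (k : Fin 2) :
    ∫ x, f x * pd k g x = -∫ x, pd k f x * g x := by
  refine integral_bilinear_hasLineDerivAt_right_eq_neg_left_of_integrable
    (B := ContinuousLinearMap.mul ℝ ℂ) (v := e k)
    ((hf.pd_nice k).integrable_mul hg) (hf.integrable_mul (hg.pd_nice k))
    (hf.integrable_mul hg) (fun x _ => ?_) (fun x _ => ?_)
  · exact (hf.differentiable x).hasFDerivAt.hasLineDerivAt (e k)
  · exact (hg.differentiable x).hasFDerivAt.hasLineDerivAt (e k)

end Nice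

/-! ### L³ pairings and integration by parts against |V|V -/

section Cubic

variable {E : Type*} [NormedAddCommGroup E]

theorem integrable_of_le_norm_mul {F G H : Type*} [NormedAddCommGroup F] [NormedAddCommGroup G]
    [NormedAddCommGroup H] {a : Plane → E} {b : Plane → F} {c : Plane → G} {φ : Plane → H}
    (ha : MemLp a 3 volume) (hb : MemLp b 3 volume) (hc : MemLp c 3 volume)
    (hφ : AEStronglyMeasurable φ volume) {C : ℝ}
    (h : ∀ x, ‖φ x‖ ≤ C * (‖a x‖ * ‖b x‖ * ‖c x‖)) : Integrable φ := by
  have h1 : Integrable (fun x => ‖a x‖ * ‖b x‖ * ‖c x‖) := by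
    refine ⟨(ha.1.norm.mul hb.1.norm).mul hc.1.norm, ?_⟩
    rw [hasFiniteIntegral_iff_enorm]
    simp only [enorm_mul, enorm_norm]
    refine (lintegral_mul_mul_le ha.1.enorm hb.1.enorm hc.1.enorm).trans_lt ?_
    simp only [eLpNorm_enorm]
    exact ENNReal.mul_lt_top (ENNReal.mul_lt_top ha.2 hb.2) hc.2
  exact (h1.const_mul C).mono' hφ (ae_of_all _ h)

/-- The real `L³` norm. -/
def n3 (a : Plane → E) : ℝ := (eLpNorm a 3 volume).toReal

theorem n3_nonneg (a : Plane → E) : 0 ≤ n3 a := ENNReal.toReal_nonneg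

theorem integral_norm_mul_le {F G : Type*} [NormedAddCommGroup F] [NormedAddCommGroup G]
    {a : Plane → E} {b : Plane → F} {c : Plane → G}
    (ha : MemLp a 3 volume) (hb : MemLp b 3 volume) (hc : MemLp c 3 volume) :
    ∫ x, ‖a x‖ * ‖b x‖ * ‖c x‖ ≤ n3 a * n3 b * n3 c := by
  have hm : AEStronglyMeasurable (fun x => ‖a x‖ * ‖b x‖ * ‖c x‖) volume :=
    (ha.1.norm.mul hb.1.norm).mul hc.1.norm
  rw [integral_eq_lintegral_of_nonneg_ae (ae_of_all _ fun x => by positivity) hm,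
    n3, n3, n3, ← ENNReal.toReal_mul, ← ENNReal.toReal_mul]
  refine ENNReal.toReal_mono (ENNReal.mul_ne_top (ENNReal.mul_ne_top ha.2.ne hb.2.ne) hc.2.ne) ?_
  have := lintegral_mul_mul_le ha.1.enorm hb.1.enorm hc.1.enorm
  simp only [eLpNorm_enorm] at this
  refine le_trans (le_of_eq (lintegral_congr fun x => ?_)) this
  rw [ENNReal.ofReal_mul (by positivity), ENNReal.ofReal_mul (by positivity)]
  simp only [ofReal_norm]

theorem n3_pow (a : Plane → E) (ha : MemLp a 3 volume) : n3 a ^ 3 = ∫ x, ‖a x‖ ^ 3 := by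
  rw [n3, ← ENNReal.toReal_pow, eLpNorm_three_pow,
    integral_eq_lintegral_of_nonneg_ae (ae_of_all _ fun x => by positivity) (f := fun x => ‖a x‖ ^ 3) (ha.1.norm.pow 3)]
  congr 1
  refine lintegral_congr fun x => ?_
  rw [ENNReal.ofReal_pow (norm_nonneg _), ofReal_norm]

theorem n3_add_le {a b : Plane → E} (ha : MemLp a 3 volume) (hb : MemLp b 3 volume) :
    n3 (a + b) ≤ n3 a + n3 b := by
  rw [n3, n3, n3, ← ENNReal.toReal_add ha.2.ne hb.2.ne]
  exact ENNReal.toReal_mono (ENNReal.add_ne_top.2 ⟨ha.2.ne, hb.2.ne⟩)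
    (eLpNorm_add_le ha.1 hb.1 (by norm_num))

variable [InnerProductSpace ℝ E]

variable {V B : Plane → E}

theorem aestronglyMeasurable_normSmulDeriv {a b : Plane → E} (ha : AEStronglyMeasurable a volume)
    (hb : AEStronglyMeasurable b volume) :
    AEStronglyMeasurable (fun x => normSmulDeriv (a x) (b x)) volume := by
  simp only [normSmulDeriv_apply]
  have h1 : AEStronglyMeasurable (fun x => ‖a x‖⁻¹) volume :=
    ha.norm.aemeasurable.inv.aestronglyMeasurable
  exact (ha.norm.smul hb).add ((h1.mul (ha.inner hb)).smul ha)

/-- Integration by parts for `∫ |V| V · ∂_k B`. -/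
theorem integral_norm_smul_inner_pd (k : Fin 2) (hV : Differentiable ℝ V) (hB : Differentiable ℝ B)
    (hV3 : MemLp V 3 volume) (hV3' : MemLp (pd k V) 3 volume) (hB3 : MemLp B 3 volume)
    (hB3' : MemLp (pd k B) 3 volume) :
    ∫ x, inner ℝ (‖V x‖ • V x) (pd k B x) =
      -∫ x, inner ℝ (normSmulDeriv (V x) (pd k V x)) (B x) := by
  have m1 := aestronglyMeasurable_normSmulDeriv hV3.1 hV3'.1
  have m2 : AEStronglyMeasurable (fun x => ‖V x‖ • V x) volume := hV3.1.norm.smul hV3.1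
  refine integral_bilinear_hasLineDerivAt_right_eq_neg_left_of_integrable
    (f := fun x => ‖V x‖ • V x) (f' := fun x => normSmulDeriv (V x) (pd k V x))
    (B := innerSL ℝ) (v := e k)
    (integrable_of_le_norm_mul hV3 hV3' hB3 (m1.inner hB3.1) (C := 2) fun x => ?_)
    (integrable_of_le_norm_mul hV3 hV3 hB3' (m2.inner hB3'.1) (C := 1) fun x => ?_)
    (integrable_of_le_norm_mul hV3 hV3 hB3 (m2.inner hB3.1) (C := 1) fun x => ?_)
    (fun x _ => ?_) (fun x _ => ?_)
  · refine (norm_inner_le_norm (𝕜 := ℝ) _ _).trans ?_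
    have := norm_normSmulDeriv_apply_le (V x) (pd k V x)
    nlinarith [norm_nonneg (B x)]
  · refine (norm_inner_le_norm (𝕜 := ℝ) _ _).trans ?_
    simp [norm_smul]
  · refine (norm_inner_le_norm (𝕜 := ℝ) _ _).trans ?_
    simp [norm_smul]
  · have := (hasFDerivAt_norm_smul (V x)).comp x (hV x).hasFDerivAt
    exact this.hasLineDerivAt (e k)
  · exact (hB x).hasFDerivAt.hasLineDerivAt (e k)

end Cubic

end

section

/-! ### The Littlewood-Paley inequality `‖∑ f_q‖_3² ≤ C ∑ ‖f_q‖_3²` -/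

section TypeTwo

variable {E : Type*} [NormedAddCommGroup E]

theorem integrable_norm_mul {F G : Type*} [NormedAddCommGroup F] [NormedAddCommGroup G]
    {a : Plane → E} {b : Plane → F} {c : Plane → G}
    (ha : MemLp a 3 volume) (hb : MemLp b 3 volume) (hc : MemLp c 3 volume) :
    Integrable (fun x => ‖a x‖ * ‖b x‖ * ‖c x‖) :=
  integrable_of_le_norm_mul ha hb hc ((ha.1.norm.mul hb.1.norm).mul hc.1.norm) (C := 1)
    fun x => by simp

theorem n3_sum_le {ι : Type*} (s : Finset ι) {f : ι → Plane → E}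
    (hf : ∀ i ∈ s, MemLp (f i) 3 volume) : n3 (∑ i ∈ s, f i) ≤ ∑ i ∈ s, n3 (f i) := by
  classical
  induction s using Finset.induction_on with
  | empty => simp [n3]
  | insert i s hi ih =>
    rw [Finset.sum_insert hi, Finset.sum_insert hi]
    refine (n3_add_le (hf i (by simp)) (memLp_finsetSum' _ fun j hj => hf j (by simp [hj]))).trans ?_
    gcongr
    exact ih fun j hj => hf j (by simp [hj])

theorem integrable_norm_cube {a : Plane → E} (ha : MemLp a 3 volume) :
    Integrable (fun x => ‖a x‖ ^ 3) :=
  (integrable_norm_mul ha ha ha).congr (ae_of_all _ fun x => by ring)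

variable [InnerProductSpace ℝ E]

theorem integrable_norm_smul_inner {a b : Plane → E}
    (ha : MemLp a 3 volume) (hb : MemLp b 3 volume) :
    Integrable (fun x => inner ℝ (‖a x‖ • a x) (b x)) := by
  have hm : AEStronglyMeasurable (fun x => ‖a x‖ • a x) volume := ha.1.norm.smul ha.1
  refine integrable_of_le_norm_mul ha ha hb (hm.inner hb.1) (C := 1) fun x => ?_
  refine (norm_inner_le_norm (𝕜 := ℝ) _ _).trans ?_
  simp [norm_smul]

/-- The smoothness of the L³ norm: the pointwise expansion, integrated with Hölder. The linear term
is kept exactly because its size is gained later by an integration by parts. -/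
theorem abs_n3_add_cube_sub_le {a b : Plane → E} (ha : MemLp a 3 volume) (hb : MemLp b 3 volume) :
    |n3 (a + b) ^ 3 - n3 a ^ 3 - 3 * ∫ x, inner ℝ (‖a x‖ • a x) (b x)| ≤
      6 * (n3 a * n3 b ^ 2 + n3 b ^ 3) := by
  have i1 := integrable_norm_cube (ha.add hb)
  have i2 := integrable_norm_cube ha
  have i3 := integrable_norm_smul_inner ha hb
  have i4 := integrable_norm_mul ha hb hb
  have i5 := integrable_norm_mul hb hb hb
  rw [n3_pow _ (ha.add hb), n3_pow _ ha, ← integral_sub i1 i2, ← integral_const_mul,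
    ← integral_sub (f := fun x => ‖(a + b) x‖ ^ 3 - ‖a x‖ ^ 3) (i1.sub i2) (i3.const_mul 3)]
  refine (abs_integral_le_integral_abs).trans ?_
  calc ∫ x, |‖(a + b) x‖ ^ 3 - ‖a x‖ ^ 3 - 3 * inner ℝ (‖a x‖ • a x) (b x)|
      ≤ ∫ x, 6 * (‖a x‖ * ‖b x‖ * ‖b x‖ + ‖b x‖ * ‖b x‖ * ‖b x‖) := by
        refine integral_mono ((i1.sub i2).sub (i3.const_mul 3)).abs ((i4.add i5).const_mul 6)
          fun x => ?_
        have := abs_norm_add_cube_sub_le (a x) (b x)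
        simp only [Pi.add_apply, real_inner_smul_left]
        rw [← mul_assoc]
        refine this.trans_eq (by ring)
    _ ≤ 6 * (n3 a * n3 b ^ 2 + n3 b ^ 3) := by
        rw [integral_const_mul, integral_add i4 i5]
        have h1 := integral_norm_mul_le ha hb hb
        have h2 := integral_norm_mul_le hb hb hb
        nlinarith

/-- Used with `V` of lower frequency than `B`: the derivative is paid at the frequency of `V`. -/
theorem integral_norm_smul_inner_pd_le (k : Fin 2) {V B : Plane → E} (hV : Differentiable ℝ V)
    (hB : Differentiable ℝ B) (hV3 : MemLp V 3 volume) (hV3' : MemLp (pd k V) 3 volume)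
    (hB3 : MemLp B 3 volume) (hB3' : MemLp (pd k B) 3 volume) :
    ∫ x, inner ℝ (‖V x‖ • V x) (pd k B x) ≤ 2 * (n3 V * n3 (pd k V) * n3 B) := by
  rw [integral_norm_smul_inner_pd k hV hB hV3 hV3' hB3 hB3', ← integral_neg]
  calc ∫ x, -inner ℝ (normSmulDeriv (V x) (pd k V x)) (B x)
      ≤ ∫ x, 2 * (‖V x‖ * ‖pd k V x‖ * ‖B x‖) := by
        refine integral_mono ?_ ((integrable_norm_mul hV3 hV3' hB3).const_mul 2) fun x => ?_
        · refine (integrable_of_le_norm_mul hV3 hV3' hB3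
            ((aestronglyMeasurable_normSmulDeriv hV3.1 hV3'.1).inner hB3.1) (C := 2)
            fun x => ?_).neg
          refine (norm_inner_le_norm (𝕜 := ℝ) _ _).trans ?_
          have := norm_normSmulDeriv_apply_le (V x) (pd k V x)
          nlinarith [norm_nonneg (B x)]
        · have h1 := norm_normSmulDeriv_apply_le (V x) (pd k V x)
          have h2 := (neg_le_abs _).trans
            (abs_real_inner_le_norm (normSmulDeriv (V x) (pd k V x)) (B x))
          simp only
          nlinarith [norm_nonneg (B x)]
    _ ≤ _ := by
        rw [integral_const_mul]
        exact mul_le_mul_of_nonneg_left (integral_norm_mul_le hV3 hV3' hB3) zero_le_two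

/-- A discrete Hardy inequality. The averages obey s_(n+1) = (s_n + c_n)/2, and convexity of the
square makes the bound of ∑ s_n² telescope with the surplus 2 s_N²; then 2 c s ≤ c² + s². -/
theorem sum_mul_dyadic_average_le (c : ℕ → ℝ) (N : ℕ) :
    ∑ n ∈ Finset.range N, c n * ((2⁻¹ : ℝ) ^ n * ∑ m ∈ Finset.range n, 2 ^ m * c m) ≤
      ∑ n ∈ Finset.range N, c n ^ 2 := by
  set s : ℕ → ℝ := fun n => (2⁻¹ : ℝ) ^ n * ∑ m ∈ Finset.range n, 2 ^ m * c m with hs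
  have hrec : ∀ n, s (n + 1) = (s n + c n) / 2 := fun n => by
    simp only [hs, Finset.sum_range_succ, pow_succ]
    have : (2⁻¹ : ℝ) ^ n * 2 ^ n = 1 := by rw [← mul_pow]; norm_num
    linear_combination (c n / 2) * this
  have key : ∀ N, ∑ n ∈ Finset.range N, s n ^ 2 + 2 * s N ^ 2 ≤ ∑ n ∈ Finset.range N, c n ^ 2 := by
    intro N
    induction N with
    | zero => simp [hs]
    | succ N ih =>
      rw [Finset.sum_range_succ, Finset.sum_range_succ, hrec]
      nlinarith [sq_nonneg (s N - c N)]
  have h1 : ∑ n ∈ Finset.range N, c n * s n ≤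
      ∑ n ∈ Finset.range N, (c n ^ 2 / 2 + s n ^ 2 / 2) :=
    Finset.sum_le_sum fun n _ => by nlinarith [sq_nonneg (c n - s n)]
  rw [Finset.sum_add_distrib, ← Finset.sum_div, ← Finset.sum_div] at h1
  change ∑ n ∈ Finset.range N, c n * s n ≤ _
  linarith [key N, sq_nonneg (s N)]

/-- If `b_n` and its derivatives have the `L³` size of a function at frequency `2^n`, and `b_n` is
the divergence of functions of size `2^{-n} c_n`, then `‖∑ b_n‖_3² ≲ ∑ c_n²`. -/
theorem n3_sum_sq_le {b : ℕ → Plane → E} {B : ℕ → Fin 2 → Plane → E} {c : ℕ → ℝ} {L : ℝ}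
    (hb : ∀ n, Differentiable ℝ (b n)) (hb3 : ∀ n, MemLp (b n) 3 volume)
    (hb3' : ∀ n k, MemLp (pd k (b n)) 3 volume)
    (hB : ∀ n k, Differentiable ℝ (B n k)) (hB3 : ∀ n k, MemLp (B n k) 3 volume)
    (hB3' : ∀ n k, MemLp (pd k (B n k)) 3 volume)
    (hbc : ∀ n, n3 (b n) ≤ c n) (hbc' : ∀ n k, n3 (pd k (b n)) ≤ L * (2 ^ n * c n))
    (hBc : ∀ n k, n3 (B n k) ≤ L * ((2⁻¹ : ℝ) ^ n * c n))
    (hdiv : ∀ n, 1 ≤ n → ∀ x, b n x = ∑ k, pd k (B n k) x) (hL : 0 ≤ L) (N : ℕ) :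
    n3 (∑ n ∈ Finset.range N, b n) ^ 2 ≤ (12 * L ^ 2 + 18) * ∑ n ∈ Finset.range N, c n ^ 2 := by
  set A : ℕ → Plane → E := fun n => ∑ m ∈ Finset.range n, b m with hA
  have hc0 : ∀ n, 0 ≤ c n := fun n => (n3_nonneg _).trans (hbc n)
  have hA3 : ∀ n, MemLp (A n) 3 volume := fun n => memLp_finsetSum' _ fun m _ => hb3 m
  have hAd : ∀ n, Differentiable ℝ (A n) := fun n => by
    simp only [hA]
    exact Differentiable.sum fun m _ => hb m
  have hApd : ∀ n k, pd k (A n) = ∑ m ∈ Finset.range n, pd k (b m) := fun n k => by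
    ext x
    simp only [pd, hA, Finset.sum_apply]
    rw [fderiv_sum fun m _ => hb m x]
    simp
  have hA3' : ∀ n k, MemLp (pd k (A n)) 3 volume := fun n k => by
    rw [hApd]; exact memLp_finsetSum' _ fun m _ => hb3' m k
  have hAn' : ∀ n k, n3 (pd k (A n)) ≤ L * ∑ m ∈ Finset.range n, 2 ^ m * c m := fun n k => by
    rw [hApd, Finset.mul_sum]
    exact (n3_sum_le _ fun m _ => hb3' m k).trans (Finset.sum_le_sum fun m _ => hbc' m k)
  -- The partial sum of largest norm `M` is estimated instead of the last one: every step then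
  -- carries a factor `M`, and M³ ≤ M·(…) can be divided by `M`.
  obtain ⟨n₀, hn₀, hmax⟩ := Finset.exists_max_image (Finset.range (N + 1)) (fun n => n3 (A n))
    ⟨0, by simp⟩
  set M := n3 (A n₀) with hM
  have hM0 : 0 ≤ M := n3_nonneg _
  have hAM : ∀ n ≤ N, n3 (A n) ≤ M := fun n hn => hmax n (by simp; omega)
  have hstep : ∀ n < N, n3 (A (n + 1)) ^ 3 - n3 (A n) ^ 3 ≤ M * (12 * L ^ 2 *
      (c n * ((2⁻¹ : ℝ) ^ n * ∑ m ∈ Finset.range n, 2 ^ m * c m)) + 18 * c n ^ 2) := by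
    intro n hn
    have hsucc : A (n + 1) = A n + b n := Finset.sum_range_succ _ _
    have hbM : n3 (b n) ≤ 2 * M := by
      have h1 : b n = A (n + 1) + -A n := by rw [hsucc]; abel
      have h2 := n3_add_le (hA3 (n + 1)) (hA3 n).neg
      rw [← h1] at h2
      have h3 : n3 (-A n) = n3 (A n) := by simp [n3]
      rw [h3] at h2
      linarith [hAM n hn.le, hAM (n + 1) hn]
    have hexp := abs_n3_add_cube_sub_le (hA3 n) (hb3 n)
    rw [← hsucc] at hexp
    have hexp' := (abs_le.1 hexp).2
    have hquad : n3 (A n) * n3 (b n) ^ 2 + n3 (b n) ^ 3 ≤ M * (3 * c n ^ 2) := by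
      have h1 : n3 (b n) ^ 2 ≤ c n ^ 2 := pow_le_pow_left₀ (n3_nonneg _) (hbc n) 2
      have h2 : n3 (A n) * n3 (b n) ^ 2 ≤ M * c n ^ 2 :=
        mul_le_mul (hAM n hn.le) h1 (sq_nonneg _) hM0
      have h3 : n3 (b n) * n3 (b n) ^ 2 ≤ 2 * M * c n ^ 2 :=
        mul_le_mul hbM h1 (sq_nonneg _) (by positivity)
      nlinarith
    -- Each of the two directions contributes 2 L² after the integration by parts, and the expansion
    -- multiplies by 3, whence 12 L². The block `b 0` needs no divergence form because `A 0 = 0`.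
    have hlin : ∫ x, inner ℝ (‖A n x‖ • A n x) (b n x) ≤
        M * (4 * L ^ 2 * (c n * ((2⁻¹ : ℝ) ^ n * ∑ m ∈ Finset.range n, 2 ^ m * c m))) := by
      rcases Nat.eq_zero_or_pos n with rfl | hn1
      · simp [hA]
      have h1 : ∫ x, inner ℝ (‖A n x‖ • A n x) (b n x) =
          ∑ k, ∫ x, inner ℝ (‖A n x‖ • A n x) (pd k (B n k) x) := by
        rw [← integral_finsetSum _ fun k _ => integrable_norm_smul_inner (hA3 n) (hB3' n k)]
        refine integral_congr_ae (ae_of_all _ fun x => ?_)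
        simp only [hdiv n hn1 x, inner_sum]
      rw [h1]
      have h2 : ∀ k, ∫ x, inner ℝ (‖A n x‖ • A n x) (pd k (B n k) x) ≤
          2 * (M * (L * ∑ m ∈ Finset.range n, 2 ^ m * c m) * (L * ((2⁻¹ : ℝ) ^ n * c n))) :=
        fun k => by
          refine (integral_norm_smul_inner_pd_le k (hAd n) (hB n k) (hA3 n) (hA3' n k) (hB3 n k)
            (hB3' n k)).trans ?_
          have hs : 0 ≤ ∑ m ∈ Finset.range n, 2 ^ m * c m :=
            Finset.sum_nonneg fun m _ => mul_nonneg (by positivity) (hc0 m)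
          refine mul_le_mul_of_nonneg_left (mul_le_mul (mul_le_mul (hAM n hn.le) (hAn' n k)
            (n3_nonneg _) hM0) (hBc n k) (n3_nonneg _) (by positivity)) zero_le_two
      refine (Finset.sum_le_sum fun k _ => h2 k).trans (le_of_eq ?_)
      rw [Fin.sum_univ_two]
      ring
    nlinarith
  -- Telescoping of the cubes from the empty sum up to the maximal one.
  have htel : M ^ 3 ≤ M * ((12 * L ^ 2 + 18) * ∑ n ∈ Finset.range N, c n ^ 2) := by
    have hn₀' : n₀ ≤ N := by simpa [Nat.lt_succ_iff] using hn₀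
    have h0 : n3 (A 0) = 0 := by simp [hA, n3]
    have h1 := Finset.sum_range_sub (fun n => n3 (A n) ^ 3) n₀
    rw [h0] at h1
    have h2 := Finset.sum_le_sum fun n (hn : n ∈ Finset.range n₀) =>
      hstep n (lt_of_lt_of_le (Finset.mem_range.1 hn) hn₀')
    rw [h1, ← Finset.mul_sum, Finset.sum_add_distrib, ← Finset.mul_sum, ← Finset.mul_sum] at h2
    have h3 := sum_mul_dyadic_average_le c n₀
    have h4 : ∑ n ∈ Finset.range n₀, c n ^ 2 ≤ ∑ n ∈ Finset.range N, c n ^ 2 :=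
      Finset.sum_le_sum_of_subset_of_nonneg (Finset.range_mono hn₀') fun _ _ _ => sq_nonneg _
    have h5 : M ^ 3 ≤ M * (12 * L ^ 2 * ∑ n ∈ Finset.range n₀, c n ^ 2 +
        18 * ∑ n ∈ Finset.range n₀, c n ^ 2) := by
      refine le_trans (by linarith) (h2.trans (mul_le_mul_of_nonneg_left ?_ hM0))
      gcongr
    refine h5.trans (mul_le_mul_of_nonneg_left ?_ hM0)
    rw [← add_mul]
    gcongr
  have hfin : n3 (A N) ≤ M := hAM N le_rfl
  have hsq : n3 (A N) ^ 2 ≤ M ^ 2 := pow_le_pow_left₀ (n3_nonneg _) hfin 2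
  refine hsq.trans ?_
  rcases hM0.eq_or_lt with h | h
  · rw [← h]
    have : 0 ≤ ∑ n ∈ Finset.range N, c n ^ 2 := Finset.sum_nonneg fun _ _ => sq_nonneg _
    nlinarith [mul_nonneg (sq_nonneg L) this]
  · nlinarith

end TypeTwo

end

section

/-! ### Dissipation along the heat flow and second-order Riesz transforms on `L³` -/

section Heat

variable {E : Type*} [NormedAddCommGroup E]

/-- The Laplacian of a function on the plane. -/
def lap [NormedSpace ℝ E] (f : Plane → E) (x : Plane) : E := ∑ k, pd k (pd k f) x

/-- `V` is differentiable at `t` as an `L³`-valued curve, with derivative `V'` and quadratic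
remainder. -/
def HasCubicDeriv [NormedSpace ℝ E] (V : ℝ → Plane → E) (V' : Plane → E) (t : ℝ) : Prop :=
  ∃ C δ : ℝ, 0 < δ ∧ ∀ h, |h| ≤ δ → n3 (V (t + h) - V t - h • V') ≤ C * h ^ 2

variable [InnerProductSpace ℝ E]

theorem abs_integral_norm_smul_inner_le {a b : Plane → E} (ha : MemLp a 3 volume)
    (hb : MemLp b 3 volume) : |∫ x, inner ℝ (‖a x‖ • a x) (b x)| ≤ n3 a * n3 a * n3 b := by
  refine abs_integral_le_integral_abs.trans (le_trans (integral_mono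
    (integrable_norm_smul_inner ha hb).abs (integrable_norm_mul ha ha hb) fun x => ?_)
    (integral_norm_mul_le ha ha hb))
  refine (abs_real_inner_le_norm _ _).trans ?_
  simp [norm_smul]

theorem n3_smul (c : ℝ) (a : Plane → E) : n3 (c • a) = |c| * n3 a := by
  rw [n3, eLpNorm_const_smul, ENNReal.toReal_mul, toReal_enorm, Real.norm_eq_abs, n3]

/-- Chain rule: the increment of the curve is inserted in the expansion of the cubed norm, and
replacing it by its linear part costs only a quadratic error. -/
theorem HasCubicDeriv.hasDerivAt {V : ℝ → Plane → E} {V' : Plane → E} {t : ℝ}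
    (h : HasCubicDeriv V V' t) (hV : ∀ s, MemLp (V s) 3 volume) (hV' : MemLp V' 3 volume) :
    HasDerivAt (fun s => n3 (V s) ^ 3) (3 * ∫ x, inner ℝ (‖V t x‖ • V t x) (V' x)) t := by
  obtain ⟨C, δ, hδ, hC⟩ := h
  have hC0 : 0 ≤ C := by
    have := (n3_nonneg _).trans (hC δ (abs_of_pos hδ).le)
    exact nonneg_of_mul_nonneg_left this (by positivity)
  rw [hasDerivAt_iff_isLittleO_nhds_zero]
  -- For |h| ≤ 1 the quadratic remainder is at most C|h|, so `K` is a local Lipschitz constant of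
  -- the curve.
  set K := n3 V' + C
  have hK0 : 0 ≤ K := add_nonneg (n3_nonneg _) hC0
  have hbig : (fun h : ℝ => n3 (V (t + h)) ^ 3 - n3 (V t) ^ 3 -
      h • (3 * ∫ x, inner ℝ (‖V t x‖ • V t x) (V' x))) =O[𝓝 0] fun h => h ^ 2 := by
    refine Asymptotics.IsBigO.of_bound (6 * (n3 (V t) * K ^ 2 + K ^ 3) +
      3 * (n3 (V t) * n3 (V t) * C)) ?_
    filter_upwards [Metric.closedBall_mem_nhds (0 : ℝ) (lt_min hδ one_pos)] with h hh
    rw [mem_closedBall_zero_iff, Real.norm_eq_abs, le_min_iff] at hh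
    obtain ⟨hh1, hh2⟩ := hh
    set b := V (t + h) - V t with hb
    have hb3 : MemLp b 3 volume := (hV _).sub (hV _)
    have hr3 : MemLp (b - h • V') 3 volume := hb3.sub (hV'.const_smul h)
    have hr := hC h hh1
    have hbn : n3 b ≤ K * |h| := by
      have h1 : b = (b - h • V') + h • V' := by abel
      have h2 := n3_add_le hr3 (hV'.const_smul h)
      rw [← h1, n3_smul] at h2
      have h3 : C * h ^ 2 ≤ C * |h| := by
        rw [← sq_abs]
        nlinarith [abs_nonneg h, mul_nonneg hC0 (abs_nonneg h)]
      calc n3 b ≤ C * |h| + |h| * n3 V' := by linarith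
        _ = K * |h| := by simp only [K]; ring
    have h1 := abs_n3_add_cube_sub_le (hV t) hb3
    have hsum : V t + b = V (t + h) := by simp [hb]
    rw [hsum] at h1
    have h2 := abs_integral_norm_smul_inner_le (hV t) hr3
    have h3 : ∫ x, inner ℝ (‖V t x‖ • V t x) ((b - h • V') x) =
        (∫ x, inner ℝ (‖V t x‖ • V t x) (b x)) - h * ∫ x, inner ℝ (‖V t x‖ • V t x) (V' x) := by
      have hi1 : Integrable (fun x => inner ℝ (‖V t x‖ • V t x) (b x)) :=
        integrable_norm_smul_inner (hV t) hb3
      rw [← integral_const_mul, ← integral_sub hi1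
        ((integrable_norm_smul_inner (hV t) hV').const_mul h)]
      refine integral_congr_ae (ae_of_all _ fun x => ?_)
      simp [inner_sub_right, real_inner_smul_right]
    rw [h3] at h2
    have h4 : n3 b ^ 2 ≤ K ^ 2 * h ^ 2 := by
      rw [← sq_abs h, ← mul_pow]; exact pow_le_pow_left₀ (n3_nonneg _) hbn 2
    have h5 : n3 b ^ 3 ≤ K ^ 3 * h ^ 2 := by
      have : n3 b ^ 3 ≤ (K * |h|) ^ 3 := pow_le_pow_left₀ (n3_nonneg _) hbn 3
      rw [mul_pow, pow_succ |h| 2, sq_abs] at this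
      have h6 : K ^ 3 * (h ^ 2 * |h|) ≤ K ^ 3 * (h ^ 2 * 1) := by gcongr
      linarith
    have h6 : n3 (V t) * n3 (V t) * n3 (b - h • V') ≤ n3 (V t) * n3 (V t) * (C * h ^ 2) :=
      mul_le_mul_of_nonneg_left hr (mul_self_nonneg _)
    have h7 : n3 (V t) * n3 b ^ 2 ≤ n3 (V t) * (K ^ 2 * h ^ 2) :=
      mul_le_mul_of_nonneg_left h4 (n3_nonneg _)
    rw [Real.norm_eq_abs, Real.norm_eq_abs, abs_of_nonneg (sq_nonneg h), smul_eq_mul]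
    generalize n3 (V (t + h)) ^ 3 - n3 (V t) ^ 3 = X at h1 ⊢
    generalize ∫ x, inner ℝ (‖V t x‖ • V t x) (V' x) = J at h2 ⊢
    generalize ∫ x, inner ℝ (‖V t x‖ • V t x) (b x) = P at h1 h2
    have h8 : |X - h * (3 * J)| ≤ |X - 3 * P| + 3 * |P - h * J| := by
      have h9 : X - h * (3 * J) = (X - 3 * P) + 3 * (P - h * J) := by ring
      rw [h9]
      refine (abs_add_le _ _).trans ?_
      rw [abs_mul, abs_of_pos (three_pos : (0 : ℝ) < 3)]
    refine h8.trans ?_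
    linarith
  refine hbig.trans_isLittleO ?_
  simpa using (Asymptotics.isLittleO_pow_pow (𝕜 := ℝ) (m := 1) (n := 2) (by norm_num))

/-- One integration by parts and the coercivity of `normSmulDeriv`; this is the dissipation of ‖V‖³
under the heat flow, up to the factor 3. -/
theorem integral_norm_smul_inner_lap_le {V : Plane → E} (hV : Differentiable ℝ V)
    (hV' : ∀ k, Differentiable ℝ (pd k V)) (hV3 : MemLp V 3 volume)
    (hV3' : ∀ k, MemLp (pd k V) 3 volume) (hV3'' : ∀ k, MemLp (pd k (pd k V)) 3 volume) :
    ∫ x, inner ℝ (‖V x‖ • V x) (lap V x) ≤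
      -∑ k, ∫ x, ‖V x‖ * ‖pd k V x‖ * ‖pd k V x‖ := by
  have h1 : ∫ x, inner ℝ (‖V x‖ • V x) (lap V x) =
      ∑ k, ∫ x, inner ℝ (‖V x‖ • V x) (pd k (pd k V) x) := by
    rw [← integral_finsetSum _ fun k _ => integrable_norm_smul_inner hV3 (hV3'' k)]
    simp only [lap, inner_sum]
  rw [h1, ← Finset.sum_neg_distrib]
  refine Finset.sum_le_sum fun k _ => ?_
  rw [integral_norm_smul_inner_pd k hV (hV' k) hV3 (hV3' k) (hV3' k) (hV3'' k), neg_le_neg_iff]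
  refine integral_mono (integrable_norm_mul hV3 (hV3' k) (hV3' k)) ?_ fun x => ?_
  · refine integrable_of_le_norm_mul hV3 (hV3' k) (hV3' k)
      ((aestronglyMeasurable_normSmulDeriv hV3.1 (hV3' k).1).inner (hV3' k).1) (C := 2)
      fun x => ?_
    refine (norm_inner_le_norm (𝕜 := ℝ) _ _).trans ?_
    have := norm_normSmulDeriv_apply_le (V x) (pd k V x)
    nlinarith [norm_nonneg (pd k V x)]
  · have := inner_normSmulDeriv_self_ge (V x) (pd k V x)
    simp only
    nlinarith

/-- After an integration by parts, 2xy ≤ x²/2 + 2y² with weight |w|. The half of the gradient term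
is absorbed by the dissipation of `w` itself. -/
theorem neg_le_integral_norm_smul_inner_pd (i : Fin 2) {w F : Plane → E} (hw : Differentiable ℝ w)
    (hF : Differentiable ℝ F) (hw3 : MemLp w 3 volume) (hw3' : MemLp (pd i w) 3 volume)
    (hF3 : MemLp F 3 volume) (hF3' : MemLp (pd i F) 3 volume) :
    -((∫ x, ‖w x‖ * ‖pd i w x‖ * ‖pd i w x‖) / 2 + 2 * ∫ x, ‖w x‖ * ‖F x‖ * ‖F x‖) ≤
      ∫ x, inner ℝ (‖w x‖ • w x) (pd i F x) := by
  rw [integral_norm_smul_inner_pd i hw hF hw3 hw3' hF3 hF3', neg_le_neg_iff]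
  have i1 := integrable_norm_mul hw3 hw3' hw3'
  have i2 := integrable_norm_mul hw3 hF3 hF3
  rw [← integral_div, ← integral_const_mul, ← integral_add (i1.div_const 2) (i2.const_mul 2)]
  refine integral_mono ?_ ((i1.div_const 2).add (i2.const_mul 2)) fun x => ?_
  · refine integrable_of_le_norm_mul hw3 hw3' hF3
      ((aestronglyMeasurable_normSmulDeriv hw3.1 hw3'.1).inner hF3.1) (C := 2) fun x => ?_
    refine (norm_inner_le_norm (𝕜 := ℝ) _ _).trans ?_
    have := norm_normSmulDeriv_apply_le (w x) (pd i w x)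
    nlinarith [norm_nonneg (F x)]
  · have h1 := norm_normSmulDeriv_apply_le (w x) (pd i w x)
    have h2 := real_inner_le_norm (normSmulDeriv (w x) (pd i w x)) (F x)
    simp only
    have h3 : ‖normSmulDeriv (w x) (pd i w x)‖ * ‖F x‖ ≤ 2 * ‖w x‖ * ‖pd i w x‖ * ‖F x‖ := by
      gcongr
    nlinarith [mul_nonneg (norm_nonneg (w x)) (sq_nonneg (‖pd i w x‖ - 2 * ‖F x‖))]

/-- The embedding `(w, f) ↦ (w, 8 f)` into a Euclidean sum. -/
def pairCLM : ℂ × ℂ →L[ℝ] WithLp 2 (ℂ × ℂ) :=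
  ((WithLp.prodContinuousLinearEquiv 2 ℝ ℂ ℂ).symm : ℂ × ℂ →L[ℝ] WithLp 2 (ℂ × ℂ)) ∘L
    (ContinuousLinearMap.prodMap (ContinuousLinearMap.id ℝ ℂ)
      ((8 : ℝ) • ContinuousLinearMap.id ℝ ℂ))

theorem norm_pairCLM_sq (a b : ℂ) : ‖pairCLM (a, b)‖ ^ 2 = ‖a‖ ^ 2 + 64 * ‖b‖ ^ 2 := by
  rw [WithLp.prod_norm_sq_eq_of_L2]
  simp [pairCLM]
  ring

theorem norm_le_norm_pairCLM (a b : ℂ) : ‖a‖ ≤ ‖pairCLM (a, b)‖ := by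
  have := norm_pairCLM_sq a b
  exact le_of_sq_le_sq (by nlinarith [sq_nonneg ‖b‖]) (norm_nonneg _)

theorem norm_pairCLM_le (a b : ℂ) : ‖pairCLM (a, b)‖ ≤ ‖a‖ + 8 * ‖b‖ := by
  have := norm_pairCLM_sq a b
  exact le_of_sq_le_sq (by nlinarith [norm_nonneg a, norm_nonneg b]) (by positivity)

end Heat

end

section

/-! ### The `L³` bound for second-order Riesz transforms -/

section Pair

variable {w f : Plane → ℂ}

/-- The pair `(w, 8 f)` as a single vector-valued function. -/
def pairFun (w f : Plane → ℂ) (x : Plane) : WithLp 2 (ℂ × ℂ) := pairCLM (w x, f x)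

theorem differentiable_pairFun (hw : Differentiable ℝ w) (hf : Differentiable ℝ f) :
    Differentiable ℝ (pairFun w f) :=
  pairCLM.differentiable.comp (hw.prodMk hf)

theorem pd_pairFun (hw : Differentiable ℝ w) (hf : Differentiable ℝ f) (k : Fin 2) :
    pd k (pairFun w f) = pairFun (pd k w) (pd k f) := by
  ext1 x
  have h := pairCLM.hasFDerivAt.comp x ((hw x).hasFDerivAt.prodMk (hf x).hasFDerivAt)
  have h2 : fderiv ℝ (pairFun w f) x = _ := h.fderiv
  simp [pd, h2, pairFun]

theorem n3_pairFun_le (hw : MemLp w 3 volume) (hf : MemLp f 3 volume) :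
    n3 (pairFun w f) ≤ n3 w + 8 * n3 f := by
  have h1 : n3 (pairFun w f) ≤ n3 ((fun x => ‖w x‖) + (8 : ℝ) • fun x => ‖f x‖) := by
    refine ENNReal.toReal_mono ((hw.norm.add (hf.norm.const_smul (8 : ℝ))).2.ne)
      (eLpNorm_mono fun x => ?_)
    refine (norm_pairCLM_le _ _).trans ((le_abs_self _).trans_eq' ?_)
    simp
  refine h1.trans ((n3_add_le hw.norm (hf.norm.const_smul (8 : ℝ))).trans ?_)
  rw [n3_smul]
  simp [n3, eLpNorm_norm]

theorem memLp_pairFun (hw : MemLp w 3 volume) (hf : MemLp f 3 volume) :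
    MemLp (pairFun w f) 3 volume := by
  refine (hw.norm.add (hf.norm.const_smul (8 : ℝ))).of_le
    (pairCLM.continuous.comp_aestronglyMeasurable (hw.1.prodMk hf.1)) (ae_of_all _ fun x => ?_)
  refine (norm_pairCLM_le _ _).trans ((le_abs_self _).trans_eq' ?_)
  simp

end Pair

theorem HasCubicDeriv.pairFun {w f : ℝ → Plane → ℂ} {w' f' : Plane → ℂ} {t : ℝ}
    (hw : HasCubicDeriv w w' t) (hf : HasCubicDeriv f f' t)
    (hw3 : ∀ s, MemLp (w s) 3 volume) (hf3 : ∀ s, MemLp (f s) 3 volume)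
    (hw3' : MemLp w' 3 volume) (hf3' : MemLp f' 3 volume) :
    HasCubicDeriv (fun s => pairFun (w s) (f s)) (Enstrophy.pairFun w' f') t := by
  obtain ⟨C, δ, hδ, hC⟩ := hw
  obtain ⟨D, ε, hε, hD⟩ := hf
  refine ⟨C + 8 * D, min δ ε, lt_min hδ hε, fun h hh => ?_⟩
  obtain ⟨h1, h2⟩ := le_min_iff.1 hh
  have h3 : Enstrophy.pairFun (w (t + h)) (f (t + h)) - Enstrophy.pairFun (w t) (f t) -
      h • Enstrophy.pairFun w' f' =
      Enstrophy.pairFun (w (t + h) - w t - h • w') (f (t + h) - f t - h • f') := by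
    ext1 x
    simp only [Enstrophy.pairFun, Pi.sub_apply, Pi.smul_apply, ← map_sub, ← map_smul]
    rfl
  rw [h3]
  refine (n3_pairFun_le (((hw3 _).sub (hw3 _)).sub (hw3'.const_smul h))
    (((hf3 _).sub (hf3 _)).sub (hf3'.const_smul h))).trans ?_
  linarith [hC h h1, hD h h2]

/-- If `w` and `f` solve the heat equation, `Δ w = σ ∂_i ∂_j f` with `σ = ±1`, and `w` decays as
`t → ∞`, then the initial values satisfy `‖w‖_3³ ≤ 171 ‖f‖_3³`. -/
theorem n3_cube_le_of_heat {w f : ℝ → Plane → ℂ} {i j : Fin 2} {σ : ℝ} (hσ : |σ| = 1)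
    (hw : ∀ t, Nice (w t)) (hf : ∀ t, Nice (f t))
    (hwd : ∀ t, HasCubicDeriv w (lap (w t)) t) (hfd : ∀ t, HasCubicDeriv f (lap (f t)) t)
    (heq : ∀ t x, lap (w t) x = σ * pd i (pd j (f t)) x)
    (hlim : Tendsto (fun t => n3 (w t) ^ 3) atTop (𝓝 0)) :
    n3 (w 0) ^ 3 ≤ 171 * n3 (f 0) ^ 3 := by
  have hlap3 : ∀ {g : Plane → ℂ}, Nice g → MemLp (lap g) 3 volume := fun {g} hg => by
    have : lap g = ∑ k, pd k (pd k g) := by ext x; simp [lap]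
    rw [this]
    exact memLp_finsetSum' _ fun k _ => ((hg.pd_nice k).pd_nice k).memLp_three
  set V : ℝ → Plane → WithLp 2 (ℂ × ℂ) := fun t => pairFun (w t) (f t) with hV
  have hV3 : ∀ t, MemLp (V t) 3 volume := fun t =>
    memLp_pairFun (hw t).memLp_three (hf t).memLp_three
  have hVpd : ∀ t k, pd k (V t) = pairFun (pd k (w t)) (pd k (f t)) := fun t k =>
    pd_pairFun (hw t).differentiable (hf t).differentiable k
  have hVpd2 : ∀ t k, pd k (pd k (V t)) = pairFun (pd k (pd k (w t))) (pd k (pd k (f t))) :=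
    fun t k => by
      rw [hVpd, pd_pairFun ((hw t).pd_nice k).differentiable ((hf t).pd_nice k).differentiable]
  have hVlap : ∀ t, lap (V t) = pairFun (lap (w t)) (lap (f t)) := fun t => by
    ext1 x
    simp only [lap, hVpd2, pairFun, ← map_sum]
    congr 1
  have hVd : ∀ t, HasCubicDeriv V (lap (V t)) t := fun t => by
    rw [hVlap]
    exact (hwd t).pairFun (hfd t) (fun s => (hw s).memLp_three) (fun s => (hf s).memLp_three)
      (hlap3 (hw t)) (hlap3 (hf t))
  have hVlap3 : ∀ t, MemLp (lap (V t)) 3 volume := fun t => by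
    rw [hVlap]; exact memLp_pairFun (hlap3 (hw t)) (hlap3 (hf t))
  -- The Bellman functional. The weight 8 and the divisor 16 are matched by 8²/16 = 4 below.
  set Ψ : ℝ → ℝ := fun t => n3 (w t) ^ 3 - n3 (V t) ^ 3 / 16 with hΨ
  set X : ℝ → ℝ := fun t => ∫ x, inner ℝ (‖w t x‖ • w t x) (lap (w t) x) with hX
  set Y : ℝ → ℝ := fun t => ∫ x, inner ℝ (‖V t x‖ • V t x) (lap (V t) x) with hY
  have hΨd : ∀ t, HasDerivAt Ψ (3 * X t - 3 * Y t / 16) t := fun t =>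
    ((hwd t).hasDerivAt (fun s => (hw s).memLp_three) (hlap3 (hw t))).sub
      (((hVd t).hasDerivAt hV3 (hVlap3 t)).div_const 16)
  -- The relation gives X ≥ -(a_i/2 + 2 d_j), while dissipation gives a_i ≤ -X; together X ≥ -4 d_j.
  -- The pair dissipates at least 64 ∑ d_k, and a sixteenth of this compensates.
  have hXY : ∀ t, 0 ≤ 3 * X t - 3 * Y t / 16 := fun t => by
    have hw3 := (hw t).memLp_three
    have hw1 := fun k => (hw t).pd_nice k
    have hf1 := fun k => (hf t).pd_nice k
    set a : Fin 2 → ℝ := fun k => ∫ x, ‖w t x‖ * ‖pd k (w t) x‖ * ‖pd k (w t) x‖ with ha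
    set d : Fin 2 → ℝ := fun k => ∫ x, ‖w t x‖ * ‖pd k (f t) x‖ * ‖pd k (f t) x‖ with hd
    have ha0 : ∀ k, 0 ≤ a k := fun k => integral_nonneg fun x => by positivity
    have hd0 : ∀ k, 0 ≤ d k := fun k => integral_nonneg fun x => by positivity
    have h1 : X t ≤ -∑ k, a k := integral_norm_smul_inner_lap_le (hw t).differentiable
      (fun k => (hw1 k).differentiable) hw3 (fun k => (hw1 k).memLp_three)
      fun k => ((hw1 k).pd_nice k).memLp_three
    have h2 : -(a i / 2 + 2 * d j) ≤ X t := by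
      have hF : Nice (fun x => (σ : ℂ) * pd j (f t) x) := (hf1 j).const_mul _
      have h3 := neg_le_integral_norm_smul_inner_pd i (hw t).differentiable hF.differentiable hw3
        (hw1 i).memLp_three hF.memLp_three (hF.pd_nice i).memLp_three
      have h4 : ∀ x, ‖(σ : ℂ) * pd j (f t) x‖ = ‖pd j (f t) x‖ := fun x => by
        rw [norm_mul, Complex.norm_real, Real.norm_eq_abs, hσ, one_mul]
      have h5 : ∀ x, pd i (fun x => (σ : ℂ) * pd j (f t) x) x = lap (w t) x := fun x => by
        rw [Nice.pd_const_mul _ (hf1 j), heq]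
      simp only [h4, h5] at h3
      exact h3
    have h3 : Y t ≤ -∑ k, 64 * d k := by
      have h4 := integral_norm_smul_inner_lap_le (V := V t)
        (differentiable_pairFun (hw t).differentiable (hf t).differentiable)
        (fun k => by
          rw [hVpd]; exact differentiable_pairFun (hw1 k).differentiable (hf1 k).differentiable)
        (hV3 t)
        (fun k => by rw [hVpd]; exact memLp_pairFun (hw1 k).memLp_three (hf1 k).memLp_three)
        (fun k => by
          rw [hVpd2]
          exact memLp_pairFun ((hw1 k).pd_nice k).memLp_three ((hf1 k).pd_nice k).memLp_three)
      refine h4.trans (neg_le_neg (Finset.sum_le_sum fun k _ => ?_))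
      have hV1 : MemLp (pd k (V t)) 3 volume := by
        rw [hVpd]; exact memLp_pairFun (hw1 k).memLp_three (hf1 k).memLp_three
      rw [hd, ← integral_const_mul]
      refine integral_mono ((integrable_norm_mul hw3 (hf1 k).memLp_three
        (hf1 k).memLp_three).const_mul 64) (integrable_norm_mul (hV3 t) hV1 hV1) fun x => ?_
      have h5 : ‖w t x‖ ≤ ‖V t x‖ := norm_le_norm_pairCLM _ _
      have h6 : 64 * ‖pd k (f t) x‖ ^ 2 ≤ ‖pd k (V t) x‖ ^ 2 := by
        rw [hVpd]
        have := norm_pairCLM_sq (pd k (w t) x) (pd k (f t) x)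
        simp only [pairFun]
        nlinarith [sq_nonneg ‖pd k (w t) x‖]
      have h7 := mul_le_mul h5 h6 (by positivity) (norm_nonneg _)
      simp only
      nlinarith
    have h4 : a i ≤ ∑ k, a k := Finset.single_le_sum (fun k _ => ha0 k) (Finset.mem_univ i)
    have h5 : d j ≤ ∑ k, d k := Finset.single_le_sum (fun k _ => hd0 k) (Finset.mem_univ j)
    rw [← Finset.mul_sum] at h3
    linarith
  have hmono : Monotone Ψ := monotone_of_deriv_nonneg (fun t => (hΨd t).differentiableAt)
    fun t => by rw [(hΨd t).deriv]; exact hXY t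
  -- A nondecreasing function that lies below a quantity tending to zero is nonpositive.
  have h0 : Ψ 0 ≤ 0 := by
    refine ge_of_tendsto hlim ((eventually_ge_atTop 0).mono fun t ht => (hmono ht).trans ?_)
    have := pow_nonneg (n3_nonneg (V t)) 3
    simp only [hΨ]
    linarith
  have h1 : n3 (V 0) ≤ n3 (w 0) + 8 * n3 (f 0) :=
    n3_pairFun_le (hw 0).memLp_three (hf 0).memLp_three
  have h2 : n3 (V 0) ^ 3 ≤ (n3 (w 0) + 8 * n3 (f 0)) ^ 3 := pow_le_pow_left₀ (n3_nonneg _) h1 3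
  -- Convexity of the cube gives ‖w‖³ ≤ (‖w‖³ + 512 ‖f‖³)/4 at time 0, hence the constant 512/3 ≤
  -- 171.
  have h3 : ∀ a b : ℝ, 0 ≤ a → 0 ≤ b → (a + b) ^ 3 ≤ 4 * (a ^ 3 + b ^ 3) := fun a b ha hb => by
    nlinarith [mul_nonneg (add_nonneg ha hb) (sq_nonneg (a - b))]
  have h4 := h3 (n3 (w 0)) (8 * n3 (f 0)) (n3_nonneg _) (mul_nonneg (by norm_num) (n3_nonneg _))
  have h5 := pow_nonneg (n3_nonneg (f 0)) 3
  simp only [hΨ] at h0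
  nlinarith

end

section

/-! ### Plancherel's theorem for multipliers and the heat flow -/

/-- The identity holds for tempered distributions and descends to L², which embeds injectively. -/
theorem Rep.cv_fourier (m : 𝓢(Plane, ℂ)) (F : Lp ℂ 2 (volume : Measure Plane)) :
    (𝓕 ((memLp_conv (by simp) (𝓕⁻ m) (Lp.memLp F)).toLp : Lp ℂ 2 (volume : Measure Plane)) :
      Lp ℂ 2 (volume : Measure Plane)) =ᵐ[volume]
      fun ξ => m ξ * (𝓕 F : Lp ℂ 2 (volume : Measure Plane)) ξ := by
  set G : Lp ℂ 2 (volume : Measure Plane) := (memLp_conv (by simp) (𝓕⁻ m) (Lp.memLp F)).toLp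
  have hm : MemLp m ⊤ (volume : Measure Plane) := m.memLp_top
  have h1 : (G : Distr) = mult m (F : Distr) :=
    (Rep.eq_toLp (Rep.cv (by simp) m (rep_Lp F))).symm
  have h2 : 𝓕 (G : Distr) = TemperedDistribution.smulLeftCLM ℂ m (𝓕 (F : Distr)) := by
    rw [h1, mult, TemperedDistribution.fourierMultiplierCLM_apply,
      FourierTransform.fourier_fourierInv_eq]
  rw [Lp.fourier_toTemperedDistribution_eq, Lp.fourier_toTemperedDistribution_eq,
    ← Lp.toTemperedDistribution_smul_eq (p := ⊤) (r := 2) m.hasTemperateGrowth hm] at h2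
  have h3 := LinearMap.ker_eq_bot.1 (Lp.ker_toTemperedDistributionCLM_eq_bot (F := ℂ)
    (μ := (volume : Measure Plane)) (p := 2)) h2
  rw [h3]
  filter_upwards [Lp.coeFn_lpSMul (r := 2) (hm.toLp _) (𝓕 F : Lp ℂ 2 (volume : Measure Plane)),
    hm.coeFn_toLp] with ξ e1 e2
  rw [e1, Pi.smul_apply', e2, smul_eq_mul]

theorem eLpNorm_cv_two (m : 𝓢(Plane, ℂ)) (F : Lp ℂ 2 (volume : Measure Plane)) :
    eLpNorm (cv m F) 2 volume =
      eLpNorm (fun ξ => m ξ * (𝓕 F : Lp ℂ 2 (volume : Measure Plane)) ξ) 2 volume := by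
  have h := eLpNorm_congr_ae (p := 2) (Rep.cv_fourier m F)
  rw [← h, ← Lp.enorm_def]
  have : ‖(𝓕 ((memLp_conv (by simp) (𝓕⁻ m) (Lp.memLp F)).toLp : Lp ℂ 2 (volume : Measure Plane)) :
      Lp ℂ 2 (volume : Measure Plane))‖ = _ := Lp.norm_fourier_eq _
  rw [← ofReal_norm, this, ofReal_norm, Lp.enorm_toLp]
  rfl

theorem eLpNorm_cv_two_le (m : 𝓢(Plane, ℂ)) {f : Plane → ℂ} (hf : MemLp f 2 volume) {A : ℝ}
    (hA : ∀ ξ, ‖m ξ‖ ≤ A) :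
    eLpNorm (cv m f) 2 volume ≤ ENNReal.ofReal A * eLpNorm f 2 volume := by
  have h1 : cv m f = cv m (hf.toLp : Lp ℂ 2 (volume : Measure Plane)) :=
    conv_congr _ hf.coeFn_toLp.symm
  rw [h1, eLpNorm_cv_two]
  refine (eLpNorm_le_mul_eLpNorm_of_ae_le_mul (g := (𝓕 hf.toLp : Lp ℂ 2 (volume : Measure Plane)))
    (c := A) (ae_of_all _ fun ξ => ?_) 2).trans_eq ?_
  · rw [norm_mul]
    gcongr
    exact hA ξ
  · rw [← Lp.enorm_def, ← ofReal_norm, Lp.norm_fourier_eq, ofReal_norm, Lp.enorm_toLp]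

theorem exists_schwartz_eq_one (R : ℝ) :
    ∃ θ : 𝓢(Plane, ℂ), ∀ ξ, ‖ξ‖ ≤ R → θ ξ = 1 := by
  let b : ContDiffBump (0 : Plane) := ⟨max R 1, max R 1 + 1, by positivity, by linarith⟩
  have h1 : HasCompactSupport (Complex.ofRealCLM ∘ b) := b.hasCompactSupport.comp_left rfl
  have h2 : ContDiff ℝ ∞ (Complex.ofRealCLM ∘ b) := Complex.ofRealCLM.contDiff.comp b.contDiff
  refine ⟨h1.toSchwartzMap h2, fun ξ hξ => ?_⟩
  have : b ξ = 1 := b.one_of_mem_closedBall (by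
    rw [mem_closedBall_zero_iff]; exact hξ.trans (le_max_left _ _))
  simp [this]

/-- Two continuous functions representing the same distribution agree at every point; symbol
identities thus become pointwise identities of convolutions. -/
theorem cv_congr_of_rep {p q : ℝ≥0∞} [Fact (1 ≤ p)] [Fact (1 ≤ q)] {f g : Plane → ℂ} {S T : Distr}
    (hp : p ≠ ⊤) (hq : q ≠ ⊤) {m n : 𝓢(Plane, ℂ)} (hf : Rep p f S) (hg : Rep q g T)
    (h : mult m S = mult n T) : cv m f = cv n g := by
  have h1 := Rep.cv hp m hf
  rw [h] at h1
  exact (Continuous.ae_eq_iff_eq _ (continuous_conv _ hf.memLp) (continuous_conv _ hg.memLp)).1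
    (h1.ae_eq (Rep.cv hq n hg))

theorem cv_cv {p : ℝ≥0∞} [Fact (1 ≤ p)] (hp : p ≠ ⊤) {f : Plane → ℂ} (hf : MemLp f p volume)
    (m n : 𝓢(Plane, ℂ)) : cv m (cv n f) = cv (smul' m n) f :=
  cv_congr_of_rep hp hp (Rep.cv hp n (rep_toLp hf)) (rep_toLp hf) (mult_mult _ _ _)

theorem smul'_eq_of_forall {θ m : 𝓢(Plane, ℂ)} (h : ∀ ξ, m ξ ≠ 0 → θ ξ = 1) : smul' θ m = m := by
  ext ξ
  rw [smul'_apply]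
  by_cases hm : m ξ = 0
  · simp [hm]
  · rw [h ξ hm, one_mul]

/-- Bernstein's inequality from `L²` to `L³`. -/
theorem exists_eLpNorm_cv_three_le (R : ℝ) : ∃ K : ℝ≥0∞, K ≠ ⊤ ∧ ∀ (m : 𝓢(Plane, ℂ))
    (f : Plane → ℂ), (∀ ξ, m ξ ≠ 0 → ‖ξ‖ ≤ R) → MemLp f 2 volume →
      eLpNorm (cv m f) 3 volume ^ 3 ≤ K * eLpNorm (cv m f) 2 volume ^ 3 := by
  obtain ⟨θ, hθ⟩ := exists_schwartz_eq_one R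
  refine ⟨eLpNorm (𝓕⁻ θ : 𝓢(Plane, ℂ)) (1 - 2⁻¹)⁻¹ volume,
    (SchwartzMap.eLpNorm_lt_top _ _ volume).ne, fun m f hm hf => ?_⟩
  have hg : MemLp (cv m f) 2 volume := memLp_conv (by simp) _ hf
  -- A multiplier equal to 1 on the frequency support reproduces the function, so one fixed kernel
  -- bounds its supremum by its L² norm; interpolation then gives L³.
  have h1 : cv m f = cv θ (cv m f) := by
    rw [cv_cv (by simp) hf, smul'_eq_of_forall fun ξ h => hθ ξ (hm ξ h)]
  have h2 : ∀ x, ‖cv m f x‖ₑ ≤ eLpNorm (𝓕⁻ θ : 𝓢(Plane, ℂ)) (1 - 2⁻¹)⁻¹ volume *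
      eLpNorm (cv m f) 2 volume := fun x => by
    conv_lhs => rw [h1]
    exact enorm_conv_le (𝓕⁻ θ) hg x
  refine (eLpNorm_three_pow_le h2 (ENNReal.mul_ne_top (SchwartzMap.eLpNorm_lt_top _ _ volume).ne
    hg.2.ne)).trans_eq ?_
  ring

/-- The symbol `m(ξ) e^{-4π²t|ξ|²}`. -/
def heatSym (m : 𝓢(Plane, ℂ)) (hm : HasCompactSupport m) (t : ℝ) : 𝓢(Plane, ℂ) :=
  HasCompactSupport.toSchwartzMap
    (f := fun ξ => m ξ * Complex.exp (-(4 * Real.pi ^ 2 * t * ‖ξ‖ ^ 2 : ℝ)))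
    hm.mul_right ((m.smooth ⊤).mul (by
      apply ContDiff.cexp
      apply ContDiff.neg
      exact Complex.ofRealCLM.contDiff.comp (contDiff_const.mul (contDiff_norm_sq ℝ))))

theorem heatSym_apply (m : 𝓢(Plane, ℂ)) (hm : HasCompactSupport m) (t : ℝ) (ξ : Plane) :
    heatSym m hm t ξ = m ξ * (Real.exp (-(4 * Real.pi ^ 2 * ‖ξ‖ ^ 2 * t)) : ℝ) := by
  simp [heatSym]
  left; ring_nf

theorem lap_cv {f : Plane → ℂ} (m : 𝓢(Plane, ℂ)) (hf : MemLp f 2 volume) :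
    lap (cv m f) = cv (∑ k, dsym k (dsym k m)) f := by
  ext x
  simp only [lap, Fin.sum_univ_two, pd_cv _ hf]
  simp only [cv, conv, FourierTransform.fourierInv_add, add_apply, add_mul]
  exact (integral_add (integrable_kernel_mul (𝓕⁻ (dsym 0 (dsym 0 m))) hf x)
    (integrable_kernel_mul (𝓕⁻ (dsym 1 (dsym 1 m))) hf x)).symm

theorem cv_sub {f : Plane → ℂ} (m n : 𝓢(Plane, ℂ)) (hf : MemLp f 2 volume) :
    cv (m - n) f = cv m f - cv n f := by
  ext x
  have h : (𝓕⁻ (m - n) : 𝓢(Plane, ℂ)) = 𝓕⁻ m - 𝓕⁻ n :=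
    map_sub (FourierTransform.fourierCLE ℂ 𝓢(Plane, ℂ)).symm m n
  simp only [cv, conv, Pi.sub_apply, h, sub_apply, sub_mul]
  exact integral_sub (integrable_kernel_mul (𝓕⁻ m) hf x) (integrable_kernel_mul (𝓕⁻ n) hf x)

theorem cv_smul {f : Plane → ℂ} (c : ℝ) (m : 𝓢(Plane, ℂ)) :
    cv ((c : ℂ) • m) f = c • cv m f := by
  ext x
  simp only [cv, conv, Pi.smul_apply, FourierTransform.fourierInv_smul, smul_apply, smul_eq_mul,
    mul_assoc, integral_const_mul, Complex.real_smul]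

theorem exists_norm_le_of_hasCompactSupport {m : 𝓢(Plane, ℂ)} (hm : HasCompactSupport m) :
    ∃ R : ℝ, 0 ≤ R ∧ ∀ ξ, m ξ ≠ 0 → ‖ξ‖ ≤ R := by
  obtain ⟨R, hR⟩ := hm.isCompact.isBounded.exists_norm_le
  exact ⟨max R 0, le_max_right _ _, fun ξ h =>
    (hR ξ (subset_tsupport _ h)).trans (le_max_left _ _)⟩

theorem exists_bound (m : 𝓢(Plane, ℂ)) : ∃ A : ℝ, 0 ≤ A ∧ ∀ ξ, ‖m ξ‖ ≤ A :=
  ⟨SchwartzMap.seminorm ℝ 0 0 m, apply_nonneg _ _, fun ξ => SchwartzMap.norm_le_seminorm ℝ m ξ⟩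

/-- On a compact frequency support the exponential has a uniform second-order Taylor remainder.
Plancherel turns it into an L² bound and Bernstein into an L³ bound. -/
theorem hasCubicDeriv_heat {f : Plane → ℂ} (hf : MemLp f 2 volume) (m : 𝓢(Plane, ℂ))
    (hm : HasCompactSupport m) (t : ℝ) :
    HasCubicDeriv (fun s => cv (heatSym m hm s) f) (lap (cv (heatSym m hm t) f)) t := by
  obtain ⟨R, hR0, hR⟩ := exists_norm_le_of_hasCompactSupport hm
  obtain ⟨A, hA0, hA⟩ := exists_bound (heatSym m hm t)
  obtain ⟨K, hK, hKb⟩ := exists_eLpNorm_cv_three_le R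
  set a : Plane → ℝ := fun ξ => 4 * Real.pi ^ 2 * ‖ξ‖ ^ 2 with ha
  set M := 4 * Real.pi ^ 2 * R ^ 2 with hM
  have hM0 : 0 ≤ M := by positivity
  have haM : ∀ ξ, m ξ ≠ 0 → a ξ ≤ M := fun ξ h => by
    simp only [ha, hM]; gcongr; exact hR ξ h
  -- The radius `(M + 1)⁻¹` keeps the exponent in [-1, 1], where |exp x - 1 - x| ≤ x². The constant
  -- is a cube root because Bernstein's inequality is stated for cubes.
  refine ⟨(K * (ENNReal.ofReal (A * M ^ 2) * eLpNorm f 2 volume) ^ 3).toReal ^ (1 / 3 : ℝ),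
    (M + 1)⁻¹, by positivity, fun h hh => ?_⟩
  set r : 𝓢(Plane, ℂ) := heatSym m hm (t + h) - heatSym m hm t -
    (h : ℂ) • ∑ k, dsym k (dsym k (heatSym m hm t)) with hr
  have hrcv : cv (heatSym m hm (t + h)) f - cv (heatSym m hm t) f -
      h • lap (cv (heatSym m hm t) f) = cv r f := by
    rw [lap_cv _ hf, hr, cv_sub _ _ hf, cv_sub _ _ hf, cv_smul]
  have hrξ : ∀ ξ, r ξ = heatSym m hm t ξ * ((Real.exp (-(a ξ * h)) - 1 + a ξ * h : ℝ) : ℂ) := by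
    intro ξ
    have e1 : heatSym m hm (t + h) ξ = heatSym m hm t ξ * (Real.exp (-(a ξ * h)) : ℝ) := by
      have : Real.exp (-(4 * Real.pi ^ 2 * ‖ξ‖ ^ 2 * (t + h))) =
          Real.exp (-(4 * Real.pi ^ 2 * ‖ξ‖ ^ 2 * t)) * Real.exp (-(a ξ * h)) := by
        rw [← Real.exp_add]
        congr 1
        simp only [ha]; ring
      rw [heatSym_apply, heatSym_apply, this, Complex.ofReal_mul, ← mul_assoc (m ξ)]
    have e2 : (∑ k, dsym k (dsym k (heatSym m hm t))) ξ = -(a ξ : ℂ) * heatSym m hm t ξ := by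
      rw [Fin.sum_univ_two, add_apply, dsym_apply, dsym_apply, dsym_apply, dsym_apply]
      have : (‖ξ‖ ^ 2 : ℝ) = ξ 0 ^ 2 + ξ 1 ^ 2 := by
        rw [EuclideanSpace.norm_sq_eq]; simp
      simp only [ha, this]
      push_cast
      linear_combination (4 * (Real.pi : ℂ) ^ 2 * ((ξ 0 : ℂ) ^ 2 + (ξ 1 : ℂ) ^ 2) *
        heatSym m hm t ξ) * Complex.I_sq
    rw [hr, sub_apply, sub_apply, smul_apply, e1, e2]
    push_cast
    simp only [smul_eq_mul]
    ring
  have hrb : ∀ ξ, ‖r ξ‖ ≤ A * M ^ 2 * h ^ 2 := fun ξ => by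
    rw [hrξ, norm_mul]
    by_cases hmξ : m ξ = 0
    · rw [heatSym_apply, hmξ]; simp; positivity
    have h1 : |-(a ξ * h)| ≤ 1 := by
      rw [abs_neg, abs_mul, abs_of_nonneg (by simp only [ha]; positivity)]
      calc a ξ * |h| ≤ M * (M + 1)⁻¹ := by gcongr; exact haM ξ hmξ
        _ ≤ 1 := by rw [← div_eq_mul_inv, div_le_one (by positivity)]; linarith
    have h2 := Real.abs_exp_sub_one_sub_id_le h1
    rw [Complex.norm_real, Real.norm_eq_abs]
    have h3 : Real.exp (-(a ξ * h)) - 1 + a ξ * h = Real.exp (-(a ξ * h)) - 1 - -(a ξ * h) := by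
      ring
    rw [h3, mul_assoc A]
    refine mul_le_mul (hA ξ) (h2.trans ?_) (abs_nonneg _) hA0
    rw [neg_sq, mul_pow]
    have : 0 ≤ a ξ := by simp only [ha]; positivity
    gcongr
    exact haM ξ hmξ
  have hr0 : ∀ ξ, r ξ ≠ 0 → ‖ξ‖ ≤ R := fun ξ h => hR ξ fun h0 => h (by
    rw [hrξ, heatSym_apply, h0]; simp)
  change n3 (cv (heatSym m hm (t + h)) f - cv (heatSym m hm t) f -
      h • lap (cv (heatSym m hm t) f)) ≤ _
  rw [hrcv]
  have h1 := hKb r f hr0 hf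
  have h2 := eLpNorm_cv_two_le r hf hrb
  rw [ENNReal.ofReal_mul (by positivity), mul_right_comm] at h2
  have h3 : eLpNorm (cv r f) 3 volume ^ 3 ≤
      K * (ENNReal.ofReal (A * M ^ 2) * eLpNorm f 2 volume) ^ 3 * ENNReal.ofReal (h ^ 2) ^ 3 := by
    refine h1.trans ?_
    rw [mul_assoc K, ← mul_pow]
    gcongr
  have hfin : K * (ENNReal.ofReal (A * M ^ 2) * eLpNorm f 2 volume) ^ 3 ≠ ⊤ :=
    ENNReal.mul_ne_top hK (ENNReal.pow_ne_top (ENNReal.mul_ne_top ENNReal.ofReal_ne_top hf.2.ne))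
  have h4 : n3 (cv r f) ^ 3 ≤
      (K * (ENNReal.ofReal (A * M ^ 2) * eLpNorm f 2 volume) ^ 3).toReal * (h ^ 2) ^ 3 := by
    rw [n3, ← ENNReal.toReal_pow]
    refine (ENNReal.toReal_mono (ENNReal.mul_ne_top hfin
      (ENNReal.pow_ne_top ENNReal.ofReal_ne_top)) h3).trans_eq ?_
    rw [ENNReal.toReal_mul, ENNReal.toReal_pow (ENNReal.ofReal (h ^ 2)),
      ENNReal.toReal_ofReal (sq_nonneg h)]
  refine le_of_pow_le_pow_left₀ three_ne_zero (by positivity) (h4.trans_eq ?_)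
  have hZ : ∀ Z : ℝ, 0 ≤ Z → Z * (h ^ 2) ^ 3 = (Z ^ (1 / 3 : ℝ) * h ^ 2) ^ 3 := fun Z hZ => by
    rw [mul_pow, ← Real.rpow_natCast (Z ^ (1 / 3 : ℝ)), ← Real.rpow_mul hZ]
    norm_num
  exact hZ _ ENNReal.toReal_nonneg

/-- Dominated convergence on the Fourier side: the heat factor decays off the origin, a null set.
Bernstein transfers the L² decay to L³. -/
theorem tendsto_n3_heat {f : Plane → ℂ} (hf : MemLp f 2 volume) (m : 𝓢(Plane, ℂ))
    (hm : HasCompactSupport m) :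
    Tendsto (fun t => n3 (cv (heatSym m hm t) f) ^ 3) atTop (𝓝 0) := by
  obtain ⟨R, hR0, hR⟩ := exists_norm_le_of_hasCompactSupport hm
  obtain ⟨A, hA0, hA⟩ := exists_bound m
  obtain ⟨K, hK, hKb⟩ := exists_eLpNorm_cv_three_le R
  set F : Lp ℂ 2 (volume : Measure Plane) := hf.toLp
  have hF : ∀ n : 𝓢(Plane, ℂ), cv n f = cv n F := fun n => conv_congr _ hf.coeFn_toLp.symm
  set g : Plane → ℂ := fun ξ => (𝓕 F : Lp ℂ 2 (volume : Measure Plane)) ξ with hg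
  have hgm : MemLp g 2 volume := Lp.memLp _
  have h2 : Tendsto (fun t => eLpNorm (cv (heatSym m hm t) f) 2 volume ^ 2) atTop (𝓝 0) := by
    simp only [hF, eLpNorm_cv_two, eLpNorm_two_pow]
    have h0 : (0 : ℝ≥0∞) = ∫⁻ _ : Plane, 0 := by simp
    rw [h0]
    refine tendsto_lintegral_filter_of_dominated_convergence
      (fun ξ => (ENNReal.ofReal A * ‖g ξ‖ₑ) ^ 2) ?_ ?_ ?_ ?_
    · refine Eventually.of_forall fun t => ?_
      exact ((heatSym m hm t).continuous.measurable.mul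
        (Lp.stronglyMeasurable _).measurable).enorm.pow_const 2
    · filter_upwards [eventually_ge_atTop 0] with t ht
      refine ae_of_all _ fun ξ => ?_
      rw [enorm_mul]
      gcongr
      rw [← ofReal_norm]
      refine ENNReal.ofReal_le_ofReal ?_
      rw [heatSym_apply, norm_mul, Complex.norm_real, Real.norm_of_nonneg (Real.exp_pos _).le]
      have : Real.exp (-(4 * Real.pi ^ 2 * ‖ξ‖ ^ 2 * t)) ≤ 1 := by
        rw [Real.exp_le_one_iff, neg_nonpos]; positivity
      calc _ ≤ A * 1 := mul_le_mul (hA ξ) this (Real.exp_pos _).le hA0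
        _ = A := mul_one A
    · simp only [mul_pow]
      rw [lintegral_const_mul' _ _ (ENNReal.pow_ne_top ENNReal.ofReal_ne_top), ← eLpNorm_two_pow]
      exact ENNReal.mul_ne_top (ENNReal.pow_ne_top ENNReal.ofReal_ne_top)
        (ENNReal.pow_ne_top hgm.2.ne)
    · have h0 : ∀ᵐ ξ : Plane, ξ ≠ 0 := by
        simp [ae_iff]
      filter_upwards [h0] with ξ hξ
      have h3 : Tendsto (fun t : ℝ => Real.exp (-(4 * Real.pi ^ 2 * ‖ξ‖ ^ 2 * t))) atTop (𝓝 0) := by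
        refine Real.tendsto_exp_neg_atTop_nhds_zero.comp ?_
        exact Tendsto.const_mul_atTop (by have := norm_pos_iff.2 hξ; positivity) tendsto_id
      have h4 : Tendsto (fun t : ℝ => m ξ * (Real.exp (-(4 * Real.pi ^ 2 * ‖ξ‖ ^ 2 * t)) : ℝ) * g ξ)
          atTop (𝓝 0) := by
        have := ((Complex.continuous_ofReal.tendsto 0).comp h3).const_mul (m ξ) |>.mul_const (g ξ)
        simpa using! this
      simp only [heatSym_apply]
      have := ((ENNReal.continuous_pow 2).tendsto _).comp ((continuous_enorm.tendsto _).comp h4)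
      simp only [enorm_zero, ne_eq, OfNat.ofNat_ne_zero, not_false_eq_true, zero_pow] at this
      exact this
  have h3 : Tendsto (fun t => eLpNorm (cv (heatSym m hm t) f) 3 volume ^ 3) atTop (𝓝 0) := by
    have h5 : Tendsto (fun t => K * (eLpNorm (cv (heatSym m hm t) f) 2 volume ^ 2) ^ (3 / 2 : ℝ))
        atTop (𝓝 0) := by
      have h6 := (ENNReal.continuous_rpow_const (y := 3 / 2)).tendsto 0 |>.comp h2
      rw [ENNReal.zero_rpow_of_pos (by norm_num)] at h6
      simpa using! ENNReal.Tendsto.const_mul h6 (Or.inr hK)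
    refine tendsto_of_tendsto_of_tendsto_of_le_of_le tendsto_const_nhds h5
      (fun _ => zero_le) fun t => ?_
    refine (hKb _ f (fun ξ h => hR ξ fun h0 => h ?_) hf).trans_eq ?_
    · rw [heatSym_apply, h0, zero_mul]
    · rw [← ENNReal.rpow_natCast, ← ENNReal.rpow_natCast, ← ENNReal.rpow_mul]
      norm_num
  have h4 := (ENNReal.tendsto_toReal ENNReal.zero_ne_top).comp h3
  refine (h4.congr fun t => ?_)
  simp [n3, ENNReal.toReal_pow]

end

section

/-! ### The Calderón–Zygmund inequality in `L³` -/

theorem cv_add {p : ℝ≥0∞} [Fact (1 ≤ p)] {f : Plane → ℂ} (m n : 𝓢(Plane, ℂ))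
    (hf : MemLp f p volume) : cv (m + n) f = cv m f + cv n f := by
  ext x
  simp only [cv, conv, Pi.add_apply, FourierTransform.fourierInv_add, add_apply, add_mul]
  exact integral_add (integrable_kernel_mul (𝓕⁻ m) hf x) (integrable_kernel_mul (𝓕⁻ n) hf x)

theorem dsym_comm (i j : Fin 2) (m : 𝓢(Plane, ℂ)) : dsym i (dsym j m) = dsym j (dsym i m) := by
  ext ξ
  simp only [dsym_apply]
  ring

theorem hasCompactSupport_dsym {m : 𝓢(Plane, ℂ)} (hm : HasCompactSupport m) (k : Fin 2) :
    HasCompactSupport (dsym k m) := by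
  refine hm.mono fun ξ hξ h => hξ ?_
  rw [dsym_apply, h, mul_zero]

theorem heatSym_dsym (m : 𝓢(Plane, ℂ)) (hm : HasCompactSupport m) (k : Fin 2) (t : ℝ) :
    heatSym (dsym k m) (hasCompactSupport_dsym hm k) t = dsym k (heatSym m hm t) := by
  ext ξ
  simp only [dsym_apply, heatSym_apply]
  ring

theorem heatSym_zero (m : 𝓢(Plane, ℂ)) (hm : HasCompactSupport m) : heatSym m hm 0 = m := by
  ext ξ
  simp [heatSym_apply]

theorem nice_cv (m : 𝓢(Plane, ℂ)) {f : Plane → ℂ} (hf : MemLp f 2 volume) : Nice (cv m f) :=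
  .conv2 _ hf

theorem Nice.sub {f g : Plane → ℂ} (hf : Nice f) (hg : Nice g) : Nice (f - g) := by
  have : f - g = fun x => f x + (-1) * g x := by ext x; simp [sub_eq_add_neg]
  rw [this]
  exact hf.add (hg.const_mul _)

theorem pd_sub {f g : Plane → ℂ} (hf : Nice f) (hg : Nice g) (k : Fin 2) :
    pd k (f - g) = pd k f - pd k g := by
  ext x
  simp only [pd, Pi.sub_apply]
  rw [fderiv_sub (hf.differentiable x) (hg.differentiable x)]
  rfl

theorem lap_sub {f g : Plane → ℂ} (hf : Nice f) (hg : Nice g) :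
    lap (f - g) = lap f - lap g := by
  ext x
  simp only [lap, pd_sub hf hg, pd_sub (hf.pd_nice _) (hg.pd_nice _), Pi.sub_apply,
    Finset.sum_sub_distrib]

theorem lap_nice {f : Plane → ℂ} (hf : Nice f) : Nice (lap f) := by
  have : lap f = fun x => pd 0 (pd 0 f) x + pd 1 (pd 1 f) x := by
    ext x; simp [lap]
  rw [this]
  exact ((hf.pd_nice 0).pd_nice 0).add ((hf.pd_nice 1).pd_nice 1)

theorem n3_sub_le {f g : Plane → ℂ} (hf : MemLp f 3 volume) (hg : MemLp g 3 volume) :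
    n3 (f - g) ≤ n3 f + n3 g := by
  rw [n3, n3, n3, ← ENNReal.toReal_add hf.2.ne hg.2.ne]
  exact ENNReal.toReal_mono (ENNReal.add_ne_top.2 ⟨hf.2.ne, hg.2.ne⟩)
    (eLpNorm_sub_le hf.1 hg.1 (by norm_num))

theorem HasCubicDeriv.sub {V W : ℝ → Plane → ℂ} {V' W' : Plane → ℂ} {t : ℝ}
    (hV : HasCubicDeriv V V' t) (hW : HasCubicDeriv W W' t) (hV3 : ∀ t, MemLp (V t) 3 volume)
    (hV'3 : MemLp V' 3 volume) (hW3 : ∀ t, MemLp (W t) 3 volume) (hW'3 : MemLp W' 3 volume) :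
    HasCubicDeriv (fun t => V t - W t) (V' - W') t := by
  obtain ⟨C, δ, hδ, h⟩ := hV
  obtain ⟨D, ε, hε, h'⟩ := hW
  refine ⟨C + D, min δ ε, lt_min hδ hε, fun s hs => ?_⟩
  have e : V (t + s) - W (t + s) - (V t - W t) - s • (V' - W') =
      (V (t + s) - V t - s • V') - (W (t + s) - W t - s • W') := by
    rw [smul_sub]; abel
  rw [e, add_mul]
  exact (n3_sub_le (((hV3 _).sub (hV3 _)).sub (hV'3.const_smul s))
    (((hW3 _).sub (hW3 _)).sub (hW'3.const_smul s))).trans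
    (add_le_add (h s (hs.trans (min_le_left _ _))) (h' s (hs.trans (min_le_right _ _))))

variable {u₀ u₁ : Plane → ℂ} {T₀ T₁ : Distr}

/-- A mollified divergence-free field is divergence-free in the classical sense. -/
theorem cv_dsym_add_eq_zero (h₀ : Rep 2 u₀ T₀) (h₁ : Rep 2 u₁ T₁)
    (hdiv : ∂_{e 0} T₀ + ∂_{e 1} T₁ = 0) (m : 𝓢(Plane, ℂ)) (x : Plane) :
    cv (dsym 0 m) u₀ x + cv (dsym 1 m) u₁ x = 0 := by
  have h := (Rep.cv (by simp) (dsym 0 m) h₀).add (Rep.cv (by simp) (dsym 1 m) h₁)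
  rw [← mult_lineDeriv, ← mult_lineDeriv, ← map_add, hdiv, map_zero] at h
  have h2 := (Continuous.ae_eq_iff_eq _ ((continuous_conv _ h₀.memLp).add
    (continuous_conv _ h₁.memLp)) continuous_zero).1 (h.ae_eq (Rep.zero (p := 2)))
  exact congrFun h2 x

/-- With div u = 0 one has Δu₀ = -∂₁ω and Δu₁ = ∂₀ω. Hence ∂_i u_j and ω, both mollified and
propagated by the heat flow, satisfy the relation of `n3_cube_le_of_heat` with σ = -1 or σ = 1. -/
theorem n3_cv_dsym_le (h₀ : Rep 2 u₀ T₀) (h₁ : Rep 2 u₁ T₁)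
    (hdiv : ∂_{e 0} T₀ + ∂_{e 1} T₁ = 0) (m : 𝓢(Plane, ℂ)) (hm : HasCompactSupport m)
    (i : Fin 2) :
    n3 (cv (dsym i m) u₀) ^ 3 ≤ 171 * n3 (cv (dsym 0 m) u₁ - cv (dsym 1 m) u₀) ^ 3 ∧
    n3 (cv (dsym i m) u₁) ^ 3 ≤ 171 * n3 (cv (dsym 0 m) u₁ - cv (dsym 1 m) u₀) ^ 3 := by
  have m₀ := h₀.memLp
  have m₁ := h₁.memLp
  set f : ℝ → Plane → ℂ := fun t => cv (dsym 0 (heatSym m hm t)) u₁ -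
    cv (dsym 1 (heatSym m hm t)) u₀ with hf
  have hfn : ∀ t, Nice (f t) := fun t => (nice_cv _ m₁).sub (nice_cv _ m₀)
  have hder : ∀ (k : Fin 2) {v : Plane → ℂ}, MemLp v 2 volume → ∀ t,
      HasCubicDeriv (fun s => cv (dsym k (heatSym m hm s)) v)
        (lap (cv (dsym k (heatSym m hm t)) v)) t := fun k v hv t => by
    simp only [← heatSym_dsym m hm k]
    exact hasCubicDeriv_heat hv _ _ t
  have hlim : ∀ (k : Fin 2) {v : Plane → ℂ}, MemLp v 2 volume →
      Tendsto (fun t => n3 (cv (dsym k (heatSym m hm t)) v) ^ 3) atTop (𝓝 0) := fun k v hv => by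
    simp only [← heatSym_dsym m hm k]
    exact tendsto_n3_heat hv _ _
  have hfd : ∀ t, HasCubicDeriv f (lap (f t)) t := fun t => by
    simp only [hf]
    rw [lap_sub (nice_cv _ m₁) (nice_cv _ m₀)]
    exact (hder 0 m₁ t).sub (hder 1 m₀ t) (fun s => (nice_cv _ m₁).memLp_three)
      (lap_nice (nice_cv _ m₁)).memLp_three (fun s => (nice_cv _ m₀).memLp_three)
      (lap_nice (nice_cv _ m₀)).memLp_three
  have hf0 : f 0 = cv (dsym 0 m) u₁ - cv (dsym 1 m) u₀ := by simp only [hf, heatSym_zero]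
  have hfpd : ∀ (a b : Fin 2) t x, pd a (pd b (f t)) x =
      cv (dsym a (dsym b (dsym 0 (heatSym m hm t)))) u₁ x -
        cv (dsym a (dsym b (dsym 1 (heatSym m hm t)))) u₀ x := fun a b t x => by
    simp only [hf]
    rw [pd_sub (nice_cv _ m₁) (nice_cv _ m₀), pd_cv _ m₁, pd_cv _ m₀,
      pd_sub (nice_cv _ m₁) (nice_cv _ m₀), pd_cv _ m₁, pd_cv _ m₀, Pi.sub_apply]
  have hlap : ∀ {v : Plane → ℂ}, MemLp v 2 volume → ∀ (n : 𝓢(Plane, ℂ)) x,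
      lap (cv n v) x = cv (dsym 0 (dsym 0 n)) v x + cv (dsym 1 (dsym 1 n)) v x :=
    fun {v} hv n x => by
      rw [lap_cv _ hv, Fin.sum_univ_two, cv_add _ _ hv, Pi.add_apply]
  rw [← hf0]
  constructor
  · have h := n3_cube_le_of_heat (σ := -1) (i := i) (j := 1) (by simp)
      (fun t => nice_cv (dsym i (heatSym m hm t)) m₀) hfn (hder i m₀) hfd (fun t x => ?_)
      (hlim i m₀)
    · simpa only [heatSym_zero] using h
    · have h2 := cv_dsym_add_eq_zero h₀ h₁ hdiv (dsym 0 (dsym i (heatSym m hm t))) x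
      rw [hlap m₀, hfpd]
      rw [dsym_comm i 1 (dsym 0 _), dsym_comm i 1 (dsym 1 _), dsym_comm i 0, dsym_comm i 1]
      push_cast
      linear_combination h2
  · have h := n3_cube_le_of_heat (σ := 1) (i := i) (j := 0) (by simp)
      (fun t => nice_cv (dsym i (heatSym m hm t)) m₁) hfn (hder i m₁) hfd (fun t x => ?_)
      (hlim i m₁)
    · simpa only [heatSym_zero] using h
    · have h2 := cv_dsym_add_eq_zero h₀ h₁ hdiv (dsym 1 (dsym i (heatSym m hm t))) x
      rw [hlap m₁, hfpd]
      have c1 := dsym_comm i 0 (dsym 0 (heatSym m hm t))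
      have c2 := dsym_comm i 0 (dsym 1 (heatSym m hm t))
      have c3 := dsym_comm i 1 (heatSym m hm t)
      have c4 := dsym_comm i 0 (heatSym m hm t)
      rw [c1, c2, c3, c4]
      push_cast
      linear_combination h2

end

section

/-! ### Dyadic dilations of symbols -/

theorem lintegral_comp_two_pow_smul (f : Plane → ℝ≥0∞) (hf : Measurable f) (n : ℕ) :
    ∫⁻ x, f ((2 : ℝ) ^ n • x) = ((4 : ℝ≥0∞) ^ n)⁻¹ * ∫⁻ x, f x := by
  have h0 : (2 : ℝ) ^ n ≠ 0 := by positivity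
  rw [← lintegral_map hf (measurable_const_smul ((2 : ℝ) ^ n)), Measure.map_addHaar_smul _ h0,
    lintegral_smul_measure, smul_eq_mul]
  congr 1
  rw [finrank_euclideanSpace_fin, abs_of_pos (by positivity),
    ENNReal.ofReal_inv_of_pos (by positivity), ← pow_mul, mul_comm, pow_mul,
    ENNReal.ofReal_pow (by positivity)]
  norm_num

/-- The dilated symbol `m(2⁻ⁿ ξ)`. -/
def dil (n : ℕ) (m : 𝓢(Plane, ℂ)) : 𝓢(Plane, ℂ) :=
  SchwartzMap.compCLMOfContinuousLinearEquiv ℂ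
    (ContinuousLinearEquiv.smulLeft (Units.mk0 ((2 : ℝ) ^ n)⁻¹ (by positivity)) : Plane ≃L[ℝ] Plane) m

theorem dil_apply (n : ℕ) (m : 𝓢(Plane, ℂ)) (ξ : Plane) :
    dil n m ξ = m (((2 : ℝ) ^ n)⁻¹ • ξ) := rfl

theorem dil_zero (m : 𝓢(Plane, ℂ)) : dil 0 m = m := by
  ext ξ
  simp [dil_apply]

theorem dsym_dil (k : Fin 2) (n : ℕ) (m : 𝓢(Plane, ℂ)) :
    dsym k (dil n m) = (2 : ℂ) ^ n • dil n (dsym k m) := by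
  ext ξ
  simp only [dsym_apply, dil_apply, smul_apply, smul_eq_mul, PiLp.smul_apply]
  push_cast
  field_simp

theorem fourierInv_dil (n : ℕ) (m : 𝓢(Plane, ℂ)) (x : Plane) :
    𝓕⁻ (dil n m) x = 4 ^ n * 𝓕⁻ m ((2 : ℝ) ^ n • x) := by
  rw [SchwartzMap.fourierInv_coe, SchwartzMap.fourierInv_coe, Real.fourierInv_eq,
    Real.fourierInv_eq]
  have h0 : (2 : ℝ) ^ n ≠ 0 := by positivity
  have h := Measure.integral_comp_smul volume
    (fun v : Plane => Real.fourierChar (inner ℝ v ((2 : ℝ) ^ n • x)) • m v) ((2 : ℝ) ^ n)⁻¹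
  have h2 : ∀ v : Plane, inner ℝ (((2 : ℝ) ^ n)⁻¹ • v) ((2 : ℝ) ^ n • x) = inner ℝ v x := fun v => by
    rw [real_inner_smul_left, real_inner_smul_right, inv_mul_cancel_left₀ h0]
  simp only [h2, ← dil_apply] at h
  rw [h, finrank_euclideanSpace_fin, abs_of_pos (by positivity), Complex.real_smul]
  congr 1
  push_cast
  rw [inv_pow, inv_inv, ← pow_mul, mul_comm, pow_mul]
  norm_num

theorem eLpNorm_one_fourierInv_dil (n : ℕ) (m : 𝓢(Plane, ℂ)) :
    eLpNorm (𝓕⁻ (dil n m) : 𝓢(Plane, ℂ)) 1 volume = eLpNorm (𝓕⁻ m : 𝓢(Plane, ℂ)) 1 volume := by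
  simp only [eLpNorm_one_eq_lintegral_enorm, fourierInv_dil, enorm_mul]
  rw [lintegral_const_mul' _ _ (by simp), lintegral_comp_two_pow_smul
    (fun x => ‖(𝓕⁻ m : 𝓢(Plane, ℂ)) x‖ₑ) (SchwartzMap.continuous _).enorm.measurable, ← mul_assoc]
  have : ‖(4 : ℂ) ^ n‖ₑ = 4 ^ n := by
    rw [enorm_pow, ← ofReal_norm]; norm_num
  rw [this, ENNReal.mul_inv_cancel (by positivity) (by finiteness), one_mul]

/-- The smallness of the second moment balances, in the flux, the two derivatives that fall on the
vorticity. -/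
theorem lintegral_norm_sq_fourierInv_dil (n : ℕ) (m : 𝓢(Plane, ℂ)) :
    ∫⁻ x, ‖(𝓕⁻ (dil n m) : 𝓢(Plane, ℂ)) x‖ₑ * ‖x‖ₑ ^ 2 =
      ((4 : ℝ≥0∞) ^ n)⁻¹ * ∫⁻ x, ‖(𝓕⁻ m : 𝓢(Plane, ℂ)) x‖ₑ * ‖x‖ₑ ^ 2 := by
  have h0 : (2 : ℝ≥0∞) ^ n ≠ 0 := by positivity
  have h1 : (2 : ℝ≥0∞) ^ n ≠ ⊤ := by finiteness
  have h4 : (4 : ℝ≥0∞) ^ n = (2 ^ n) * 2 ^ n := by rw [← mul_pow]; norm_num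
  have e1 : ∀ x : Plane, ‖(𝓕⁻ (dil n m) : 𝓢(Plane, ℂ)) x‖ₑ * ‖x‖ₑ ^ 2 =
      ‖(𝓕⁻ m : 𝓢(Plane, ℂ)) ((2 : ℝ) ^ n • x)‖ₑ * ‖(2 : ℝ) ^ n • x‖ₑ ^ 2 := fun x => by
    have e2 : ‖(4 : ℂ) ^ n‖ₑ = 4 ^ n := by
      rw [enorm_pow, ← ofReal_norm]; norm_num
    have e3 : ‖(2 : ℝ) ^ n‖ₑ = 2 ^ n := by
      rw [enorm_pow, ← ofReal_norm]; norm_num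
    rw [fourierInv_dil, enorm_mul, enorm_smul, e2, e3, h4]
    ring
  simp only [e1]
  exact lintegral_comp_two_pow_smul
    (fun x => ‖(𝓕⁻ m : 𝓢(Plane, ℂ)) x‖ₑ * ‖x‖ₑ ^ 2)
    ((SchwartzMap.continuous _).enorm.measurable.mul (continuous_enorm.measurable.pow_const 2)) n

theorem lintegral_norm_sq_schwartz_lt_top (K : 𝓢(Plane, ℂ)) :
    ∫⁻ x, ‖K x‖ₑ * ‖x‖ₑ ^ 2 < ⊤ := by
  have h := (K.integrable_pow_mul volume 2).2
  rw [hasFiniteIntegral_iff_enorm] at h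
  refine lt_of_eq_of_lt (lintegral_congr fun x => ?_) h
  rw [enorm_mul, enorm_norm, enorm_pow, enorm_norm, mul_comm]

theorem n3_cv_le {f : Plane → ℂ} (m : 𝓢(Plane, ℂ)) (hf : MemLp f 3 volume) :
    n3 (cv m f) ≤ (eLpNorm (𝓕⁻ m : 𝓢(Plane, ℂ)) 1 volume).toReal * n3 f := by
  rw [n3, n3, ← ENNReal.toReal_mul]
  exact ENNReal.toReal_mono (ENNReal.mul_ne_top (SchwartzMap.eLpNorm_lt_top _ _ volume).ne hf.2.ne)
    (eLpNorm_conv_le (by simp) _ hf)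

theorem n3_cv_dil_le {f : Plane → ℂ} (n : ℕ) (m : 𝓢(Plane, ℂ)) (hf : MemLp f 3 volume) :
    n3 (cv (dil n m) f) ≤ (eLpNorm (𝓕⁻ m : 𝓢(Plane, ℂ)) 1 volume).toReal * n3 f := by
  rw [← eLpNorm_one_fourierInv_dil n m]
  exact n3_cv_le _ hf

theorem cv_csmul (c : ℂ) (m : 𝓢(Plane, ℂ)) (f : Plane → ℂ) : cv (c • m) f = c • cv m f := by
  ext x
  simp only [cv, conv, Pi.smul_apply, FourierTransform.fourierInv_smul, smul_apply, smul_eq_mul,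
    mul_assoc, integral_const_mul]

theorem n3_csmul (c : ℂ) (f : Plane → ℂ) : n3 (c • f) = ‖c‖ * n3 f := by
  rw [n3, n3, eLpNorm_const_smul, ENNReal.toReal_mul, toReal_enorm]

/-! ### Functions localized in frequency -/

/-- The cutoff as a Schwartz function. -/
def cut {χ : Plane → ℝ} (hχ : IsCutoff χ) : 𝓢(Plane, ℂ) :=
  HasCompactSupport.toSchwartzMap (f := fun ξ => (χ ξ : ℂ))
    (hχ.hasCompactSupport.comp_left (g := Complex.ofReal) rfl)
    (Complex.ofRealCLM.contDiff.comp hχ.contDiff)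

variable {χ : Plane → ℝ} (hχ : IsCutoff χ)

theorem cut_apply (ξ : Plane) : cut hχ ξ = χ ξ := rfl

theorem cut_eq_one {ξ : Plane} (h : ‖ξ‖ ≤ 1 / 2) : cut hχ ξ = 1 := by
  rw [cut_apply, hχ.eq_one ξ h]; rfl

theorem cut_eq_zero {ξ : Plane} (h : 1 ≤ ‖ξ‖) : cut hχ ξ = 0 := by
  by_contra h0
  have : ξ ∈ tsupport χ := subset_tsupport _ fun h1 => h0 (by rw [cut_apply, h1]; rfl)
  have := hχ.tsupport_subset this
  rw [mem_ball_zero_iff] at this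
  linarith

/-- The symbol of the `n`-th Littlewood–Paley block, `n = q + 1`. -/
def blk : ℕ → 𝓢(Plane, ℂ)
  | 0 => cut hχ
  | n + 1 => dil (n + 1) (cut hχ) - dil n (cut hχ)

/-- The blocks telescope; with n = q + 1 this identifies the symbol of S_Q as the cutoff dilated by
2^(Q+1). -/
theorem sum_blk (N : ℕ) : ∑ n ∈ Finset.range (N + 1), blk hχ n = dil N (cut hχ) := by
  rw [Finset.sum_range_succ']
  simp only [blk]
  rw [Finset.sum_range_sub (fun n => dil n (cut hχ)), dil_zero, sub_add_cancel]

/-- The symbol of a fattened annulus. -/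
def ann : 𝓢(Plane, ℂ) :=
  dil 1 (cut hχ) - HasCompactSupport.toSchwartzMap (f := fun ξ => (χ ((8 : ℝ) • ξ) : ℂ))
    ((hχ.hasCompactSupport.comp_smul (by norm_num)).comp_left (g := Complex.ofReal) rfl)
    (Complex.ofRealCLM.contDiff.comp (hχ.contDiff.comp (contDiff_const_smul 8)))

theorem ann_apply (ξ : Plane) : ann hχ ξ = cut hχ ((2 : ℝ)⁻¹ • ξ) - χ ((8 : ℝ) • ξ) := by
  rw [ann, sub_apply, dil_apply, pow_one]
  rfl

theorem ann_eq_one {ξ : Plane} (h : 1 / 8 ≤ ‖ξ‖) (h' : ‖ξ‖ ≤ 1) : ann hχ ξ = 1 := by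
  rw [ann_apply, cut_eq_one hχ, ← cut_apply hχ, cut_eq_zero hχ, sub_zero]
  · rw [norm_smul]; norm_num; linarith
  · rw [norm_smul]; norm_num; linarith

theorem ann_eq_zero {ξ : Plane} (h : ‖ξ‖ ≤ 1 / 16) : ann hχ ξ = 0 := by
  rw [ann_apply, cut_eq_one hχ, ← cut_apply hχ, cut_eq_one hχ, sub_self]
  · rw [norm_smul]; norm_num; linarith
  · rw [norm_smul]; norm_num; linarith

/-- The numerator vanishes near the origin, the only point where |ξ|⁻² is singular. -/
theorem contDiff_ann_div : ContDiff ℝ ∞ (fun ξ : Plane => ann hχ ξ * ((‖ξ‖ ^ 2 : ℝ) : ℂ)⁻¹) := by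
  rw [contDiff_iff_contDiffAt]
  intro ξ
  by_cases h : ξ = 0
  · subst h
    refine (contDiffAt_const (c := (0 : ℂ))).congr_of_eventuallyEq ?_
    filter_upwards [Metric.closedBall_mem_nhds (0 : Plane) (by norm_num : (0 : ℝ) < 1 / 16)] with η hη
    rw [ann_eq_zero hχ (by simpa using hη), zero_mul]
  · refine ((ann hχ).smooth ⊤).contDiffAt.mul (ContDiffAt.inv ?_ ?_)
    · exact (Complex.ofRealCLM.contDiff.comp (contDiff_norm_sq ℝ)).contDiffAt
    · simpa using h

theorem hasCompactSupport_dil {m : 𝓢(Plane, ℂ)} (hm : HasCompactSupport m) (n : ℕ) :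
    HasCompactSupport (dil n m) :=
  hm.comp_homeomorph (ContinuousLinearEquiv.smulLeft
    (Units.mk0 ((2 : ℝ) ^ n)⁻¹ (by positivity)) : Plane ≃L[ℝ] Plane).toHomeomorph

theorem hasCompactSupport_cut : HasCompactSupport (cut hχ) :=
  hχ.hasCompactSupport.comp_left (g := Complex.ofReal) rfl

theorem hasCompactSupport_ann : HasCompactSupport (ann hχ) := by
  refine (hasCompactSupport_dil (hasCompactSupport_cut hχ) 1).sub ?_
  exact (hχ.hasCompactSupport.comp_smul (by norm_num)).comp_left (g := Complex.ofReal) rfl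

/-- The symbol `|ξ|⁻²` localized to the fattened annulus. -/
def annDiv : 𝓢(Plane, ℂ) :=
  HasCompactSupport.toSchwartzMap (hasCompactSupport_ann hχ).mul_right (contDiff_ann_div hχ)

theorem annDiv_apply (ξ : Plane) : annDiv hχ ξ = ann hχ ξ * ((‖ξ‖ ^ 2 : ℝ) : ℂ)⁻¹ := rfl

/-- The dilated symbol inverts the Laplacian on the fattened annulus, up to the factor -4π² 4^n; the
factor comes from the derivatives 2πi ξ_k and from the dilation. -/
theorem sum_dsym_dsym_annDiv (n : ℕ) :
    dsym 0 (dsym 0 (dil n (annDiv hχ))) + dsym 1 (dsym 1 (dil n (annDiv hχ))) =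
      (-(4 * Real.pi ^ 2 * 4 ^ n) : ℂ) • dil n (ann hχ) := by
  ext ξ
  rw [add_apply, dsym_apply, dsym_apply, dsym_apply, dsym_apply, smul_apply, dil_apply, dil_apply,
    annDiv_apply]
  by_cases h : ξ = 0
  · subst h
    have := ann_eq_zero hχ (ξ := 0) (by simp)
    simp [this]
  have h1 : (‖ξ‖ ^ 2 : ℝ) = ξ 0 ^ 2 + ξ 1 ^ 2 := by
    rw [EuclideanSpace.norm_sq_eq]; simp
  have h2 : ((ξ 0 : ℂ) ^ 2 + (ξ 1 : ℂ) ^ 2) ≠ 0 := by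
    have : (‖ξ‖ ^ 2 : ℝ) ≠ 0 := by simpa using h
    rw [h1] at this
    exact_mod_cast this
  have h4 : (4 : ℂ) ^ n = 2 ^ n * 2 ^ n := by rw [← mul_pow]; norm_num
  rw [norm_smul, mul_pow, h1, norm_inv, norm_pow, Real.norm_ofNat, h4]
  push_cast
  rw [smul_eq_mul]
  field_simp
  rw [Complex.I_sq]
  ring

end

/-! ### Frequency-localized functions, almost orthogonality and the Biot–Savart law on blocks -/

section

variable {χ : Plane → ℝ} (hχ : IsCutoff χ)

theorem dsym_smul' (k : Fin 2) (m n : 𝓢(Plane, ℂ)) :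
    dsym k (smul' m n) = smul' (dsym k m) n := by
  ext ξ
  simp only [dsym_apply, smul'_apply]
  ring

theorem smul'_dsym (k : Fin 2) (m n : 𝓢(Plane, ℂ)) :
    smul' m (dsym k n) = smul' (dsym k m) n := by
  ext ξ
  simp only [dsym_apply, smul'_apply]
  ring

theorem cv_sub_right {p : ℝ≥0∞} [Fact (1 ≤ p)] {f g : Plane → ℂ} (m : 𝓢(Plane, ℂ))
    (hf : MemLp f p volume) (hg : MemLp g p volume) : cv m (f - g) = cv m f - cv m g := by
  ext x
  simp only [cv, conv, Pi.sub_apply, mul_sub]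
  exact integral_sub (integrable_kernel_mul (𝓕⁻ m) hf x) (integrable_kernel_mul (𝓕⁻ m) hg x)

theorem cv_zero_right (m : 𝓢(Plane, ℂ)) : cv m 0 = 0 := by
  ext x
  simp [cv, conv]

theorem pd_eq_cv {m : 𝓢(Plane, ℂ)} {b : Plane → ℂ} (hb : MemLp b 2 volume) (h : cv m b = b)
    (k : Fin 2) : pd k b = cv (dsym k m) b := by
  conv_lhs => rw [← h]
  rw [pd_cv m hb]

theorem cv_pd_of_eq {m θ : 𝓢(Plane, ℂ)} {b : Plane → ℂ} (hb : MemLp b 2 volume) (h : cv θ b = b)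
    (k : Fin 2) : cv m (pd k b) = cv (dsym k m) b := by
  rw [pd_eq_cv hb h, cv_cv (by simp) hb, smul'_dsym, ← cv_cv (by simp) hb, h]

/-- A function localized at frequencies of size about `2ⁿ` (at most `1` if `n = 0`). -/
structure IsBlock (n : ℕ) (b : Plane → ℂ) : Prop where
  nice : Nice b
  low : cv (dil n (dil 1 (cut hχ))) b = b
  high : 1 ≤ n → cv (dil n (ann hχ)) b = b

theorem nice_zero : Nice 0 := by
  have := Nice.conv1 0 (f := 0) (MemLp.zero' (p := 1) (μ := volume))
  have h : conv 0 (0 : Plane → ℂ) = 0 := by ext x; simp [conv]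
  rwa [h] at this

theorem IsBlock.zero (n : ℕ) : IsBlock hχ n 0 :=
  ⟨nice_zero, cv_zero_right _, fun _ => cv_zero_right _⟩

variable {hχ}

theorem IsBlock.sub {n : ℕ} {a b : Plane → ℂ} (ha : IsBlock hχ n a) (hb : IsBlock hχ n b) :
    IsBlock hχ n (a - b) := by
  refine ⟨ha.nice.sub hb.nice, ?_, fun h => ?_⟩
  · rw [cv_sub_right _ ha.nice.memLp_two hb.nice.memLp_two, ha.low, hb.low]
  · rw [cv_sub_right _ ha.nice.memLp_two hb.nice.memLp_two, ha.high h, hb.high h]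

/-- Localization is expressed by reproducing formulas, and these commute with differentiation. -/
theorem IsBlock.pd {n : ℕ} {b : Plane → ℂ} (hb : IsBlock hχ n b) (k : Fin 2) :
    IsBlock hχ n (pd k b) := by
  refine ⟨hb.nice.pd_nice k, ?_, fun h => ?_⟩
  · rw [cv_pd_of_eq hb.nice.memLp_two hb.low, pd_eq_cv hb.nice.memLp_two hb.low]
  · rw [cv_pd_of_eq hb.nice.memLp_two hb.low, pd_eq_cv hb.nice.memLp_two (hb.high h)]

theorem norm_two_pow_inv_smul (n : ℕ) (ξ : Plane) :
    ‖((2 : ℝ) ^ n)⁻¹ • ξ‖ = ((2 : ℝ) ^ n)⁻¹ * ‖ξ‖ := by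
  rw [norm_smul, norm_inv, norm_pow, Real.norm_ofNat]

/-- After rescaling by 2^(-n), the n-th symbol lives in the unit ball, and for n ≥ 1 also outside
the ball of radius 1/8; there the reproducing symbols equal 1. -/
theorem isBlock_cv (hχ : IsCutoff χ) (n : ℕ) {f : Plane → ℂ} (hf : MemLp f 2 volume) :
    IsBlock hχ n (cv (blk hχ n) f) := by
  have key : ∀ ξ, blk hχ n ξ ≠ 0 →
      ((2 : ℝ) ^ n)⁻¹ * ‖ξ‖ ≤ 1 ∧ (1 ≤ n → 1 / 8 ≤ ((2 : ℝ) ^ n)⁻¹ * ‖ξ‖) := fun ξ hξ => by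
    cases n with
    | zero =>
      refine ⟨?_, fun h => by omega⟩
      by_contra! h
      exact hξ (cut_eq_zero hχ (by simpa using h.le))
    | succ n =>
      have e1 : ((2 : ℝ) ^ (n + 1))⁻¹ * ‖ξ‖ = ((2 : ℝ) ^ n)⁻¹ * ‖ξ‖ / 2 := by
        rw [pow_succ]; field_simp
      constructor
      · by_contra! h
        refine hξ ?_
        rw [blk, sub_apply, dil_apply, dil_apply, cut_eq_zero, cut_eq_zero, sub_self] <;>
        rw [norm_two_pow_inv_smul] <;> linarith
      · intro _
        by_contra! h
        refine hξ ?_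
        rw [blk, sub_apply, dil_apply, dil_apply, cut_eq_one, cut_eq_one, sub_self] <;>
        rw [norm_two_pow_inv_smul] <;> linarith
  refine ⟨nice_cv _ hf, ?_, fun h => ?_⟩
  · rw [cv_cv (by simp) hf, smul'_eq_of_forall fun ξ hξ => ?_]
    rw [dil_apply, dil_apply, cut_eq_one]
    rw [norm_two_pow_inv_smul, norm_two_pow_inv_smul]
    have := (key ξ hξ).1
    norm_num
    linarith
  · rw [cv_cv (by simp) hf, smul'_eq_of_forall fun ξ hξ => ?_]
    have := key ξ hξ
    rw [dil_apply, ann_eq_one]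
    · rw [norm_two_pow_inv_smul]; exact this.2 h
    · rw [norm_two_pow_inv_smul]; exact this.1

variable (hχ) in
/-- A bound for the `L¹` norms of the kernels of the localized derivatives and integrals. -/
def lpC : ℝ := ∑ k, ((eLpNorm (𝓕⁻ (dsym k (dil 1 (cut hχ))) : 𝓢(Plane, ℂ)) 1 volume).toReal +
  (eLpNorm (𝓕⁻ (dsym k (annDiv hχ)) : 𝓢(Plane, ℂ)) 1 volume).toReal)

theorem le_lpC (k : Fin 2) :
    (eLpNorm (𝓕⁻ (dsym k (dil 1 (cut hχ))) : 𝓢(Plane, ℂ)) 1 volume).toReal ≤ lpC hχ ∧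
    (eLpNorm (𝓕⁻ (dsym k (annDiv hχ)) : 𝓢(Plane, ℂ)) 1 volume).toReal ≤ lpC hχ := by
  have h := Finset.single_le_sum (s := Finset.univ) (f := fun k =>
    ((eLpNorm (𝓕⁻ (dsym k (dil 1 (cut hχ))) : 𝓢(Plane, ℂ)) 1 volume).toReal +
      (eLpNorm (𝓕⁻ (dsym k (annDiv hχ)) : 𝓢(Plane, ℂ)) 1 volume).toReal))
    (fun _ _ => add_nonneg ENNReal.toReal_nonneg ENNReal.toReal_nonneg) (Finset.mem_univ k)
  exact ⟨(le_add_of_nonneg_right ENNReal.toReal_nonneg).trans h,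
    (le_add_of_nonneg_left ENNReal.toReal_nonneg).trans h⟩

theorem lpC_nonneg : 0 ≤ lpC hχ :=
  Finset.sum_nonneg fun _ _ => add_nonneg ENNReal.toReal_nonneg ENNReal.toReal_nonneg

theorem IsBlock.n3_pd_le {n : ℕ} {b : Plane → ℂ} (hb : IsBlock hχ n b) (k : Fin 2) :
    n3 (Enstrophy.pd k b) ≤ lpC hχ * (2 ^ n * n3 b) := by
  rw [pd_eq_cv hb.nice.memLp_two hb.low, dsym_dil, cv_csmul, n3_csmul, norm_pow, Complex.norm_ofNat,
    mul_left_comm]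
  gcongr
  exact (n3_cv_dil_le _ _ hb.nice.memLp_three).trans
    (mul_le_mul_of_nonneg_right (le_lpC k).1 (n3_nonneg _))

theorem n3_cv_dsym_annDiv_le (n : ℕ) (k : Fin 2) {b : Plane → ℂ} (hb : MemLp b 3 volume) :
    n3 (fun x => (-(4 * Real.pi ^ 2 * 4 ^ n) : ℂ)⁻¹ * cv (dsym k (dil n (annDiv hχ))) b x) ≤
      lpC hχ * ((2⁻¹ : ℝ) ^ n * n3 b) := by
  change n3 ((-(4 * Real.pi ^ 2 * 4 ^ n) : ℂ)⁻¹ • cv (dsym k (dil n (annDiv hχ))) b) ≤ _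
  rw [dsym_dil, cv_csmul, n3_csmul, n3_csmul]
  have h1 : n3 (cv (dil n (dsym k (annDiv hχ))) b) ≤ lpC hχ * n3 b :=
    (n3_cv_dil_le _ _ hb).trans (mul_le_mul_of_nonneg_right (le_lpC k).2 (n3_nonneg _))
  have h2 : ‖(-(4 * Real.pi ^ 2 * 4 ^ n) : ℂ)⁻¹‖ ≤ ((4 : ℝ) ^ n)⁻¹ := by
    rw [norm_inv, norm_neg, norm_mul, norm_mul, norm_pow, norm_pow, Complex.norm_ofNat,
      Complex.norm_real, Real.norm_of_nonneg Real.pi_pos.le]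
    gcongr
    have : 0 < (4 : ℝ) ^ n := by positivity
    have h9 : 1 ≤ 4 * Real.pi ^ 2 := by nlinarith [Real.pi_gt_three]
    nlinarith
  have h4 : (4 : ℝ) ^ n = 2 ^ n * 2 ^ n := by rw [← mul_pow]; norm_num
  rw [norm_pow, Complex.norm_ofNat]
  calc _ ≤ ((4 : ℝ) ^ n)⁻¹ * (2 ^ n * (lpC hχ * n3 b)) := by
        have := n3_nonneg (cv (dil n (dsym k (annDiv hχ))) b)
        gcongr
    _ = _ := by rw [h4, inv_pow]; field_simp

/-- b = div ∇ Δ⁻¹ b with a localized inverse Laplacian. Only `n ≥ 1` is possible, since the lowest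
block contains the zero frequency. -/
theorem IsBlock.eq_sum {n : ℕ} (hn : 1 ≤ n) {b : Plane → ℂ} (hb : IsBlock hχ n b) (x : Plane) :
    b x = ∑ k, Enstrophy.pd k (fun x => (-(4 * Real.pi ^ 2 * 4 ^ n) : ℂ)⁻¹ *
      cv (dsym k (dil n (annDiv hχ))) b x) x := by
  have m2 := hb.nice.memLp_two
  have h0 : (-(4 * Real.pi ^ 2 * 4 ^ n) : ℂ) ≠ 0 := by simp [Real.pi_ne_zero]
  simp only [Fin.sum_univ_two, (nice_cv _ m2).pd_const_mul, pd_cv _ m2]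
  have h := congrArg (fun m => cv m b x) (sum_dsym_dsym_annDiv hχ n)
  simp only [cv_add _ _ m2, cv_csmul, hb.high hn, Pi.add_apply, Pi.smul_apply, smul_eq_mul] at h
  rw [← mul_add, h, inv_mul_cancel_left₀ h0]

/-- Almost orthogonality in `L³`. -/
theorem n3_sum_sq_le_of_isBlock {b : ℕ → Plane → ℂ} (hb : ∀ n, IsBlock hχ n (b n)) (N : ℕ) :
    n3 (∑ n ∈ Finset.range N, b n) ^ 2 ≤
      (12 * lpC hχ ^ 2 + 18) * ∑ n ∈ Finset.range N, n3 (b n) ^ 2 := by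
  have hB : ∀ n k, Nice (fun x => (-(4 * Real.pi ^ 2 * 4 ^ n) : ℂ)⁻¹ *
      cv (dsym k (dil n (annDiv hχ))) (b n) x) := fun n k =>
    (nice_cv _ (hb n).nice.memLp_two).const_mul _
  exact n3_sum_sq_le (fun n => (hb n).nice.differentiable) (fun n => (hb n).nice.memLp_three)
    (fun n k => ((hb n).nice.pd_nice k).memLp_three) (fun n k => (hB n k).differentiable)
    (fun n k => (hB n k).memLp_three) (fun n k => ((hB n k).pd_nice k).memLp_three)
    (fun n => le_rfl) (fun n k => (hb n).n3_pd_le k)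
    (fun n k => n3_cv_dsym_annDiv_le n k (hb n).nice.memLp_three)
    (fun n hn x => (hb n).eq_sum hn x) lpC_nonneg N

/-! ### Velocity and vorticity blocks -/

/-- The mollified vorticity. -/
def curl (u : Fin 2 → Plane → ℂ) (m : 𝓢(Plane, ℂ)) : Plane → ℂ :=
  cv (dsym 0 m) (u 1) - cv (dsym 1 m) (u 0)

section

variable {u : Fin 2 → Plane → ℂ}

theorem curl_eq (hu : ∀ i, MemLp (u i) 2 volume) (m : 𝓢(Plane, ℂ)) :
    curl u m = pd 0 (cv m (u 1)) - pd 1 (cv m (u 0)) := by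
  rw [curl, pd_cv m (hu 1), pd_cv m (hu 0)]

theorem nice_curl (hu : ∀ i, MemLp (u i) 2 volume) (m : 𝓢(Plane, ℂ)) : Nice (curl u m) :=
  (nice_cv _ (hu 1)).sub (nice_cv _ (hu 0))

theorem isBlock_curl (hχ : IsCutoff χ) (hu : ∀ i, MemLp (u i) 2 volume) (n : ℕ) :
    IsBlock hχ n (curl u (blk hχ n)) := by
  rw [curl_eq hu]
  exact ((isBlock_cv hχ n (hu 1)).pd 0).sub ((isBlock_cv hχ n (hu 0)).pd 1)

theorem cv_curl (hu : ∀ i, MemLp (u i) 2 volume) (m n : 𝓢(Plane, ℂ)) :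
    cv m (curl u n) = curl u (smul' m n) := by
  rw [curl, curl, cv_sub_right m (nice_cv _ (hu 1)).memLp_two (nice_cv _ (hu 0)).memLp_two,
    cv_cv (by simp) (hu 1), cv_cv (by simp) (hu 0), smul'_dsym, smul'_dsym, dsym_smul', dsym_smul']

/-- Biot–Savart on one block: u₀ = -∂₁Δ⁻¹ω and u₁ = ∂₀Δ⁻¹ω, obtained from b = ΔΔ⁻¹b by eliminating
one second derivative with div u = 0. The inverse Laplacian with one derivative gains 2^(-n). -/
theorem n3_cv_blk_le {T : Fin 2 → Distr} (h : ∀ i, Rep 2 (u i) (T i))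
    (hdiv : ∂_{e 0} (T 0) + ∂_{e 1} (T 1) = 0) (n : ℕ) (hn : 1 ≤ n) (j : Fin 2) :
    n3 (cv (blk hχ n) (u j)) ≤ lpC hχ * ((2⁻¹ : ℝ) ^ n * n3 (curl u (blk hχ n))) := by
  have hu : ∀ i, MemLp (u i) 2 volume := fun i => (h i).memLp
  have hnice := (nice_curl hu (blk hχ n))
  set D := dil n (annDiv hχ) with hD
  set c : ℂ := (-(4 * Real.pi ^ 2 * 4 ^ n) : ℂ)⁻¹
  have hj : ∀ j x, cv (blk hχ n) (u j) x = c * (cv (smul' (dsym 0 (dsym 0 D)) (blk hχ n)) (u j) x +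
      cv (smul' (dsym 1 (dsym 1 D)) (blk hχ n)) (u j) x) := fun j x => by
    have hb := isBlock_cv hχ n (hu j)
    rw [hb.eq_sum hn x, Fin.sum_univ_two, (nice_cv _ hb.nice.memLp_two).pd_const_mul,
      (nice_cv _ hb.nice.memLp_two).pd_const_mul, pd_cv _ hb.nice.memLp_two,
      pd_cv _ hb.nice.memLp_two, cv_cv (by simp) (hu j), cv_cv (by simp) (hu j), mul_add]
  have hc : ∀ k x, cv (dsym k D) (curl u (blk hχ n)) x =
      cv (smul' (dsym 0 (dsym k D)) (blk hχ n)) (u 1) x -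
        cv (smul' (dsym 1 (dsym k D)) (blk hχ n)) (u 0) x := fun k x => by
    rw [cv_curl hu, curl, dsym_smul', dsym_smul', Pi.sub_apply]
  have hd : ∀ k x, cv (smul' (dsym 0 (dsym k D)) (blk hχ n)) (u 0) x +
      cv (smul' (dsym 1 (dsym k D)) (blk hχ n)) (u 1) x = 0 := fun k x => by
    rw [← dsym_smul', ← dsym_smul' 1]
    exact cv_dsym_add_eq_zero (h 0) (h 1) hdiv (smul' (dsym k D) (blk hχ n)) x
  fin_cases j
  · have e1 : cv (blk hχ n) (u 0) =
        -(fun x => c * cv (dsym 1 D) (curl u (blk hχ n)) x) := by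
      ext x
      rw [hj, Pi.neg_apply, hc]
      have := hd 0 x
      rw [dsym_comm 1 0] at this
      linear_combination c * this
    have h2 := n3_cv_dsym_annDiv_le (hχ := hχ) n 1 hnice.memLp_three
    simp only [Fin.zero_eta, e1]
    rwa [n3, eLpNorm_neg]
  · have e1 : cv (blk hχ n) (u 1) =
        fun x => c * cv (dsym 0 D) (curl u (blk hχ n)) x := by
      ext x
      rw [hj, hc]
      have := hd 1 x
      rw [dsym_comm 0 1] at this
      linear_combination c * this
    simp only [Fin.mk_one, e1]
    exact n3_cv_dsym_annDiv_le n 0 hnice.memLp_three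

end

end

section

/-! ### Convergence of the mollifications -/

theorem eLpNorm_cv_sub_two (m : 𝓢(Plane, ℂ)) (F : Lp ℂ 2 (volume : Measure Plane)) :
    eLpNorm (cv m F - (F : Plane → ℂ)) 2 volume =
      eLpNorm (fun ξ => (m ξ - 1) * (𝓕 F : Lp ℂ 2 (volume : Measure Plane)) ξ) 2 volume := by
  set G : Lp ℂ 2 (volume : Measure Plane) :=
    (memLp_conv (by simp) (𝓕⁻ m) (Lp.memLp F)).toLp with hG
  have h1 : eLpNorm (cv m F - (F : Plane → ℂ)) 2 volume = ‖G - F‖ₑ := by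
    rw [Lp.enorm_def]
    refine eLpNorm_congr_ae ?_
    filter_upwards [Lp.coeFn_sub G F, (memLp_conv (by simp) (𝓕⁻ m) (Lp.memLp F)).coeFn_toLp]
      with x hx hx'
    rw [hx, Pi.sub_apply, Pi.sub_apply, hx']
    rfl
  have h2 : (𝓕 (G - F) : Lp ℂ 2 (volume : Measure Plane)) = 𝓕 G - 𝓕 F :=
    map_sub (FourierTransform.fourierCLE ℂ (Lp ℂ 2 (volume : Measure Plane))) G F
  have h3 : ‖(𝓕 (G - F) : Lp ℂ 2 (volume : Measure Plane))‖ = ‖G - F‖ := Lp.norm_fourier_eq _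
  rw [h1, ← ofReal_norm, ← h3, ofReal_norm, h2, Lp.enorm_def]
  refine eLpNorm_congr_ae ?_
  filter_upwards [Lp.coeFn_sub (𝓕 G : Lp ℂ 2 (volume : Measure Plane)) (𝓕 F), Rep.cv_fourier m F]
    with ξ h4 h5
  rw [h4, Pi.sub_apply, h5]
  ring

variable {χ : Plane → ℝ} (hχ : IsCutoff χ)

theorem norm_dil_cut_sub_one_le : ∃ A : ℝ, 0 ≤ A ∧ ∀ n ξ, ‖dil n (cut hχ) ξ - 1‖ ≤ A := by
  obtain ⟨A, hA, h⟩ := exists_bound (cut hχ)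
  refine ⟨A + 1, by positivity, fun n ξ => (norm_sub_le _ _).trans ?_⟩
  rw [norm_one]
  gcongr
  exact h _

theorem eventually_dil_cut_eq_one (ξ : Plane) : ∀ᶠ n in atTop, dil n (cut hχ) ξ = 1 := by
  have h : Tendsto (fun n : ℕ => ((2 : ℝ) ^ n)⁻¹ * ‖ξ‖) atTop (𝓝 0) := by
    have := (tendsto_pow_atTop_nhds_zero_of_lt_one (r := (2 : ℝ)⁻¹) (by norm_num)
      (by norm_num)).mul_const ‖ξ‖
    simpa using! this
  filter_upwards [h.eventually (Iio_mem_nhds (by norm_num : (0 : ℝ) < 1 / 2))] with n hn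
  rw [dil_apply, cut_eq_one]
  rw [norm_two_pow_inv_smul]
  exact (mem_Iio.1 hn).le

theorem tendsto_eLpNorm_cv_dil_sub {f : Plane → ℂ} (hf : MemLp f 2 volume) :
    Tendsto (fun n => eLpNorm (cv (dil n (cut hχ)) f - f) 2 volume) atTop (𝓝 0) := by
  obtain ⟨A, hA, hb⟩ := norm_dil_cut_sub_one_le hχ
  set F : Lp ℂ 2 (volume : Measure Plane) := hf.toLp
  have hF : ∀ m : 𝓢(Plane, ℂ), eLpNorm (cv m f - f) 2 volume = eLpNorm (cv m F - (F : Plane → ℂ)) 2 volume :=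
    fun m => by
      have : cv m f = cv m F := conv_congr _ hf.coeFn_toLp.symm
      rw [this]
      exact eLpNorm_congr_ae (EventuallyEq.rfl.sub hf.coeFn_toLp.symm)
  have h2 : Tendsto (fun n => eLpNorm (cv (dil n (cut hχ)) f - f) 2 volume ^ 2) atTop (𝓝 0) := by
    simp only [hF, eLpNorm_cv_sub_two, eLpNorm_two_pow]
    have h0 : (0 : ℝ≥0∞) = ∫⁻ _ : Plane, 0 := by simp
    rw [h0]
    refine tendsto_lintegral_of_dominated_convergence
      (fun ξ => (ENNReal.ofReal A * ‖(𝓕 F : Lp ℂ 2 (volume : Measure Plane)) ξ‖ₑ) ^ 2) ?_ ?_ ?_ ?_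
    · intro n
      exact (((dil n (cut hχ)).continuous.measurable.sub_const 1).mul
        (Lp.stronglyMeasurable _).measurable).enorm.pow_const 2
    · intro n
      refine ae_of_all _ fun ξ => ?_
      simp only [enorm_mul]
      gcongr
      rw [← ofReal_norm]
      exact ENNReal.ofReal_le_ofReal (hb n ξ)
    · simp only [mul_pow]
      rw [lintegral_const_mul' _ _ (ENNReal.pow_ne_top ENNReal.ofReal_ne_top), ← eLpNorm_two_pow]
      exact ENNReal.mul_ne_top (ENNReal.pow_ne_top ENNReal.ofReal_ne_top)
        (ENNReal.pow_ne_top (Lp.memLp _).2.ne)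
    · refine ae_of_all _ fun ξ => ?_
      refine tendsto_const_nhds.congr' ?_
      filter_upwards [eventually_dil_cut_eq_one hχ ξ] with n hn
      simp [hn]
  have h3 := (ENNReal.continuous_rpow_const (y := 1 / 2)).tendsto 0 |>.comp h2
  rw [ENNReal.zero_rpow_of_pos (by norm_num)] at h3
  refine h3.congr fun n => ?_
  simp only [Function.comp_apply]
  rw [← ENNReal.rpow_natCast, ← ENNReal.rpow_mul]
  norm_num

/-- Membership of `f` in L³ is not assumed. Its mollifications converge in L², hence almost
everywhere along a subsequence, and Fatou's lemma passes the uniform L³ bound to the limit. -/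
theorem eLpNorm_sub_cv_dil_le {f : Plane → ℂ} (hf : MemLp f 2 volume) (n : ℕ) {B : ℝ≥0∞}
    (hB : ∀ N, n ≤ N → eLpNorm (cv (dil N (cut hχ)) f - cv (dil n (cut hχ)) f) 3 volume ≤ B) :
    eLpNorm (f - cv (dil n (cut hχ)) f) 3 volume ≤ B := by
  have hm : ∀ N, MemLp (cv (dil N (cut hχ)) f) 2 volume := fun N => memLp_conv (by simp) _ hf
  obtain ⟨ns, hns, hae⟩ := (tendstoInMeasure_of_tendsto_eLpNorm (p := 2) (by simp)
    (fun N => (hm N).1) hf.1 (tendsto_eLpNorm_cv_dil_sub hχ hf)).exists_seq_tendsto_ae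
  have h := Lp.eLpNorm_lim_le_liminf_eLpNorm (p := 3) (μ := volume)
    (f := fun k => cv (dil (ns k) (cut hχ)) f - cv (dil n (cut hχ)) f)
    (fun k => ((hm _).1.sub (hm _).1)) (f - cv (dil n (cut hχ)) f)
    (by filter_upwards [hae] with x hx using hx.sub_const _)
  refine h.trans ?_
  refine (liminf_le_liminf (v := fun _ => B) ?_).trans (by simp)
  filter_upwards [hns.tendsto_atTop.eventually_ge_atTop n] with k hk using hB _ hk

/-! ### The blocks of the statement -/

theorem mult_sum {ι : Type*} (s : Finset ι) (m : ι → 𝓢(Plane, ℂ)) (T : Distr) :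
    mult (∑ i ∈ s, m i) T = ∑ i ∈ s, mult (m i) T := by
  classical
  induction s using Finset.induction_on with
  | empty =>
    have := mult_smul 0 0 T
    rw [smul_zero] at this
    rw [Finset.sum_empty, Finset.sum_empty]
    exact this.trans (zero_smul ℂ (mult 0 T))
  | insert i s hi ih => rw [Finset.sum_insert hi, Finset.sum_insert hi, mult_add, ih]

theorem block_eq_mult (n : ℕ) (T : Distr) : block χ ((n : ℤ) - 1) T = mult (blk hχ n) T := by
  have : (fun ξ => (blockSymbol χ ((n : ℤ) - 1) ξ : ℂ)) = blk hχ n := by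
    ext ξ
    rw [blockSymbol, if_neg (by omega)]
    cases n with
    | zero => simp [blk, cut_apply]
    | succ n =>
      have e1 : ((n + 1 : ℕ) : ℤ) - 1 = n := by push_cast; ring
      rw [e1, if_neg (by omega), shell, blk, sub_apply, dil_apply, dil_apply, cut_apply, cut_apply,
        smul_smul, lam, lam, zpow_natCast, zpow_one, ← mul_inv, ← pow_succ']
      push_cast
      rfl
  rw [block, mult, this]

theorem block_eq_zero {q : ℤ} (hq : q < -1) (T : Distr) : block χ q T = 0 := by
  have : (fun ξ => (blockSymbol χ q ξ : ℂ)) = fun _ => (0 : ℂ) := by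
    ext ξ
    rw [blockSymbol, if_pos hq]
    rfl
  rw [block, this]
  simp

theorem partialSum_eq_mult (Q : ℕ) (T : Distr) :
    partialSum χ Q T = mult (dil (Q + 1) (cut hχ)) T := by
  rw [← sum_blk, mult_sum, partialSum]
  symm
  refine Finset.sum_bij (fun n _ => (n : ℤ) - 1) ?_ ?_ ?_ ?_
  · intro n hn
    simp only [Finset.mem_range, Finset.mem_Icc] at hn ⊢
    omega
  · intro a _ b _ h
    omega
  · intro q hq
    simp only [Finset.mem_Icc] at hq
    exact ⟨(q + 1).toNat, by simp only [Finset.mem_range]; omega, by omega⟩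
  · intro n _
    rw [block_eq_mult hχ]

section

variable {u : Fin 2 → Plane → ℂ} {T : Fin 2 → Distr}

theorem rep_curl (h : ∀ i, Rep 2 (u i) (T i)) (m : 𝓢(Plane, ℂ)) :
    Rep 2 (curl u m) (mult m (∂_{e 0} (T 1) - ∂_{e 1} (T 0))) := by
  rw [map_sub, mult_lineDeriv, mult_lineDeriv]
  exact (Rep.cv (by simp) _ (h 1)).sub (Rep.cv (by simp) _ (h 0))

theorem Rep.of_memLp {p q : ℝ≥0∞} {f : Plane → ℂ} {S : Distr} (h : Rep p f S)
    (hq : MemLp f q volume) : Rep q f S := ⟨hq, h.apply⟩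

theorem rep_curl_three (h : ∀ i, Rep 2 (u i) (T i)) (m : 𝓢(Plane, ℂ)) :
    Rep 3 (curl u m) (mult m (∂_{e 0} (T 1) - ∂_{e 1} (T 0))) :=
  (rep_curl h m).of_memLp (nice_curl (fun i => (h i).memLp) m).memLp_three

theorem Nice.eLpNorm_three_eq {f : Plane → ℂ} (hf : Nice f) :
    eLpNorm f 3 volume = ENNReal.ofReal (n3 f) := by
  rw [n3, ENNReal.ofReal_toReal hf.memLp_three.2.ne]

end

theorem rep_component (u : VectorField) (i : Fin 2) :
    Rep 2 (component u i) (component u i : Distr) := rep_Lp _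

/-- The components of a vector field, as functions. -/
def comp (u : VectorField) (i : Fin 2) : Plane → ℂ := component u i

theorem rep_comp (u : VectorField) (i : Fin 2) : Rep 2 (comp u i) (component u i : Distr) :=
  rep_Lp _

theorem memLp_comp (u : VectorField) (i : Fin 2) : MemLp (comp u i) 2 volume := Lp.memLp _

theorem c_eq (u : VectorField) (n : ℕ) :
    c χ u ((n : ℤ) - 1) = ENNReal.ofReal (n3 (curl (comp u) (blk hχ n))) := by
  rw [c, block_eq_mult hχ, vorticity, (rep_curl_three (rep_comp u) _).distNorm_eq,
    (nice_curl (memLp_comp u) _).eLpNorm_three_eq]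

theorem sum_le_Wc (u : VectorField) (Q : ℕ) (s : Finset ℕ) :
    ENNReal.ofReal (∑ n ∈ s, W ((Q : ℤ) - ((n : ℤ) - 1)) * n3 (curl (comp u) (blk hχ n)) ^ 2) ≤
      Wc χ u Q := by
  have hW : ∀ q, 0 ≤ W q := fun q => by
    rw [W]; split_ifs <;> simp only [lam] <;> positivity
  rw [ENNReal.ofReal_sum_of_nonneg fun n _ => mul_nonneg (hW _) (sq_nonneg _), Wc]
  have hinj : Function.Injective (fun n : ℕ => (n : ℤ) - 1) := fun a b h => by
    simpa using h
  refine le_trans (le_of_eq ?_) (ENNReal.sum_le_tsum (s.map ⟨_, hinj⟩))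
  rw [Finset.sum_map]
  refine Finset.sum_congr rfl fun n _ => ?_
  rw [Function.Embedding.coeFn_mk, c_eq hχ, ENNReal.ofReal_mul (hW _),
    ENNReal.ofReal_pow (n3_nonneg _)]

/-- In the range q ≤ Q (block index m = q + 1) the kernel is the ratio 16^(q-Q): two derivatives of
a block cost λ_q², and the square is λ_q⁴. -/
theorem W_of_le {n m : ℕ} (h : m ≤ n + 1) :
    (16 : ℝ) ^ m = 16 ^ (n + 1) * W ((n : ℤ) - ((m : ℤ) - 1)) := by
  have key : W ((n : ℤ) - ((m : ℤ) - 1)) = ((16 : ℝ) ^ (n + 1 - m))⁻¹ := by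
    have e1 : (n : ℤ) - ((m : ℤ) - 1) = ((n + 1 - m : ℕ) : ℤ) := by omega
    rw [e1, W, lam, zpow_natCast]
    split_ifs with h2
    · have : n + 1 - m = 0 := by omega
      simp [this]
    · rw [← pow_mul, mul_comm, pow_mul]; norm_num
  rw [key, ← div_eq_mul_inv, eq_div_iff (by positivity), ← pow_add]
  congr 1; omega

/-- In the range q > Q the kernel is 4^(Q-q), the square of the Biot–Savart gain λ_q⁻¹ relative to
λ_Q⁻¹. -/
theorem W_of_lt {n m : ℕ} (h : n + 1 < m) :
    ((4 : ℝ)⁻¹) ^ m = (4⁻¹) ^ (n + 1) * W ((n : ℤ) - ((m : ℤ) - 1)) := by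
  have key : W ((n : ℤ) - ((m : ℤ) - 1)) = (4⁻¹ : ℝ) ^ (m - (n + 1)) := by
    have e1 : (n : ℤ) - ((m : ℤ) - 1) = -((m - (n + 1) : ℕ) : ℤ) := by omega
    rw [e1, W, if_pos (by omega), lam, zpow_neg, zpow_natCast, inv_pow, inv_pow, ← pow_mul,
      mul_comm, pow_mul]
    norm_num
  rw [key, ← pow_add]
  congr 1; omega

theorem sum_high_le (u : VectorField) (Q N : ℕ) :
    ENNReal.ofReal (∑ n ∈ Finset.range N, if n ≤ Q + 1 then 0 else
        (4⁻¹ : ℝ) ^ n * n3 (curl (comp u) (blk hχ n)) ^ 2) ≤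
      ENNReal.ofReal ((4⁻¹) ^ (Q + 1)) * Wc χ u Q := by
  have hf : ∀ n, (if n ≤ Q + 1 then 0 else (4⁻¹ : ℝ) ^ n * n3 (curl (comp u) (blk hχ n)) ^ 2) =
      if ¬ n ≤ Q + 1 then (4⁻¹ : ℝ) ^ n * n3 (curl (comp u) (blk hχ n)) ^ 2 else 0 := fun n => by
    split_ifs <;> rfl
  simp only [hf]
  rw [← Finset.sum_filter]
  refine le_trans (le_of_eq ?_) (mul_le_mul_right (sum_le_Wc hχ u Q
    ((Finset.range N).filter fun n => ¬ n ≤ Q + 1)) _)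
  rw [← ENNReal.ofReal_mul (by positivity), Finset.mul_sum]
  congr 1
  refine Finset.sum_congr rfl fun n hn => ?_
  rw [W_of_lt (not_le.1 (Finset.mem_filter.1 hn).2), mul_assoc]

theorem sum_low_le (u : VectorField) (Q : ℕ) :
    ENNReal.ofReal (∑ n ∈ Finset.range (Q + 2),
        (16 : ℝ) ^ n * n3 (curl (comp u) (blk hχ n)) ^ 2) ≤
      ENNReal.ofReal (16 ^ (Q + 1)) * Wc χ u Q := by
  refine le_trans (le_of_eq ?_) (mul_le_mul_right (sum_le_Wc hχ u Q (Finset.range (Q + 2))) _)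
  rw [← ENNReal.ofReal_mul (by positivity), Finset.mul_sum]
  congr 1
  refine Finset.sum_congr rfl fun n hn => ?_
  rw [W_of_le (n := Q) (m := n) (by have := Finset.mem_range.1 hn; omega), mul_assoc]

end

section

/-! ### Translations -/

/-- The increment is an integral of the gradient along the segment; Jensen on the unit interval,
Tonelli and translation invariance give the bound. -/
theorem eLpNorm_translate_sub_le {f : Plane → ℂ} (hf : Nice f) (z : Plane) :
    eLpNorm (fun x => f (x - z) - f x) 3 volume ≤
      ‖z‖ₑ * (eLpNorm (pd 0 f) 3 volume + eLpNorm (pd 1 f) 3 volume) := by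
  set g : Plane → ℝ≥0∞ := fun x => ‖pd 0 f x‖ₑ + ‖pd 1 f x‖ₑ with hg
  set gr : Plane → ℝ := fun x => ‖pd 0 f x‖ + ‖pd 1 f x‖ with hgr
  have hgrg : ∀ x, ‖gr x‖ₑ = g x := fun x => by
    rw [hgr, hg, Real.enorm_of_nonneg (by positivity),
      ENNReal.ofReal_add (norm_nonneg _) (norm_nonneg _), ofReal_norm, ofReal_norm]
  have hgc : Continuous g :=
    (hf.pd_nice 0).continuous.enorm.add (hf.pd_nice 1).continuous.enorm
  set μ : Measure ℝ := volume.restrict (Ioc (0 : ℝ) 1) with hμ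
  have hμ1 : μ univ = 1 := by simp [hμ]
  have hfd : ∀ x, ‖fderiv ℝ f x z‖ₑ ≤ ‖z‖ₑ * g x := fun x => by
    have hz : z = z 0 • e 0 + z 1 • e 1 := by
      ext i; fin_cases i <;> simp [e]
    have h1 : fderiv ℝ f x z = z 0 • pd 0 f x + z 1 • pd 1 f x := by
      conv_lhs => rw [hz]
      simp [pd]
    have hzi : ∀ i, ‖z i‖ₑ ≤ ‖z‖ₑ := fun i => by
      rw [← ofReal_norm, ← ofReal_norm]
      exact ENNReal.ofReal_le_ofReal (PiLp.norm_apply_le z i)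
    rw [h1, hg, mul_add]
    refine (enorm_add_le _ _).trans ?_
    rw [enorm_smul, enorm_smul]
    gcongr
    · exact hzi 0
    · exact hzi 1
  have hpt : ∀ x, ‖f (x - z) - f x‖ₑ ≤ ‖z‖ₑ * ∫⁻ t, g (x - t • z) ∂μ := fun x => by
    have hpdc : Continuous fun t : ℝ => fderiv ℝ f (x - t • z) z := by
      have h1 : ∀ y, fderiv ℝ f y z = z 0 • pd 0 f y + z 1 • pd 1 f y := fun y => by
        have hz : z = z 0 • e 0 + z 1 • e 1 := by
          ext i; fin_cases i <;> simp [e]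
        conv_lhs => rw [hz]
        simp [pd]
      simp only [h1]
      have := (hf.pd_nice 0).continuous
      have := (hf.pd_nice 1).continuous
      fun_prop
    have h2 : ∀ t : ℝ, HasDerivAt (fun t : ℝ => f (x - t • z)) (-fderiv ℝ f (x - t • z) z) t :=
      fun t => by
        have h3 : HasDerivAt (fun t : ℝ => x - t • z) (-z) t := by
          simpa using ((hasDerivAt_id t).smul_const z).const_sub x
        simpa using! (hf.differentiable (x - t • z)).hasFDerivAt.comp_hasDerivAt t h3
    have h4 := intervalIntegral.integral_eq_sub_of_hasDerivAt (a := 0) (b := 1)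
      (fun t _ => h2 t) (hpdc.neg.intervalIntegrable _ _)
    simp only [one_smul, zero_smul, sub_zero] at h4
    rw [← h4, intervalIntegral.integral_of_le zero_le_one]
    refine (enorm_integral_le_lintegral_enorm _).trans ?_
    rw [← lintegral_const_mul' _ _ enorm_ne_top]
    refine lintegral_mono fun t => ?_
    rw [enorm_neg]
    exact hfd _
  have hgi : ∀ x, (∫⁻ t, g (x - t • z) ∂μ) ^ (3 : ℝ) ≤ ∫⁻ t, g (x - t • z) ^ (3 : ℝ) ∂μ := fun x => by
    have := lintegral_mul_rpow_le (μ := μ) (p := 3) (by norm_num) (k := fun _ => 1)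
      (g := fun t => g (x - t • z)) aemeasurable_const
      (hgc.comp (by fun_prop : Continuous fun t : ℝ => x - t • z)).measurable.aemeasurable
    simpa [hμ1] using this
  have hcube : eLpNorm (fun x => f (x - z) - f x) 3 volume ^ 3 ≤
      (‖z‖ₑ * eLpNorm gr 3 volume) ^ 3 := by
    rw [mul_pow, eLpNorm_three_pow, eLpNorm_three_pow]
    simp only [hgrg]
    calc ∫⁻ x, ‖f (x - z) - f x‖ₑ ^ 3
        ≤ ∫⁻ x, ‖z‖ₑ ^ 3 * ∫⁻ t, g (x - t • z) ^ 3 ∂μ := by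
          refine lintegral_mono fun x => ?_
          refine (pow_le_pow_left' (hpt x) 3).trans ?_
          rw [mul_pow]
          gcongr
          have := hgi x
          norm_num at this
          exact_mod_cast this
      _ = ‖z‖ₑ ^ 3 * ∫⁻ x, ∫⁻ t, g (x - t • z) ^ 3 ∂μ :=
          lintegral_const_mul' _ _ (by finiteness)
      _ = ‖z‖ₑ ^ 3 * ∫⁻ t, ∫⁻ x, g (x - t • z) ^ 3 ∂volume ∂μ := by
          rw [lintegral_lintegral_swap (f := fun x (t : ℝ) => g (x - t • z) ^ 3) (ν := μ)]
          exact ((hgc.comp (by fun_prop : Continuous fun p : Plane × ℝ =>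
            p.1 - p.2 • z)).measurable.pow_const 3).aemeasurable
      _ = ‖z‖ₑ ^ 3 * ∫⁻ x, g x ^ 3 := by
          congr 1
          simp only [lintegral_sub_right_eq_self (fun x => g x ^ 3)]
          rw [lintegral_const, hμ1, mul_one]
  have h5 := (ENNReal.pow_le_pow_left_iff three_ne_zero).1 hcube
  refine h5.trans ?_
  gcongr
  have h6 := eLpNorm_add_le (p := 3) (μ := volume) (f := fun x => ‖pd 0 f x‖)
    (g := fun x => ‖pd 1 f x‖) (hf.pd_nice 0).continuous.norm.aestronglyMeasurable
    (hf.pd_nice 1).continuous.norm.aestronglyMeasurable (by norm_num)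
  simpa only [eLpNorm_norm] using! h6

/-! ### The quadratic commutator -/

section

variable {f g : Plane → ℂ}

/-- `∫ h(y) (f(x-y)-f(x)) (g(x-y)-g(x)) dy`. -/
def comm (s : 𝓢(Plane, ℂ)) (f g : Plane → ℂ) (x : Plane) : ℂ :=
  ∫ y, (𝓕⁻ s : 𝓢(Plane, ℂ)) (x - y) * ((f y - f x) * (g y - g x))

theorem integral_fourierInv (s : 𝓢(Plane, ℂ)) : ∫ y, (𝓕⁻ s : 𝓢(Plane, ℂ)) y = s 0 := by
  have h : 𝓕 (𝓕⁻ s : 𝓢(Plane, ℂ)) 0 = s 0 := by rw [FourierTransform.fourier_fourierInv_eq]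
  rw [← h, SchwartzMap.fourier_coe, Real.fourier_eq]
  simp

/-- The Constantin–E–Titi identity: expanding the product of increments uses only that the kernel
has integral `s 0 = 1`. -/
theorem cv_mul_eq (s : 𝓢(Plane, ℂ)) (hs : s 0 = 1) (hf : MemLp f 2 volume)
    (hg : MemLp g 2 volume) (x : Plane) :
    cv s (fun y => f y * g y) x =
      comm s f g x - (f x - cv s f x) * (g x - cv s g x) + cv s f x * cv s g x := by
  set h : 𝓢(Plane, ℂ) := 𝓕⁻ s with hh
  have hfg : MemLp (fun y => f y * g y) 1 volume := hg.mul' hf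
  have i1 := integrable_kernel_mul h hfg x
  have i2 := (integrable_kernel_mul h hf x).mul_const (g x)
  have i3 := (integrable_kernel_mul h hg x).mul_const (f x)
  have i4 : Integrable (fun y => h (x - y) * (f x * g x)) :=
    (h.integrable.comp_sub_left x).mul_const _
  have e1 : ∫ y, h (x - y) * (f x * g x) = f x * g x := by
    rw [integral_mul_const, integral_sub_left_eq_self (fun y => h y), integral_fourierInv, hs,
      one_mul]
  have e2 : comm s f g x = cv s (fun y => f y * g y) x - cv s f x * g x - cv s g x * f x +
      f x * g x := by
    have e3 : ∀ y, h (x - y) * ((f y - f x) * (g y - g x)) = h (x - y) * (f y * g y) -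
        h (x - y) * f y * g x - h (x - y) * g y * f x + h (x - y) * (f x * g x) := fun y => by ring
    simp only [comm, cv, conv, ← hh, e3]
    have k1 := integral_add ((i1.sub i2).sub i3) i4
    have k2 := integral_sub (i1.sub i2) i3
    have k3 := integral_sub i1 i2
    simp only [Pi.sub_apply, e1, integral_mul_const] at k1 k2 k3
    rw [k1, k2, k3]
  rw [e2]
  ring

/-- Tonelli first: for a fixed shift z, Hölder in x bounds the two increments and `G`; then (|z|V +
2R)² ≤ 2|z|²V² + 8R² is integrated against the kernel. -/
theorem lintegral_comm_mul_le (s : 𝓢(Plane, ℂ)) (hf : Measurable f) (hg : Measurable g)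
    {G : Plane → ℂ} (hG : Measurable G) {V R : ℝ≥0∞}
    (hfV : ∀ z, eLpNorm (fun x => f (x - z) - f x) 3 volume ≤ ‖z‖ₑ * V + 2 * R)
    (hgV : ∀ z, eLpNorm (fun x => g (x - z) - g x) 3 volume ≤ ‖z‖ₑ * V + 2 * R) :
    ∫⁻ x, ‖comm s f g x‖ₑ * ‖G x‖ₑ ≤
      (2 * V ^ 2 * (∫⁻ z, ‖(𝓕⁻ s : 𝓢(Plane, ℂ)) z‖ₑ * ‖z‖ₑ ^ 2) +
        8 * R ^ 2 * eLpNorm (𝓕⁻ s : 𝓢(Plane, ℂ)) 1 volume) * eLpNorm G 3 volume := by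
  set h : 𝓢(Plane, ℂ) := 𝓕⁻ s with hh
  have hhm : Measurable h := h.continuous.measurable
  set D : Plane → Plane → ℝ≥0∞ := fun x z =>
    ‖h z‖ₑ * (‖f (x - z) - f x‖ₑ * ‖g (x - z) - g x‖ₑ * ‖G x‖ₑ) with hD
  have hDm : Measurable (Function.uncurry D) := by
    simp only [hD, Function.uncurry_def]
    fun_prop
  have h1 : ∀ x, ‖comm s f g x‖ₑ * ‖G x‖ₑ ≤ ∫⁻ z, D x z := fun x => by
    have h2 : ‖comm s f g x‖ₑ ≤ ∫⁻ z, ‖h z‖ₑ * (‖f (x - z) - f x‖ₑ * ‖g (x - z) - g x‖ₑ) := by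
      refine (enorm_integral_le_lintegral_enorm _).trans ?_
      rw [← lintegral_sub_left_eq_self _ x]
      simp only [sub_sub_cancel, enorm_mul]
      exact le_rfl
    refine (mul_le_mul_left h2 _).trans ?_
    rw [← lintegral_mul_const' _ _ enorm_ne_top]
    simp only [hD, mul_assoc]
    exact le_rfl
  have h3 : ∀ a b : ℝ≥0∞, (a + b) ^ 2 ≤ 2 * a ^ 2 + 2 * b ^ 2 := fun a b => by
    have := ENNReal.rpow_add_le_mul_rpow_add_rpow a b (p := 2) (by norm_num)
    norm_num [← mul_add] at this ⊢
    exact_mod_cast this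
  calc ∫⁻ x, ‖comm s f g x‖ₑ * ‖G x‖ₑ ≤ ∫⁻ x, ∫⁻ z, D x z := lintegral_mono h1
    _ = ∫⁻ z, ∫⁻ x, D x z := lintegral_lintegral_swap hDm.aemeasurable
    _ ≤ ∫⁻ z, (2 * V ^ 2 * (‖h z‖ₑ * ‖z‖ₑ ^ 2) + 8 * R ^ 2 * ‖h z‖ₑ) * eLpNorm G 3 volume := by
        refine lintegral_mono fun z => ?_
        simp only [hD]
        rw [lintegral_const_mul' _ _ enorm_ne_top]
        have hfm : Measurable fun x => f (x - z) - f x := by fun_prop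
        have hgm : Measurable fun x => g (x - z) - g x := by fun_prop
        have h4 := lintegral_mul_mul_le (μ := volume) hfm.enorm.aemeasurable hgm.enorm.aemeasurable
          hG.enorm.aemeasurable
        simp only [eLpNorm_enorm] at h4
        calc _ ≤ ‖h z‖ₑ * ((‖z‖ₑ * V + 2 * R) * (‖z‖ₑ * V + 2 * R) * eLpNorm G 3 volume) := by
              gcongr
              refine h4.trans ?_
              gcongr
              · exact hfV z
              · exact hgV z
          _ = ‖h z‖ₑ * ((‖z‖ₑ * V + 2 * R) ^ 2 * eLpNorm G 3 volume) := by ring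
          _ ≤ ‖h z‖ₑ * ((2 * (‖z‖ₑ * V) ^ 2 + 2 * (2 * R) ^ 2) * eLpNorm G 3 volume) := by
              gcongr
              exact h3 _ _
          _ = _ := by ring
    _ = _ := by
        have m1 : Measurable fun z => ‖h z‖ₑ * ‖z‖ₑ ^ 2 := by fun_prop
        have m2 : Measurable fun z => ‖h z‖ₑ := by fun_prop
        have m3 : Measurable fun z => 2 * V ^ 2 * (‖h z‖ₑ * ‖z‖ₑ ^ 2) + 8 * R ^ 2 * ‖h z‖ₑ :=
          (m1.const_mul _).add (m2.const_mul _)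
        rw [lintegral_mul_const _ m3, lintegral_add_left (m1.const_mul _), lintegral_const_mul _ m1, lintegral_const_mul _ m2,
          eLpNorm_one_eq_lintegral_enorm]

/-- The smooth part is charged with its gradient, the rough remainder with two copies of its norm.
-/
theorem eLpNorm_translate_sub_le_of_sub {v : Plane → ℂ} (hf : MemLp f 2 volume) (hv : Nice v)
    {R : ℝ≥0∞} (hR : eLpNorm (f - v) 3 volume ≤ R) (z : Plane) :
    eLpNorm (fun x => f (x - z) - f x) 3 volume ≤
      ‖z‖ₑ * (eLpNorm (pd 0 v) 3 volume + eLpNorm (pd 1 v) 3 volume) + 2 * R := by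
  have hm : AEStronglyMeasurable (f - v) volume := hf.1.sub hv.continuous.aestronglyMeasurable
  have hmp : MeasurePreserving (fun x : Plane => x - z) volume volume :=
    measurePreserving_sub_right volume z
  have e1 : (fun x => f (x - z) - f x) =
      (fun x => v (x - z) - v x) + (((f - v) ∘ fun x => x - z) - (f - v)) := by
    ext x
    simp only [Pi.add_apply, Pi.sub_apply, Function.comp_apply]
    ring
  have hvm : AEStronglyMeasurable (fun x => v (x - z) - v x) volume :=
    ((hv.continuous.comp (continuous_id.sub continuous_const)).sub hv.continuous).aestronglyMeasurable
  have hcm : AEStronglyMeasurable ((f - v) ∘ fun x => x - z) volume :=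
    hm.comp_measurePreserving hmp
  rw [e1]
  refine (eLpNorm_add_le hvm (hcm.sub hm) (by norm_num)).trans
    (add_le_add (eLpNorm_translate_sub_le hv z) ?_)
  refine (eLpNorm_sub_le hcm hm (by norm_num)).trans ?_
  rw [eLpNorm_comp_measurePreserving hm hmp, two_mul]
  exact add_le_add hR hR

end

end

section

/-! ### The enstrophy flux of the mollified field vanishes -/

theorem Nice.integrable_pd_mul {f g : Plane → ℂ} (hf : Nice f) (hg : Nice g) (k : Fin 2) :
    Integrable (pd k fun x => f x * g x) := by
  rw [funext (Nice.pd_mul hf hg k)]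
  exact (hf.integrable_mul (hg.pd_nice k)).add (hg.integrable_mul (hf.pd_nice k))

theorem Nice.integral_pd_mul {f g : Plane → ℂ} (hf : Nice f) (hg : Nice g) (k : Fin 2) :
    ∫ x, pd k (fun x => f x * g x) x = 0 := by
  simp only [Nice.pd_mul hf hg k]
  rw [integral_add (hf.integrable_mul (hg.pd_nice k)) (hg.integrable_mul (hf.pd_nice k)),
    hf.integral_mul_pd hg k]
  simp only [mul_comm (g _), neg_add_cancel]

section

variable {u : Fin 2 → Plane → ℂ}

theorem pd_curl (hu : ∀ i, MemLp (u i) 2 volume) (k : Fin 2) (m : 𝓢(Plane, ℂ)) :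
    pd k (curl u m) = curl u (dsym k m) := by
  rw [curl, curl, pd_sub (nice_cv _ (hu 1)) (nice_cv _ (hu 0)), pd_cv _ (hu 1), pd_cv _ (hu 0),
    dsym_comm k 0, dsym_comm k 1]

/-- The entries of `∇∇^⊥` of the mollified vorticity. -/
def hess (u : Fin 2 → Plane → ℂ) (m : 𝓢(Plane, ℂ)) (i j : Fin 2) : Plane → ℂ :=
  if j = 0 then fun x => (-1) * curl u (dsym i (dsym 1 m)) x else curl u (dsym i (dsym 0 m))

theorem nice_hess (hu : ∀ i, MemLp (u i) 2 volume) (m : 𝓢(Plane, ℂ)) (i j : Fin 2) :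
    Nice (hess u m i j) := by
  rw [hess]
  split_ifs
  · exact (nice_curl hu _).const_mul _
  · exact nice_curl hu _

theorem n3_hess (m : 𝓢(Plane, ℂ)) (i j : Fin 2) :
    ∃ k, n3 (hess u m i j) = n3 (curl u (dsym i (dsym k m))) := by
  rw [hess]
  split_ifs
  · refine ⟨1, ?_⟩
    change n3 ((-1 : ℂ) • curl u (dsym i (dsym 1 m))) = _
    rw [n3_csmul]
    simp
  · exact ⟨0, rfl⟩

/-- Formally, two integrations by parts reduce the integral to ∫ w curl(v·∇v) = ∫ w v·∇w = ½ ∫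
div(w² v) = 0, where w = curl v. The proof exhibits the integrand as a divergence, so no boundary
term or intermediate pairing has to be justified. -/
theorem integral_cv_mul_hess {T : Fin 2 → Distr} (h : ∀ i, Rep 2 (u i) (T i))
    (hdiv : ∂_{e 0} (T 0) + ∂_{e 1} (T 1) = 0) (m : 𝓢(Plane, ℂ)) :
    ∫ x, ∑ i, ∑ j, cv m (u i) x * cv m (u j) x * hess u m i j x = 0 := by
  have hu : ∀ i, MemLp (u i) 2 volume := fun i => (h i).memLp
  have hv : ∀ i, Nice (cv m (u i)) := fun i => nice_cv _ (hu i)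
  set w := curl u m with hw
  have hwn : Nice w := nice_curl hu m
  have c1 := fun j => ((hv 0).mul ((hv j).pd_nice 0)).add ((hv 1).mul ((hv j).pd_nice 1))
  have c2 := fun j => ((hv j).mul hwn).const_mul (1 / 2)
  -- The integrand is div(v p) + div(w q) with p = v·∇^⊥w and q = (-v·∇v₁ + ½ v₀ w, v·∇v₀ + ½ v₁ w).
  set p : Plane → ℂ := fun x => cv m (u 0) x * ((-1) * pd 1 w x) + cv m (u 1) x * pd 0 w x with hp
  have hpn : Nice p := ((hv 0).mul ((hwn.pd_nice 1).const_mul (-1))).add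
    ((hv 1).mul (hwn.pd_nice 0))
  set q₀ : Plane → ℂ := fun x => (-1) * (cv m (u 0) x * pd 0 (cv m (u 1)) x +
    cv m (u 1) x * pd 1 (cv m (u 1)) x) + 1 / 2 * (cv m (u 0) x * w x) with hq₀
  have hq₀n : Nice q₀ := ((c1 1).const_mul (-1)).add (c2 0)
  set q₁ : Plane → ℂ := fun x => (cv m (u 0) x * pd 0 (cv m (u 0)) x +
    cv m (u 1) x * pd 1 (cv m (u 0)) x) + 1 / 2 * (cv m (u 1) x * w x) with hq₁
  have hq₁n : Nice q₁ := (c1 0).add (c2 1)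
  have hpp : ∀ k x, pd k p x = cv m (u 0) x * ((-1) * pd k (pd 1 w) x) +
      ((-1) * pd 1 w x) * pd k (cv m (u 0)) x +
      (cv m (u 1) x * pd k (pd 0 w) x + pd 0 w x * pd k (cv m (u 1)) x) := fun k x => by
    rw [hp, Nice.pd_add ((hv 0).mul ((hwn.pd_nice 1).const_mul (-1))) ((hv 1).mul (hwn.pd_nice 0)),
      Nice.pd_mul (hv 0) ((hwn.pd_nice 1).const_mul (-1)), Nice.pd_mul (hv 1) (hwn.pd_nice 0),
      Nice.pd_const_mul _ (hwn.pd_nice 1)]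
  have hc1 : ∀ j k x, pd k (fun x => cv m (u 0) x * pd 0 (cv m (u j)) x +
      cv m (u 1) x * pd 1 (cv m (u j)) x) x =
      cv m (u 0) x * pd k (pd 0 (cv m (u j))) x + pd 0 (cv m (u j)) x * pd k (cv m (u 0)) x +
      (cv m (u 1) x * pd k (pd 1 (cv m (u j))) x + pd 1 (cv m (u j)) x * pd k (cv m (u 1)) x) :=
    fun j k x => by
      rw [Nice.pd_add ((hv 0).mul ((hv j).pd_nice 0)) ((hv 1).mul ((hv j).pd_nice 1)),
        Nice.pd_mul (hv 0) ((hv j).pd_nice 0), Nice.pd_mul (hv 1) ((hv j).pd_nice 1)]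
  have hc2 : ∀ j k x, pd k (fun x => 1 / 2 * (cv m (u j) x * w x)) x =
      1 / 2 * (cv m (u j) x * pd k w x + w x * pd k (cv m (u j)) x) := fun j k x => by
    rw [Nice.pd_const_mul _ ((hv j).mul hwn), Nice.pd_mul (hv j) hwn]
  have hq₀p : ∀ k x, pd k q₀ x = _ := fun k x => by
    rw [hq₀, Nice.pd_add ((c1 1).const_mul (-1)) (c2 0), Nice.pd_const_mul _ (c1 1), hc1, hc2]
  have hq₁p : ∀ k x, pd k q₁ x = _ := fun k x => by
    rw [hq₁, Nice.pd_add (c1 0) (c2 1), hc1, hc2]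
  have key : ∀ x, ∑ i, ∑ j, cv m (u i) x * cv m (u j) x * hess u m i j x =
      pd 0 (fun x => cv m (u 0) x * p x) x + pd 0 (fun x => w x * q₀ x) x +
      (pd 1 (fun x => cv m (u 1) x * p x) x + pd 1 (fun x => w x * q₁ x) x) := fun x => by
    have d0 := cv_dsym_add_eq_zero (h 0) (h 1) hdiv m x
    have hw1 : ∀ k, pd k w = curl u (dsym k m) := fun k => pd_curl hu k m
    have e0 : ∀ k, curl u (dsym k m) x =
        cv (dsym 0 (dsym k m)) (u 1) x - cv (dsym 1 (dsym k m)) (u 0) x := fun k => rfl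
    have e1 : w x = cv (dsym 0 m) (u 1) x - cv (dsym 1 m) (u 0) x := rfl
    rw [Nice.pd_mul (hv 0) hpn, Nice.pd_mul (hv 1) hpn, Nice.pd_mul hwn hq₀n, Nice.pd_mul hwn hq₁n,
      hpp, hpp, hq₀p, hq₁p]
    simp only [hp, hq₀, hq₁, hw1, pd_curl hu, pd_cv _ (hu _), Fin.sum_univ_two, hess, e0, e1, dsym_comm 1 0]
    simp only [Fin.isValue, ↓reduceIte, one_ne_zero]
    -- The two sides differ by (½ w² - p) div v, which vanishes.
    linear_combination (-(cv m (u 0) x * ((-1) * (cv (dsym 0 (dsym 1 m)) (u 1) x -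
      cv (dsym 1 (dsym 1 m)) (u 0) x)) + cv m (u 1) x * (cv (dsym 0 (dsym 0 m)) (u 1) x -
      cv (dsym 0 (dsym 1 m)) (u 0) x)) + 1 / 2 * (cv (dsym 0 m) (u 1) x -
      cv (dsym 1 m) (u 0) x) ^ 2) * d0
  simp only [key]
  rw [integral_add, integral_add, integral_add, (hv 0).integral_pd_mul hpn,
    hwn.integral_pd_mul hq₀n, (hv 1).integral_pd_mul hpn, hwn.integral_pd_mul hq₁n]
  · simp
  · exact (hv 1).integrable_pd_mul hpn 1
  · exact hwn.integrable_pd_mul hq₁n 1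
  · exact (hv 0).integrable_pd_mul hpn 0
  · exact hwn.integrable_pd_mul hq₀n 0
  · exact ((hv 0).integrable_pd_mul hpn 0).add (hwn.integrable_pd_mul hq₀n 0)
  · exact ((hv 1).integrable_pd_mul hpn 1).add (hwn.integrable_pd_mul hq₁n 1)

end

end

section

/-! ### The estimate of the enstrophy flux -/

variable {χ : Plane → ℝ} (hχ : IsCutoff χ)

theorem sum_range_blk {A : 𝓢(Plane, ℂ) → Plane → ℂ} (hA : ∀ a b, A (a - b) = A a - A b) (N : ℕ) :
    ∑ n ∈ Finset.range (N + 1), A (blk hχ n) = A (dil N (cut hχ)) := by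
  induction N with
  | zero => simp [blk, dil_zero]
  | succ N ih => rw [Finset.sum_range_succ, ih, blk, hA, add_sub_cancel]

theorem sum_range_blk_high {A : 𝓢(Plane, ℂ) → Plane → ℂ} (hA : ∀ a b, A (a - b) = A a - A b)
    {n N : ℕ} (h : n ≤ N) :
    ∑ k ∈ Finset.range (N + 1), (if k ≤ n then 0 else A (blk hχ k)) =
      A (dil N (cut hχ)) - A (dil n (cut hχ)) := by
  induction N, h using Nat.le_induction with
  | base =>
    rw [sub_self]
    exact Finset.sum_eq_zero fun k hk => if_pos (by simpa [Nat.lt_succ_iff] using hk)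
  | succ N hN ih => rw [Finset.sum_range_succ, ih, if_neg (by omega), blk, hA]; abel

theorem le_rpow_half {a X : ℝ≥0∞} (h : a ^ 2 ≤ X) : a ≤ X ^ (1 / 2 : ℝ) := by
  have := ENNReal.rpow_le_rpow h (by norm_num : (0 : ℝ) ≤ 1 / 2)
  rw [← ENNReal.rpow_natCast, ← ENNReal.rpow_mul] at this
  norm_num at this ⊢
  exact this

theorem rpow_half_sq (X : ℝ≥0∞) : (X ^ (1 / 2 : ℝ)) ^ 2 = X := by
  rw [← ENNReal.rpow_natCast, ← ENNReal.rpow_mul]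
  norm_num

theorem curl_sub {u : Fin 2 → Plane → ℂ} (hu : ∀ i, MemLp (u i) 2 volume) (a b : 𝓢(Plane, ℂ)) :
    curl u (a - b) = curl u a - curl u b := by
  have hd : ∀ k, dsym k (a - b) = dsym k a - dsym k b := fun k => by
    ext ξ
    simp only [dsym_apply, sub_apply]
    ring
  rw [curl, hd, hd, cv_sub _ _ (hu 1), cv_sub _ _ (hu 0), curl, curl]
  abel

/-- Almost orthogonality of the blocks q ≤ Q after two derivatives: Bernstein gives 4^n for each
block, hence 16^n after squaring. -/
theorem eLpNorm_hess_le (u : VectorField) (Q : ℕ) (i j : Fin 2) :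
    eLpNorm (hess (comp u) (dil (Q + 1) (cut hχ)) i j) 3 volume ≤
      (ENNReal.ofReal ((12 * lpC hχ ^ 2 + 18) * lpC hχ ^ 4 * 16 ^ (Q + 1)) * Wc χ u Q) ^
        (1 / 2 : ℝ) := by
  have hu := memLp_comp u
  refine le_rpow_half ?_
  obtain ⟨k, hk⟩ := n3_hess (u := comp u) (dil (Q + 1) (cut hχ)) i j
  rw [(nice_hess hu _ i j).eLpNorm_three_eq, hk, ← ENNReal.ofReal_pow (n3_nonneg _)]
  have hA : ∀ a b, curl (comp u) (dsym i (dsym k (a - b))) =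
      curl (comp u) (dsym i (dsym k a)) - curl (comp u) (dsym i (dsym k b)) := fun a b => by
    rw [← curl_sub hu]
    congr 1
    ext ξ
    simp only [dsym_apply, sub_apply]
    ring
  have hbl : ∀ n, curl (comp u) (dsym i (dsym k (blk hχ n))) =
      pd i (pd k (curl (comp u) (blk hχ n))) := fun n => by
    rw [pd_curl hu, pd_curl hu]
  rw [← sum_range_blk hχ (A := fun m => curl (comp u) (dsym i (dsym k m))) hA]
  simp only [hbl]
  have h1 := n3_sum_sq_le_of_isBlock (hχ := hχ)
    (b := fun n => pd i (pd k (curl (comp u) (blk hχ n))))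
    (fun n => ((isBlock_curl hχ hu n).pd k).pd i) (Q + 1 + 1)
  have h2 : ∀ n, n3 (pd i (pd k (curl (comp u) (blk hχ n)))) ^ 2 ≤
      lpC hχ ^ 4 * (16 ^ n * n3 (curl (comp u) (blk hχ n)) ^ 2) := fun n => by
    have h3 := ((isBlock_curl hχ hu n).pd k).n3_pd_le i
    have h4 := (isBlock_curl hχ hu n).n3_pd_le k
    have h0 := lpC_nonneg (hχ := hχ)
    have h5 : n3 (pd i (pd k (curl (comp u) (blk hχ n)))) ≤
        lpC hχ ^ 2 * (4 ^ n * n3 (curl (comp u) (blk hχ n))) := by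
      refine h3.trans ((by gcongr : _ ≤ lpC hχ * (2 ^ n * (lpC hχ * (2 ^ n *
        n3 (curl (comp u) (blk hχ n)))))).trans_eq ?_)
      have : (4 : ℝ) ^ n = 2 ^ n * 2 ^ n := by rw [← mul_pow]; norm_num
      rw [this]; ring
    refine (pow_le_pow_left₀ (n3_nonneg _) h5 2).trans_eq ?_
    have : (16 : ℝ) ^ n = 4 ^ n * 4 ^ n := by rw [← mul_pow]; norm_num
    rw [this]; ring
  have h6 := h1.trans (mul_le_mul_of_nonneg_left (Finset.sum_le_sum fun n _ => h2 n)
    (by positivity))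
  rw [← Finset.mul_sum, ← mul_assoc] at h6
  refine (ENNReal.ofReal_le_ofReal h6).trans ?_
  have h0 : 0 ≤ (12 * lpC hχ ^ 2 + 18) * lpC hχ ^ 4 := by positivity
  rw [ENNReal.ofReal_mul h0, ENNReal.ofReal_mul h0, mul_assoc]
  gcongr
  exact sum_low_le hχ u Q

/-- Almost orthogonality of the blocks q > Q of the velocity, each controlled by the vorticity
through Biot–Savart; the lower blocks are replaced by zero so that the indices are unchanged. -/
theorem eLpNorm_comp_sub_le (u : VectorField) (hdiv : DivergenceFree u) (Q : ℕ) (j : Fin 2) :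
    eLpNorm (comp u j - cv (dil (Q + 1) (cut hχ)) (comp u j)) 3 volume ≤
      (ENNReal.ofReal ((12 * lpC hχ ^ 2 + 18) * lpC hχ ^ 2 * 4⁻¹ ^ (Q + 1)) * Wc χ u Q) ^
        (1 / 2 : ℝ) := by
  have hu := memLp_comp u
  rw [DivergenceFree, Fin.sum_univ_two] at hdiv
  refine eLpNorm_sub_cv_dil_le hχ (hu j) _ fun N hN => le_rpow_half ?_
  have hA : ∀ a b, cv (a - b) (comp u j) = cv a (comp u j) - cv b (comp u j) :=
    fun a b => cv_sub a b (hu j)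
  rw [((nice_cv _ (hu j)).sub (nice_cv _ (hu j))).eLpNorm_three_eq,
    ← ENNReal.ofReal_pow (n3_nonneg _),
    ← sum_range_blk_high hχ (A := fun m => cv m (comp u j)) hA hN]
  have h1 := n3_sum_sq_le_of_isBlock (hχ := hχ)
    (b := fun n => if n ≤ Q + 1 then 0 else cv (blk hχ n) (comp u j))
    (fun n => by
      split_ifs
      · exact IsBlock.zero hχ n
      · exact isBlock_cv hχ n (hu j)) (N + 1)
  have h2 : ∀ n, n3 (if n ≤ Q + 1 then 0 else cv (blk hχ n) (comp u j)) ^ 2 ≤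
      lpC hχ ^ 2 * (if n ≤ Q + 1 then 0 else
        (4⁻¹ : ℝ) ^ n * n3 (curl (comp u) (blk hχ n)) ^ 2) := fun n => by
    split_ifs with h
    · simp [n3]
    · refine (pow_le_pow_left₀ (n3_nonneg _)
        (n3_cv_blk_le (rep_comp u) hdiv n (by omega) j) 2).trans_eq ?_
      have : (4⁻¹ : ℝ) ^ n = 2⁻¹ ^ n * 2⁻¹ ^ n := by rw [← mul_pow]; norm_num
      rw [this]; ring
  have h6 := h1.trans (mul_le_mul_of_nonneg_left (Finset.sum_le_sum fun n _ => h2 n)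
    (by positivity))
  rw [← Finset.mul_sum, ← mul_assoc] at h6
  refine (ENNReal.ofReal_le_ofReal h6).trans ?_
  have h0 : 0 ≤ (12 * lpC hχ ^ 2 + 18) * lpC hχ ^ 2 := by positivity
  rw [ENNReal.ofReal_mul h0, ENNReal.ofReal_mul h0, mul_assoc]
  gcongr
  exact sum_high_le hχ u Q _

/-- The factor 6 comes from 171 ≤ 6³. -/
theorem eLpNorm_pd_cv_le {u : Fin 2 → Plane → ℂ} {T : Fin 2 → Distr}
    (h : ∀ i, Rep 2 (u i) (T i)) (hdiv : ∂_{e 0} (T 0) + ∂_{e 1} (T 1) = 0) (m : 𝓢(Plane, ℂ))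
    (hm : HasCompactSupport m) (i j : Fin 2) :
    eLpNorm (pd i (cv m (u j))) 3 volume ≤ 6 * eLpNorm (curl u m) 3 volume := by
  have hu : ∀ i, MemLp (u i) 2 volume := fun i => (h i).memLp
  have h1 : n3 (pd i (cv m (u j))) ≤ 6 * n3 (curl u m) := by
    refine le_of_pow_le_pow_left₀ three_ne_zero (mul_nonneg (by norm_num) (n3_nonneg _)) ?_
    have h2 := n3_cv_dsym_le (h 0) (h 1) hdiv m hm i
    have h3 : n3 (pd i (cv m (u j))) ^ 3 ≤ 171 * n3 (curl u m) ^ 3 := by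
      rw [pd_cv _ (hu j)]
      fin_cases j
      · exact h2.1
      · exact h2.2
    rw [mul_pow]
    have := pow_nonneg (n3_nonneg (curl u m)) 3
    linarith
  rw [((nice_cv _ (hu j)).pd_nice i).eLpNorm_three_eq, (nice_curl hu m).eLpNorm_three_eq]
  refine (ENNReal.ofReal_le_ofReal h1).trans_eq ?_
  rw [ENNReal.ofReal_mul (by norm_num)]
  norm_num

/-- Replaces the representatives chosen in the definition of the flux by explicit continuous ones.
-/
theorem fluxDensity_ae_eq (Q : ℕ) (u : VectorField) :
    fluxDensity χ Q u =ᵐ[volume] fun x => ∑ i, ∑ j,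
      cv (dil (Q + 1) (cut hχ)) (fun y => comp u i y * comp u j y) x *
        hess (comp u) (dil (Q + 1) (cut hχ)) i j x := by
  set s := dil (Q + 1) (cut hχ)
  have h1 : ∀ i j, toFunction (partialSum χ Q (tensor u i j)) =ᵐ[volume]
      cv s (fun y => comp u i y * comp u j y) := fun i j => by
    rw [partialSum_eq_mult hχ]
    exact (Rep.cv (by simp) s (rep_toLp (memLp_tensor u i j))).represents.toFunction_ae_eq
  have h2 : ∀ i j, toFunction (∂_{e i} (gradPerp (partialSum χ Q (vorticity u)) j)) =ᵐ[volume]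
      hess (comp u) s i j := fun i j => by
    rw [partialSum_eq_mult hχ, gradPerp, hess]
    split_ifs
    · have h3 := (rep_curl (rep_comp u) (dsym i (dsym 1 s))).neg
      rw [← lineDeriv_mult, ← lineDeriv_mult, ← LineDeriv.lineDerivOp_neg] at h3
      exact h3.represents.toFunction_ae_eq.trans (ae_of_all _ fun x => by simp)
    · have h3 := rep_curl (rep_comp u) (dsym i (dsym 0 s))
      rw [← lineDeriv_mult, ← lineDeriv_mult] at h3
      exact h3.represents.toFunction_ae_eq
  have h3 : ∀ᵐ x, ∀ i j, toFunction (partialSum χ Q (tensor u i j)) x =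
      cv s (fun y => comp u i y * comp u j y) x := by
    simp only [ae_all_iff]
    exact h1
  have h4 : ∀ᵐ x, ∀ i j, toFunction (∂_{e i} (gradPerp (partialSum χ Q (vorticity u)) j)) x =
      hess (comp u) s i j x := by
    simp only [ae_all_iff]
    exact h2
  filter_upwards [h3, h4] with x h5 h6
  simp only [fluxDensity, h5, h6]

theorem integrable_cv_mul_hess (u : VectorField) (m : 𝓢(Plane, ℂ)) (i j : Fin 2) :
    Integrable fun x => cv m (fun y => comp u i y * comp u j y) x * hess (comp u) m i j x :=
  (Nice.conv1 _ (memLp_tensor u i j)).integrable_mul (nice_hess (memLp_comp u) m i j)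

theorem integrable_fluxDensity (hχ : IsCutoff χ) (Q : ℕ) (u : VectorField) : Integrable (fluxDensity χ Q u) := by
  refine Integrable.congr ?_ (fluxDensity_ae_eq hχ Q u).symm
  exact integrable_finsetSum _ fun i _ => integrable_finsetSum _ fun j _ =>
    integrable_cv_mul_hess u _ i j

theorem enorm_flux_le (u : VectorField) (hdiv : DivergenceFree u) (Q : ℕ) {V R H : ℝ≥0∞}
    (hV : ∀ i j, eLpNorm (pd i (cv (dil (Q + 1) (cut hχ)) (comp u j))) 3 volume ≤ V)
    (hR : ∀ j, eLpNorm (comp u j - cv (dil (Q + 1) (cut hχ)) (comp u j)) 3 volume ≤ R)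
    (hH : ∀ i j, eLpNorm (hess (comp u) (dil (Q + 1) (cut hχ)) i j) 3 volume ≤ H) :
    ‖flux χ Q u‖ₑ ≤ 4 * ((2 * (2 * V) ^ 2 * (((4 : ℝ≥0∞) ^ (Q + 1))⁻¹ *
        ∫⁻ x, ‖(𝓕⁻ (cut hχ) : 𝓢(Plane, ℂ)) x‖ₑ * ‖x‖ₑ ^ 2) +
      8 * R ^ 2 * eLpNorm (𝓕⁻ (cut hχ) : 𝓢(Plane, ℂ)) 1 volume) * H + R * R * H) := by
  have hu := memLp_comp u
  have hum : ∀ i, Measurable (comp u i) := fun i => (Lp.stronglyMeasurable _).measurable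
  rw [DivergenceFree, Fin.sum_univ_two] at hdiv
  set s := dil (Q + 1) (cut hχ) with hs
  have hs0 : s 0 = 1 := by rw [hs, dil_apply, smul_zero, cut_eq_one hχ (by simp)]
  set v : Fin 2 → Plane → ℂ := fun i => cv s (comp u i) with hv
  have hvn : ∀ i, Nice (v i) := fun i => nice_cv _ (hu i)
  set G := hess (comp u) s with hG
  have hGn : ∀ i j, Nice (G i j) := nice_hess hu s
  have hint1 : ∀ i j, Integrable fun x => v i x * v j x * G i j x := fun i j =>
    ((hvn i).mul (hvn j)).integrable_mul (hGn i j)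
  -- Subtracting the vanishing flux of the mollified field leaves the commutator and the product of
  -- the two remainders.
  have h1 : flux χ Q u = ∫ x, ∑ i, ∑ j, (comm s (comp u i) (comp u j) x -
      (comp u i x - v i x) * (comp u j x - v j x)) * G i j x := by
    have h2 : flux χ Q u = (∫ x, ∑ i, ∑ j, cv s (fun y => comp u i y * comp u j y) x * G i j x) -
        ∫ x, ∑ i, ∑ j, v i x * v j x * G i j x := by
      rw [integral_cv_mul_hess (rep_comp u) hdiv s, sub_zero, flux]
      exact integral_congr_ae (fluxDensity_ae_eq hχ Q u)
    rw [h2, ← integral_sub]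
    · refine integral_congr_ae (ae_of_all _ fun x => ?_)
      simp only [← Finset.sum_sub_distrib]
      refine Finset.sum_congr rfl fun i _ => Finset.sum_congr rfl fun j _ => ?_
      rw [cv_mul_eq s hs0 (hu i) (hu j)]
      ring
    · exact integrable_finsetSum _ fun i _ => integrable_finsetSum _ fun j _ =>
        integrable_cv_mul_hess u _ i j
    · exact integrable_finsetSum _ fun i _ => integrable_finsetSum _ fun j _ => hint1 i j
  have hGm : ∀ i j, Measurable (G i j) := fun i j => (hGn i j).continuous.measurable
  have hwm : ∀ i, Measurable fun x => comp u i x - v i x := fun i =>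
    (hum i).sub (hvn i).continuous.measurable
  have hcm : ∀ i j, Measurable (comm s (comp u i) (comp u j)) := fun i j => by
    have : comm s (comp u i) (comp u j) = fun x => cv s (fun y => comp u i y * comp u j y) x +
        (comp u i x - v i x) * (comp u j x - v j x) - v i x * v j x := by
      ext x
      rw [cv_mul_eq s hs0 (hu i) (hu j)]
      ring
    rw [this]
    exact (((Nice.conv1 _ (memLp_tensor u i j)).continuous.measurable).add
      ((hwm i).mul (hwm j))).sub
      ((hvn i).continuous.measurable.mul (hvn j).continuous.measurable)
  -- The factor `2 * V` is the sum of the bounds of the two partial derivatives.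
  have htr : ∀ i z, eLpNorm (fun x => comp u i (x - z) - comp u i x) 3 volume ≤
      ‖z‖ₑ * (2 * V) + 2 * R := fun i z => by
    refine (eLpNorm_translate_sub_le_of_sub (hu i) (hvn i) (hR i) z).trans ?_
    gcongr
    rw [two_mul]
    exact add_le_add (hV 0 i) (hV 1 i)
  have hterm : ∀ i j, ∫⁻ x, (‖comm s (comp u i) (comp u j) x‖ₑ * ‖G i j x‖ₑ +
      ‖comp u i x - v i x‖ₑ * ‖comp u j x - v j x‖ₑ * ‖G i j x‖ₑ) ≤
      (2 * (2 * V) ^ 2 * (((4 : ℝ≥0∞) ^ (Q + 1))⁻¹ *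
        ∫⁻ x, ‖(𝓕⁻ (cut hχ) : 𝓢(Plane, ℂ)) x‖ₑ * ‖x‖ₑ ^ 2) +
      8 * R ^ 2 * eLpNorm (𝓕⁻ (cut hχ) : 𝓢(Plane, ℂ)) 1 volume) * H + R * R * H := fun i j => by
    have m1 : Measurable fun x => ‖comp u i x - v i x‖ₑ * ‖comp u j x - v j x‖ₑ * ‖G i j x‖ₑ :=
      ((hwm i).enorm.mul (hwm j).enorm).mul (hGm i j).enorm
    rw [lintegral_add_right _ m1]
    refine add_le_add ?_ ?_
    · have := lintegral_comm_mul_le s (hum i) (hum j) (hGm i j) (htr i) (htr j)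
      rw [lintegral_norm_sq_fourierInv_dil, eLpNorm_one_fourierInv_dil] at this
      exact this.trans (by gcongr; exact hH i j)
    · have := lintegral_mul_mul_le (μ := volume) (hwm i).enorm.aemeasurable
        (hwm j).enorm.aemeasurable (hGm i j).enorm.aemeasurable
      simp only [eLpNorm_enorm] at this
      refine this.trans ?_
      gcongr
      · exact hR i
      · exact hR j
      · exact hH i j
  rw [h1]
  refine (enorm_integral_le_lintegral_enorm _).trans ?_
  calc ∫⁻ x, ‖∑ i, ∑ j, (comm s (comp u i) (comp u j) x -
        (comp u i x - v i x) * (comp u j x - v j x)) * G i j x‖ₑ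
      ≤ ∫⁻ x, ∑ i, ∑ j, (‖comm s (comp u i) (comp u j) x‖ₑ * ‖G i j x‖ₑ +
        ‖comp u i x - v i x‖ₑ * ‖comp u j x - v j x‖ₑ * ‖G i j x‖ₑ) := by
        refine lintegral_mono fun x => (enorm_sum_le _ _).trans (Finset.sum_le_sum fun i _ =>
          (enorm_sum_le _ _).trans (Finset.sum_le_sum fun j _ => ?_))
        rw [enorm_mul, ← enorm_mul (comp u i x - v i x), ← add_mul]
        gcongr
        exact enorm_sub_le
    _ ≤ _ := by
        have hterm_m : ∀ i j, Measurable fun x => ‖comm s (comp u i) (comp u j) x‖ₑ * ‖G i j x‖ₑ +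
            ‖comp u i x - v i x‖ₑ * ‖comp u j x - v j x‖ₑ * ‖G i j x‖ₑ := fun i j =>
          ((hcm i j).enorm.mul (hGm i j).enorm).add
            (((hwm i).enorm.mul (hwm j).enorm).mul (hGm i j).enorm)
        rw [lintegral_finsetSum _ fun i _ => Finset.measurable_fun_sum _ fun j _ => hterm_m i j]
        simp only [lintegral_finsetSum _ fun j _ => hterm_m _ j]
        refine (Finset.sum_le_sum fun i _ => Finset.sum_le_sum fun j _ => hterm i j).trans_eq ?_
        simp only [Finset.sum_const, Finset.card_univ, Fintype.card_fin, nsmul_eq_mul]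
        rw [← mul_assoc]
        norm_num

theorem exists_enorm_flux_le (hχ : IsCutoff χ) :
    ∃ C : ℝ≥0, ∀ u : VectorField, DivergenceFree u → ∀ Q : ℕ,
    ‖flux χ Q u‖ₑ ≤ C * (distNorm 3 (partialSum χ Q (vorticity u)) ^ 2 * Wc χ u Q ^ (1 / 2 : ℝ) +
      Wc χ u Q ^ (3 / 2 : ℝ)) := by
  set κ₁ := eLpNorm (𝓕⁻ (cut hχ) : 𝓢(Plane, ℂ)) 1 volume with hκ₁
  set κ₂ := ∫⁻ x, ‖(𝓕⁻ (cut hχ) : 𝓢(Plane, ℂ)) x‖ₑ * ‖x‖ₑ ^ 2 with hκ₂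
  have hκ₁t : κ₁ ≠ ⊤ := (SchwartzMap.eLpNorm_lt_top _ _ volume).ne
  have hκ₂t : κ₂ ≠ ⊤ := (lintegral_norm_sq_schwartz_lt_top _).ne
  set a := ENNReal.ofReal ((12 * lpC hχ ^ 2 + 18) * lpC hχ ^ 2) with ha
  set b := ENNReal.ofReal ((12 * lpC hχ ^ 2 + 18) * lpC hχ ^ 4) ^ (1 / 2 : ℝ) with hb
  have hbt : b ≠ ⊤ := ENNReal.rpow_ne_top_of_nonneg (by norm_num) ENNReal.ofReal_ne_top
  -- The number 288 is 2·(2·6)², from the gradient bound inserted in the commutator; 8 κ₁ and 1 come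
  -- from the remainder inside and outside the commutator, and 4 counts the pairs of indices.
  set K := 4 * b * (288 * κ₂ + (8 * κ₁ + 1) * a) with hK
  have hat : a ≠ ⊤ := ENNReal.ofReal_ne_top
  have hKt : K ≠ ⊤ := by finiteness
  refine ⟨K.toNNReal, fun u hdiv Q => ?_⟩
  rw [ENNReal.coe_toNNReal hKt]
  have hdiv2 : ∂_{e 0} (component u 0 : Distr) + ∂_{e 1} (component u 1 : Distr) = 0 := by
    rw [← hdiv, Fin.sum_univ_two]
  set z₃ := eLpNorm (curl (comp u) (dil (Q + 1) (cut hχ))) 3 volume with hz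
  have hzd : distNorm 3 (partialSum χ Q (vorticity u)) = z₃ := by
    rw [partialSum_eq_mult hχ, vorticity, (rep_curl_three (rep_comp u) _).distNorm_eq]
  rw [hzd]
  set X := Wc χ u Q with hX
  set Λ := (4 : ℝ≥0∞) ^ (Q + 1) with hΛ
  have hΛ0 : Λ ≠ 0 := by positivity
  have hΛt : Λ ≠ ⊤ := by finiteness
  have h := enorm_flux_le hχ u hdiv Q
    (fun i j => eLpNorm_pd_cv_le (rep_comp u) hdiv2 _
      (hasCompactSupport_dil (hasCompactSupport_cut hχ) _) i j)
    (fun j => eLpNorm_comp_sub_le hχ u hdiv Q j) (fun i j => eLpNorm_hess_le hχ u Q i j)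
  have hR : (ENNReal.ofReal ((12 * lpC hχ ^ 2 + 18) * lpC hχ ^ 2 * 4⁻¹ ^ (Q + 1)) * X) =
      a * Λ⁻¹ * X := by
    rw [ENNReal.ofReal_mul (by positivity), ← ha, hΛ, ENNReal.ofReal_pow (by norm_num),
      ENNReal.inv_pow, ENNReal.ofReal_inv_of_pos (by norm_num)]
    norm_num
  have hH : (ENNReal.ofReal ((12 * lpC hχ ^ 2 + 18) * lpC hχ ^ 4 * 16 ^ (Q + 1)) * X) ^
      (1 / 2 : ℝ) = b * Λ * X ^ (1 / 2 : ℝ) := by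
    have h16 : ENNReal.ofReal (16 ^ (Q + 1)) = Λ ^ 2 := by
      rw [ENNReal.ofReal_pow (by norm_num), hΛ, ← pow_mul, mul_comm (Q + 1) 2, pow_mul]
      norm_num
    have hΛh : (Λ ^ 2) ^ (1 / 2 : ℝ) = Λ := by
      rw [← ENNReal.rpow_natCast, ← ENNReal.rpow_mul]
      norm_num
    rw [ENNReal.mul_rpow_of_nonneg _ _ (by norm_num), ENNReal.ofReal_mul (by positivity),
      ENNReal.mul_rpow_of_nonneg _ _ (by norm_num), h16, hΛh]
  have hX2 : X ^ (3 / 2 : ℝ) = X * X ^ (1 / 2 : ℝ) := by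
    conv_rhs => rw [← ENNReal.rpow_one X, ← ENNReal.rpow_mul]
    rw [← ENNReal.rpow_add_of_nonneg _ _ (by norm_num) (by norm_num)]
    norm_num
  rw [rpow_half_sq, ← sq, rpow_half_sq, hR, hH] at h
  refine h.trans ?_
  rw [hX2]
  -- Scale invariance: the kernel's second moment and the squared remainder carry Λ⁻¹, while the
  -- Hessian carries Λ.
  have e1 : Λ⁻¹ * Λ = 1 := ENNReal.inv_mul_cancel hΛ0 hΛt
  calc _ = 4 * b * (288 * κ₂ * (z₃ ^ 2 * X ^ (1 / 2 : ℝ)) +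
        (8 * κ₁ + 1) * a * (X * X ^ (1 / 2 : ℝ))) * (Λ⁻¹ * Λ) := by ring
    _ = 4 * b * (288 * κ₂ * (z₃ ^ 2 * X ^ (1 / 2 : ℝ)) +
        (8 * κ₁ + 1) * a * (X * X ^ (1 / 2 : ℝ))) := by rw [e1, mul_one]
    _ ≤ 4 * b * ((288 * κ₂ + (8 * κ₁ + 1) * a) * (z₃ ^ 2 * X ^ (1 / 2 : ℝ)) +
        (288 * κ₂ + (8 * κ₁ + 1) * a) * (X * X ^ (1 / 2 : ℝ))) := by
        gcongr
        · exact le_self_add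
        · exact le_add_self
    _ = _ := by rw [hK]; ring

end

section

/-! ### Weakly continuous curves in a Hilbert space -/

section

variable {H : Type*} [NormedAddCommGroup H] [InnerProductSpace ℝ H]

/-- Distances to a point are suprema of continuous scalar functions, so their sublevel sets are
closed; by separability the balls generate the Borel sets. -/
theorem measurable_of_continuous_inner [SecondCountableTopology H] [MeasurableSpace H]
    [BorelSpace H] {u : ℝ → H} (hu : ∀ v, Continuous fun t => inner ℝ (u t) v) : Measurable u := by
  have hn : ∀ v, Measurable fun t => dist (u t) v := fun v => by
    refine measurable_of_Iic fun R => ?_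
    by_cases hR : 0 ≤ R
    · refine IsClosed.measurableSet ?_
      have : (fun t => dist (u t) v) ⁻¹' Iic R =
          ⋂ x : H, {t | inner ℝ (u t) x - inner ℝ v x ≤ R * ‖x‖} := by
        ext t
        simp only [mem_preimage, mem_Iic, mem_iInter, mem_ofPred_eq, ← inner_sub_left, dist_eq_norm]
        constructor
        · intro h x
          exact (real_inner_le_norm _ _).trans (by gcongr)
        · intro h
          have h1 := h (u t - v)
          rw [real_inner_self_eq_norm_sq, sq] at h1
          by_contra! h2
          have : 0 < ‖u t - v‖ := hR.trans_lt h2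
          nlinarith
      rw [this]
      exact isClosed_iInter fun x => isClosed_le ((hu x).sub continuous_const) continuous_const
    · have : (fun t => dist (u t) v) ⁻¹' Iic R = ∅ := by
        ext t
        simp only [mem_preimage, mem_Iic, mem_empty_iff_false, iff_false, not_le]
        exact (not_le.1 hR).trans_le dist_nonneg
      rw [this]
      exact MeasurableSet.empty
  have hb : TopologicalSpace.IsTopologicalBasis {s : Set H | ∃ v R, s = Metric.ball v R} := by
    refine TopologicalSpace.isTopologicalBasis_of_isOpen_of_nhds ?_ ?_
    · rintro _ ⟨v, R, rfl⟩
      exact Metric.isOpen_ball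
    · intro a U ha hU
      obtain ⟨ε, hε, h⟩ := Metric.isOpen_iff.1 hU a ha
      exact ⟨_, ⟨a, ε, rfl⟩, Metric.mem_ball_self hε, h⟩
  rw [BorelSpace.measurable_eq (α := H), hb.borel_eq_generateFrom]
  refine measurable_generateFrom ?_
  rintro _ ⟨v, R, rfl⟩
  exact measurableSet_lt (hn v) measurable_const

/-- Uniform boundedness principle for the functionals ⟨u(t), ·⟩. -/
theorem exists_norm_le_of_continuousOn_inner [CompleteSpace H] {u : ℝ → H} {s : Set ℝ}
    (hs : IsCompact s) (hu : ∀ v, ContinuousOn (fun t => inner ℝ (u t) v) s) :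
    ∃ M, ∀ t ∈ s, ‖u t‖ ≤ M := by
  obtain ⟨M, hM⟩ := banach_steinhaus (g := fun t : s => innerSL ℝ (u t)) fun v => by
    obtain ⟨C, hC⟩ := hs.exists_bound_of_continuousOn (hu v)
    exact ⟨C, fun t => by simpa using! hC t t.2⟩
  exact ⟨M, fun t ht => by simpa using! hM ⟨t, ht⟩⟩

end

/-- The conservation law does not mention a cutoff, so one has to be produced. The transition 3 -
4|ξ|² is at least 1 for |ξ|² ≤ 1/2 and nonpositive for |ξ|² ≥ 3/4. -/
theorem exists_isCutoff : ∃ χ : Plane → ℝ, IsCutoff χ := by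
  set χ : Plane → ℝ := fun ξ => Real.smoothTransition (3 - 4 * ‖ξ‖ ^ 2) with hχ
  have hsupp : tsupport χ ⊆ Metric.closedBall 0 (7 / 8) := by
    refine closure_minimal (fun ξ hξ => ?_) Metric.isClosed_closedBall
    rw [mem_closedBall_zero_iff]
    by_contra! h
    refine hξ (Real.smoothTransition.zero_of_nonpos ?_)
    nlinarith
  refine ⟨χ, ⟨?_, fun ξ => Real.smoothTransition.nonneg _, fun ξ η h => by simp only [hχ, h],
    ?_, ?_, fun ξ hξ => ?_⟩⟩
  · exact Real.smoothTransition.contDiff.comp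
      (contDiff_const.sub (contDiff_const.mul (contDiff_norm_sq ℝ)))
  · exact (isCompact_closedBall (0 : Plane) (7 / 8)).of_isClosed_subset (isClosed_tsupport _) hsupp
  · exact hsupp.trans (Metric.closedBall_subset_ball (by norm_num))
  · refine Real.smoothTransition.one_of_one_le ?_
    have := norm_nonneg ξ
    nlinarith

/-! ### Multipliers and products as operators on `L^p` -/

theorem exists_clm_cv {p q : ℝ≥0∞} [Fact (1 ≤ p)] [Fact (1 ≤ q)] (m : 𝓢(Plane, ℂ)) (C : ℝ≥0)
    (h : ∀ f : Plane → ℂ, MemLp f p volume → MemLp (cv m f) q volume)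
    (hC : ∀ f : Plane → ℂ, MemLp f p volume →
      eLpNorm (cv m f) q volume ≤ C * eLpNorm f p volume) :
    ∃ L : Lp ℂ p (volume : Measure Plane) →L[ℂ] Lp ℂ q (volume : Measure Plane),
      ∀ F, L F =ᵐ[volume] cv m F := by
  let A : Lp ℂ p (volume : Measure Plane) →ₗ[ℂ] Lp ℂ q (volume : Measure Plane) :=
    { toFun := fun F => (h F (Lp.memLp F)).toLp
      map_add' := fun F G => by
        rw [← MemLp.toLp_add, MemLp.toLp_eq_toLp_iff]
        refine ae_of_all _ fun x => ?_
        have : cv m (F + G : Lp ℂ p (volume : Measure Plane)) = cv m ((F : Plane → ℂ) + G) :=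
          conv_congr _ (Lp.coeFn_add F G)
        rw [this]
        simp only [cv, conv, Pi.add_apply, mul_add]
        exact integral_add (integrable_kernel_mul _ (Lp.memLp F) x)
          (integrable_kernel_mul _ (Lp.memLp G) x)
      map_smul' := fun c F => by
        rw [RingHom.id_apply, ← MemLp.toLp_const_smul, MemLp.toLp_eq_toLp_iff]
        refine ae_of_all _ fun x => ?_
        have : cv m (c • F : Lp ℂ p (volume : Measure Plane)) = cv m (c • (F : Plane → ℂ)) :=
          conv_congr _ (Lp.coeFn_smul c F)
        rw [this]
        simp only [cv, conv, Pi.smul_apply, smul_eq_mul, mul_left_comm _ c, integral_const_mul] }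
  refine ⟨A.mkContinuous C fun F => ?_, fun F => (h F (Lp.memLp F)).coeFn_toLp⟩
  change ‖(h F (Lp.memLp F)).toLp‖ ≤ _
  rw [Lp.norm_toLp, Lp.norm_def, ← ENNReal.coe_toReal, ← ENNReal.toReal_mul]
  exact ENNReal.toReal_mono (ENNReal.mul_ne_top ENNReal.coe_ne_top (Lp.eLpNorm_ne_top F))
    (hC F (Lp.memLp F))

theorem exists_cvL (p : ℝ≥0∞) [Fact (1 ≤ p)] (hp : p ≠ ⊤) (m : 𝓢(Plane, ℂ)) :
    ∃ L : Lp ℂ p (volume : Measure Plane) →L[ℂ] Lp ℂ p (volume : Measure Plane),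
      ∀ F, L F =ᵐ[volume] cv m F := by
  refine exists_clm_cv m (eLpNorm (𝓕⁻ m : 𝓢(Plane, ℂ)) 1 volume).toNNReal
    (fun f hf => memLp_conv hp _ hf) fun f hf => ?_
  rw [ENNReal.coe_toNNReal (SchwartzMap.eLpNorm_lt_top _ _ volume).ne]
  exact eLpNorm_conv_le hp _ hf

/-- The Fourier multiplier on `L^p`. -/
def cvL (p : ℝ≥0∞) [Fact (1 ≤ p)] (hp : p ≠ ⊤) (m : 𝓢(Plane, ℂ)) :
    Lp ℂ p (volume : Measure Plane) →L[ℂ] Lp ℂ p (volume : Measure Plane) :=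
  (exists_cvL p hp m).choose

theorem coeFn_cvL (p : ℝ≥0∞) [Fact (1 ≤ p)] (hp : p ≠ ⊤) (m : 𝓢(Plane, ℂ))
    (F : Lp ℂ p (volume : Measure Plane)) : cvL p hp m F =ᵐ[volume] cv m F :=
  (exists_cvL p hp m).choose_spec F

/-- Interpolation between the L¹ and the sup bound of the convolution. It places the mollified
quadratic nonlinearity in the Hilbert space L². -/
theorem exists_cvL₁₂ (m : 𝓢(Plane, ℂ)) :
    ∃ L : Lp ℂ 1 (volume : Measure Plane) →L[ℂ] Lp ℂ 2 (volume : Measure Plane),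
      ∀ F, L F =ᵐ[volume] cv m F := by
  set a := eLpNorm (𝓕⁻ m : 𝓢(Plane, ℂ)) (1 - 1⁻¹)⁻¹ volume with ha
  set b := eLpNorm (𝓕⁻ m : 𝓢(Plane, ℂ)) 1 volume with hb
  have hat : a ≠ ⊤ := (SchwartzMap.eLpNorm_lt_top _ _ volume).ne
  have hbt : b ≠ ⊤ := (SchwartzMap.eLpNorm_lt_top _ _ volume).ne
  refine exists_clm_cv m (a + b).toNNReal (fun f hf => (Nice.conv1 _ hf).memLp_two) fun f hf => ?_
  rw [ENNReal.coe_toNNReal (ENNReal.add_ne_top.2 ⟨hat, hbt⟩)]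
  have h1 : ∀ x, ‖cv m f x‖ₑ ≤ a * eLpNorm f 1 volume := enorm_conv_le (𝓕⁻ m) hf
  have h2 : eLpNorm (cv m f) 1 volume ≤ b * eLpNorm f 1 volume :=
    eLpNorm_conv_le (by simp) (𝓕⁻ m) hf
  have h3 : eLpNorm (cv m f) 2 volume ^ 2 ≤ ((a + b) * eLpNorm f 1 volume) ^ 2 := by
    rw [eLpNorm_two_pow]
    calc ∫⁻ x, ‖cv m f x‖ₑ ^ 2 ≤ ∫⁻ x, (a * eLpNorm f 1 volume) * ‖cv m f x‖ₑ := by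
          refine lintegral_mono fun x => ?_
          rw [sq]
          gcongr
          exact h1 x
      _ = (a * eLpNorm f 1 volume) * eLpNorm (cv m f) 1 volume := by
          rw [lintegral_const_mul' _ _ (ENNReal.mul_ne_top hat hf.2.ne),
            eLpNorm_one_eq_lintegral_enorm (f := cv m f)]
      _ ≤ (a * eLpNorm f 1 volume) * (b * eLpNorm f 1 volume) := by gcongr
      _ ≤ ((a + b) * eLpNorm f 1 volume) * ((a + b) * eLpNorm f 1 volume) := by
          gcongr
          · exact le_self_add
          · exact le_add_self
      _ = _ := by ring
  exact (ENNReal.pow_le_pow_left_iff two_ne_zero).1 h3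

/-- The Fourier multiplier from `L¹` to `L²`. -/
def cvL₁₂ (m : 𝓢(Plane, ℂ)) :
    Lp ℂ 1 (volume : Measure Plane) →L[ℂ] Lp ℂ 2 (volume : Measure Plane) :=
  (exists_cvL₁₂ m).choose

theorem coeFn_cvL₁₂ (m : 𝓢(Plane, ℂ)) (F : Lp ℂ 1 (volume : Measure Plane)) :
    cvL₁₂ m F =ᵐ[volume] cv m F := (exists_cvL₁₂ m).choose_spec F

theorem continuous_component (i : Fin 2) : Continuous fun u : VectorField => component u i :=
  (ContinuousLinearMap.compLpL 2 volume
    (Complex.ofRealCLM ∘L (EuclideanSpace.proj i : Plane →L[ℝ] ℝ))).continuous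

/-- The entry `u_i u_j` of `u ⊗ u`, as an element of `L¹`. -/
def tens (u : VectorField) (i j : Fin 2) : Lp ℂ 1 (volume : Measure Plane) :=
  (memLp_tensor u i j).toLp

theorem tensor_eq (u : VectorField) (i j : Fin 2) : tensor u i j = (tens u i j : Distr) := rfl

theorem continuous_tens (i j : Fin 2) : Continuous fun u : VectorField => tens u i j := by
  have h : ∀ u, tens u i j = (ContinuousLinearMap.mul ℂ ℂ).holder 1 (component u i)
      (component u j) := fun u => by
    rw [tens, ContinuousLinearMap.holder]
    rfl
  simp only [h]
  exact (((ContinuousLinearMap.mul ℂ ℂ).holderL volume 2 2 1).continuous.comp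
    (continuous_component i)).clm_apply (continuous_component j)

end

section

/-! ### The vorticity equation -/

theorem lineDeriv_comm_schwartz (φ : 𝓢(Plane, ℂ)) (v w : Plane) : ∂_{v} (∂_{w} φ) = ∂_{w} (∂_{v} φ) := by
  ext x
  have h2 : ∀ a b : Plane, ∂_{a} (∂_{b} φ) x = fderiv ℝ (fderiv ℝ φ) x a b := fun a b => by
    have h1 : (∂_{b} φ : 𝓢(Plane, ℂ)) = fun y => fderiv ℝ φ y b := by
      ext y; exact SchwartzMap.lineDerivOp_apply_eq_fderiv b φ y
    have hd : DifferentiableAt ℝ (fderiv ℝ φ) x :=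
      ((φ.smooth 2).fderiv_right (m := 1) (by norm_num)).differentiable (by norm_num) x
    rw [SchwartzMap.lineDerivOp_apply_eq_fderiv, h1, fderiv_clm_apply hd (by fun_prop)]
    simp
  rw [h2, h2]
  exact ((φ.smooth 2).contDiffAt.isSymmSndFDerivAt (by simp)) v w

/-- `Re ∇^⊥ φ`. -/
def gradPerpRe (φ : 𝓢(Plane, ℂ)) : 𝓢(Plane, Plane) :=
  (∂_{e 0} φ : 𝓢(Plane, ℂ)).postcompCLM (Complex.reCLM.smulRight (e 1)) -
    (∂_{e 1} φ : 𝓢(Plane, ℂ)).postcompCLM (Complex.reCLM.smulRight (e 0))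

theorem gradPerpRe_apply (φ : 𝓢(Plane, ℂ)) (x : Plane) :
    gradPerpRe φ x = (∂_{e 0} φ x).re • e 1 - (∂_{e 1} φ x).re • e 0 := rfl

theorem plane_eq (v : Plane) : v = v 0 • e 0 + v 1 • e 1 := by
  ext i; fin_cases i <;> simp [e]

theorem fderiv_gradPerpRe (φ : 𝓢(Plane, ℂ)) (x v : Plane) :
    fderiv ℝ (gradPerpRe φ) x v =
      (v 0 * (∂_{e 0} (∂_{e 0} φ) x).re + v 1 * (∂_{e 1} (∂_{e 0} φ) x).re) • e 1 -
        (v 0 * (∂_{e 0} (∂_{e 1} φ) x).re + v 1 * (∂_{e 1} (∂_{e 1} φ) x).re) • e 0 := by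
  have h1 : ∀ (f : 𝓢(Plane, ℂ)), fderiv ℝ f x v = v 0 • ∂_{e 0} f x + v 1 • ∂_{e 1} f x :=
    fun f => by
      rw [SchwartzMap.lineDerivOp_apply_eq_fderiv, SchwartzMap.lineDerivOp_apply_eq_fderiv]
      conv_lhs => rw [plane_eq v]
      simp
  have hd : ∀ (f : 𝓢(Plane, ℂ)) (k : Fin 2), HasFDerivAt (fun y => (f y).re • e k)
      ((Complex.reCLM.smulRight (e k)) ∘L fderiv ℝ f x) x := fun f k =>
    (Complex.reCLM.smulRight (e k)).hasFDerivAt.comp x f.differentiableAt.hasFDerivAt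
  have h2 : HasFDerivAt (gradPerpRe φ) _ x := (hd (∂_{e 0} φ) 1).sub (hd (∂_{e 1} φ) 0)
  rw [h2.fderiv]
  simp [h1]

theorem component_ae_eq (u : VectorField) (i : Fin 2) :
    component u i =ᵐ[volume] fun x => ((u x i : ℝ) : ℂ) :=
  ContinuousLinearMap.coeFn_compLp _ u

theorem vorticity_apply (u : VectorField) (φ : 𝓢(Plane, ℂ)) :
    vorticity u φ = ∫ x, (∂_{e 1} φ x * component u 0 x - ∂_{e 0} φ x * component u 1 x) := by
  rw [vorticity, sub_apply, TemperedDistribution.lineDerivOp_apply_apply,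
    TemperedDistribution.lineDerivOp_apply_apply, (rep_component u 1).apply,
    (rep_component u 0).apply, integral_sub (integrable_schwartz_mul _ (Lp.memLp _))
    (integrable_schwartz_mul _ (Lp.memLp _))]
  simp [integral_neg]
  ring

/-- `∇^⊥ · ∇ · (u ⊗ u)`. -/
def eulerDistr (u : VectorField) : Distr :=
  ∑ i, (∂_{e i} (∂_{e 0} (tensor u i 1)) - ∂_{e i} (∂_{e 1} (tensor u i 0)))

theorem eulerDistr_apply (u : VectorField) (φ : 𝓢(Plane, ℂ)) :
    eulerDistr u φ = ∑ i, (tensor u i 1 (∂_{e i} (∂_{e 0} φ)) - tensor u i 0 (∂_{e i} (∂_{e 1} φ))) := by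
  simp only [eulerDistr, Fin.sum_univ_two, add_apply, sub_apply,
    TemperedDistribution.lineDerivOp_apply_apply]
  simp [lineDeriv_comm_schwartz φ (e 1) (e 0)]

theorem pairing_gradPerpRe (u : VectorField) (φ : 𝓢(Plane, ℂ)) :
    pairing u (gradPerpRe φ) = -(vorticity u φ).re := by
  have hi : Integrable fun x => ∂_{e 1} φ x * component u 0 x - ∂_{e 0} φ x * component u 1 x :=
    (integrable_schwartz_mul _ (Lp.memLp _)).sub (integrable_schwartz_mul _ (Lp.memLp _))
  rw [vorticity_apply, pairing, ← Complex.reCLM_apply, ← ContinuousLinearMap.integral_comp_comm _ hi,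
    ← integral_neg]
  refine integral_congr_ae ?_
  filter_upwards [component_ae_eq u 0, component_ae_eq u 1] with x h0 h1
  rw [h0, h1, gradPerpRe_apply, inner_sub_right, real_inner_smul_right, real_inner_smul_right]
  simp [e, EuclideanSpace.inner_single_right]

theorem trilinear_gradPerpRe (u : VectorField) (φ : 𝓢(Plane, ℂ)) :
    trilinear u (gradPerpRe φ) = (eulerDistr u φ).re := by
  have hr : ∀ i j, Rep 1 (fun x => component u i x * component u j x) (tensor u i j) := fun i j =>
    rep_toLp (memLp_tensor u i j)
  have hi : ∀ i j (g : 𝓢(Plane, ℂ)), Integrable fun x => g x * (component u i x * component u j x) :=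
    fun i j g => integrable_schwartz_mul g (memLp_tensor u i j)
  have hs : ∀ i, Integrable fun x => ∂_{e i} (∂_{e 0} φ) x * (component u i x * component u 1 x) -
      ∂_{e i} (∂_{e 1} φ) x * (component u i x * component u 0 x) := fun i =>
    (hi _ _ _).sub (hi _ _ _)
  have h1 : eulerDistr u φ = ∫ x, ∑ i, (∂_{e i} (∂_{e 0} φ) x * (component u i x * component u 1 x) -
      ∂_{e i} (∂_{e 1} φ) x * (component u i x * component u 0 x)) := by
    rw [eulerDistr_apply, integral_finsetSum _ fun i _ => hs i]
    refine Finset.sum_congr rfl fun i _ => ?_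
    rw [integral_sub (hi _ _ _) (hi _ _ _), (hr _ _).apply, (hr _ _).apply]
  rw [h1, ← Complex.reCLM_apply, ← ContinuousLinearMap.integral_comp_comm _
    (integrable_finsetSum _ fun i _ => hs i), trilinear]
  refine integral_congr_ae ?_
  filter_upwards [component_ae_eq u 0, component_ae_eq u 1] with x h0 h1
  simp only [Fin.sum_univ_two]
  rw [h0, h1, fderiv_gradPerpRe, inner_sub_left, real_inner_smul_left, real_inner_smul_left]
  simp [e, EuclideanSpace.inner_single_left]
  ring

theorem div_gradPerpRe (φ : 𝓢(Plane, ℂ)) (x : Plane) :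
    ∑ i, (fderiv ℝ (gradPerpRe φ) x (e i)) i = 0 := by
  simp only [Fin.sum_univ_two, fderiv_gradPerpRe, lineDeriv_comm_schwartz φ (e 1) (e 0)]
  simp [e]

/-- The curve `u`, extended from `[0,T]` to `ℝ` by constants. -/
def extendIcc {T : ℝ} (hT : 0 ≤ T) (u : ℝ → VectorField) (r : ℝ) : VectorField :=
  u (projIcc 0 T hT r)

section

variable {T : ℝ} {u : ℝ → VectorField}

theorem extendIcc_eq (hT : 0 ≤ T) {r : ℝ} (hr : r ∈ Icc 0 T) : extendIcc hT u r = u r := by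
  rw [extendIcc, projIcc_of_mem hT hr]

theorem IsWeakSolution.stronglyMeasurable (h : IsWeakSolution T u) (hT : 0 ≤ T) :
    StronglyMeasurable (extendIcc hT u) := by
  borelize VectorField
  have : Fact ((2 : ℝ≥0∞) ≠ ⊤) := ⟨by simp⟩
  refine (measurable_of_continuous_inner fun v => ?_).stronglyMeasurable
  exact ((h.weaklyContinuous v).comp_continuous (by fun_prop : Continuous fun r =>
    ((projIcc 0 T hT r : Icc 0 T) : ℝ)) fun r => (projIcc 0 T hT r).2)

theorem IsWeakSolution.exists_norm_le (h : IsWeakSolution T u) (hT : 0 ≤ T) :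
    ∃ M, 0 ≤ M ∧ ∀ r, ‖extendIcc hT u r‖ ≤ M := by
  obtain ⟨M, hM⟩ := exists_norm_le_of_continuousOn_inner isCompact_Icc h.weaklyContinuous
  have : ∀ r, ‖extendIcc hT u r‖ ≤ M := fun r => hM _ (projIcc 0 T hT r).2
  exact ⟨M, (norm_nonneg _).trans (this 0), this⟩

theorem norm_component_le (u : VectorField) (i : Fin 2) : ‖component u i‖ ≤ ‖u‖ := by
  refine Lp.norm_le_norm_of_ae_le ?_
  filter_upwards [component_ae_eq u i] with x hx
  rw [hx, Complex.norm_real]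
  exact PiLp.norm_apply_le _ _

theorem norm_tens_le (u : VectorField) (i j : Fin 2) : ‖tens u i j‖ ≤ ‖u‖ ^ 2 := by
  have h : tens u i j = (ContinuousLinearMap.mul ℂ ℂ).holder 1 (component u i)
      (component u j) := by
    rw [tens, ContinuousLinearMap.holder]
    rfl
  rw [h]
  refine (ContinuousLinearMap.norm_holder_apply_apply_le _ _ _).trans ?_
  have := norm_component_le u i
  have := norm_component_le u j
  calc _ ≤ 1 * ‖u‖ * ‖u‖ := by
        gcongr
        exact ContinuousLinearMap.opNorm_mul_le ℂ ℂ
    _ = _ := by ring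

theorem IsWeakSolution.intervalIntegrable_comp {E : Type*} [NormedAddCommGroup E] [NormedSpace ℂ E]
    (h : IsWeakSolution T u) (hT : 0 ≤ T) (L : Lp ℂ 1 (volume : Measure Plane) →L[ℂ] E)
    (i j : Fin 2) (a b : ℝ) :
    IntervalIntegrable (fun r => L (tens (extendIcc hT u r) i j)) volume a b := by
  obtain ⟨M, hM0, hM⟩ := h.exists_norm_le hT
  have hc : Continuous fun U : VectorField => L (tens U i j) :=
    L.continuous.comp (continuous_tens i j)
  have hm := hc.comp_stronglyMeasurable (h.stronglyMeasurable hT)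
  refine (intervalIntegrable_const (c := ‖L‖ * M ^ 2)).mono_fun hm.aestronglyMeasurable
    (ae_of_all _ fun r => ?_)
  rw [Real.norm_of_nonneg (by positivity)]
  exact (L.le_opNorm _).trans (mul_le_mul_of_nonneg_left ((norm_tens_le _ _ _).trans
    (pow_le_pow_left₀ (norm_nonneg _) (hM r) 2)) (norm_nonneg _))

/-- Stationary test fields Re ∇^⊥ φ suffice: they are divergence-free, and the term with the time
derivative disappears. -/
theorem IsWeakSolution.re_vorticity_sub (h : IsWeakSolution T u) (hT : 0 ≤ T)
    (φ : 𝓢(Plane, ℂ)) {t : ℝ} (ht : t ∈ Icc 0 T) :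
    (vorticity (u t) φ).re - (vorticity (u 0) φ).re =
      -∫ r in (0 : ℝ)..t, (eulerDistr (extendIcc hT u r) φ).re := by
  have hc : ∀ t, HasDerivWithinAt (fun _ : ℝ => gradPerpRe φ) 0 (Icc 0 T) t := fun t => by
    have h0 : HasFDerivWithinAt (fun _ : ℝ => gradPerpRe φ) (0 : ℝ →L[ℝ] 𝓢(Plane, Plane))
        (Icc 0 T) t := hasFDerivWithinAt_const _ _ _
    rw [HasDerivWithinAt, HasDerivAtFilter]
    have : ContinuousLinearMap.toSpanSingleton ℝ (0 : 𝓢(Plane, Plane)) = 0 := by ext; simp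
    rw [this]
    exact h0
  have h1 := h.momentum (fun _ => gradPerpRe φ) (fun _ => 0)
    (fun t _ => hc t) continuousOn_const
    (fun t _ x => div_gradPerpRe φ x) t ht
  have h2 : ∀ s, pairing (u s) 0 = 0 := fun s => by simp [pairing]
  simp only [h2, intervalIntegral.integral_zero, sub_zero, pairing_gradPerpRe,
    trilinear_gradPerpRe] at h1
  have h3 : ∫ r in (0 : ℝ)..t, (eulerDistr (extendIcc hT u r) φ).re =
      ∫ r in (0 : ℝ)..t, (eulerDistr (u r) φ).re := by
    refine intervalIntegral.integral_congr fun r hr => ?_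
    rw [uIcc_of_le ht.1] at hr
    simp only [extendIcc_eq hT ⟨hr.1, hr.2.trans ht.2⟩]
  rw [h3, ← h1]
  ring

theorem IsWeakSolution.intervalIntegrable_eulerDistr (h : IsWeakSolution T u) (hT : 0 ≤ T)
    (φ : 𝓢(Plane, ℂ)) (a b : ℝ) :
    IntervalIntegrable (fun r => eulerDistr (extendIcc hT u r) φ) volume a b := by
  have hL : ∀ (g : 𝓢(Plane, ℂ)) i j, IntervalIntegrable
      (fun r => tensor (extendIcc hT u r) i j g) volume a b := fun g i j =>
    h.intervalIntegrable_comp hT ((PointwiseConvergenceCLM.evalCLM (RingHom.id ℂ) ℂ g) ∘L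
      (Lp.toTemperedDistributionCLM ℂ volume 1)) i j a b
  simp only [eulerDistr_apply, Fin.sum_univ_two]
  exact ((hL _ _ _).sub (hL _ _ _)).add ((hL _ _ _).sub (hL _ _ _))

/-- The vorticity equation in the sense of distributions. -/
theorem IsWeakSolution.vorticity_sub (h : IsWeakSolution T u) (hT : 0 ≤ T)
    (φ : 𝓢(Plane, ℂ)) {a b : ℝ} (ha : a ∈ Icc 0 T) (hb : b ∈ Icc 0 T) :
    vorticity (u b) φ - vorticity (u a) φ =
      -∫ r in a..b, eulerDistr (extendIcc hT u r) φ := by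
  have hre : ∀ φ : 𝓢(Plane, ℂ), (vorticity (u b) φ - vorticity (u a) φ).re =
      (-∫ r in a..b, eulerDistr (extendIcc hT u r) φ).re := fun φ => by
    have hi := h.intervalIntegrable_eulerDistr hT φ
    have hir : ∀ a b, IntervalIntegrable (fun r => (eulerDistr (extendIcc hT u r) φ).re) volume a b :=
      fun a b => ⟨(hi a b).1.re, (hi a b).2.re⟩
    have h1 := h.re_vorticity_sub hT φ ha
    have h2 := h.re_vorticity_sub hT φ hb
    have h3 := intervalIntegral.integral_add_adjacent_intervals (hir 0 a) (hir a b)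
    have h4 : (∫ r in a..b, eulerDistr (extendIcc hT u r) φ).re =
        ∫ r in a..b, (eulerDistr (extendIcc hT u r) φ).re :=
      (ContinuousLinearMap.intervalIntegral_comp_comm Complex.reCLM (hi a b)).symm
    rw [Complex.neg_re, h4, Complex.sub_re]
    linarith
  refine Complex.ext (hre φ) ?_
  -- The real part of the identity at -iφ is the imaginary part at φ.
  have h1 := hre ((-Complex.I) • φ)
  simp only [map_smul, smul_eq_mul, ← mul_sub, intervalIntegral.integral_const_mul] at h1
  simpa using h1

end

end

section

/-! ### Evolution of the mollified vorticity -/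

/-- The mollified vorticity, in `L²`. -/
def vortL (m : 𝓢(Plane, ℂ)) (U : VectorField) : Lp ℂ 2 (volume : Measure Plane) :=
  (nice_curl (memLp_comp U) m).memLp_two.toLp

theorem vortL_coe (m : 𝓢(Plane, ℂ)) (U : VectorField) :
    (vortL m U : Distr) = mult m (vorticity U) :=
  ((rep_curl (rep_comp U) m).eq_toLp).symm

/-- The mollification of `∇^⊥ · ∇ · (u ⊗ u)`, in `L²`. -/
def eulerL (m : 𝓢(Plane, ℂ)) (U : VectorField) : Lp ℂ 2 (volume : Measure Plane) :=
  ∑ i, (cvL₁₂ (dsym 0 (dsym i m)) (tens U i 1) - cvL₁₂ (dsym 1 (dsym i m)) (tens U i 0))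

theorem cvL₁₂_coe (m : 𝓢(Plane, ℂ)) (F : Lp ℂ 1 (volume : Measure Plane)) :
    (cvL₁₂ m F : Distr) = mult m (F : Distr) := by
  have h : Rep 2 (cv m F) (mult m (F : Distr)) :=
    (Rep.cv (by simp) m (rep_Lp F)).of_memLp (Nice.conv1 _ (Lp.memLp F)).memLp_two
  exact (rep_Lp (cvL₁₂ m F)).distribution_eq (h.congr (coeFn_cvL₁₂ m F).symm)

theorem eulerL_coe (m : 𝓢(Plane, ℂ)) (U : VectorField) :
    (eulerL m U : Distr) = mult m (eulerDistr U) := by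
  have h : (eulerL m U : Distr) = ∑ i, ((cvL₁₂ (dsym 0 (dsym i m)) (tens U i 1) : Distr) -
      (cvL₁₂ (dsym 1 (dsym i m)) (tens U i 0) : Distr)) := by
    change Lp.toTemperedDistributionCLM ℂ volume 2 _ = _
    rw [eulerL, map_sum]
    simp only [map_sub]
    rfl
  rw [h, eulerDistr, map_sum]
  simp only [map_sub, mult_lineDeriv, cvL₁₂_coe, tensor_eq]

theorem coeFn_eulerL (m : 𝓢(Plane, ℂ)) (U : VectorField) : eulerL m U =ᵐ[volume] fun x =>
    ∑ i, (cv (dsym 0 (dsym i m)) (fun y => comp U i y * comp U 1 y) x -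
      cv (dsym 1 (dsym i m)) (fun y => comp U i y * comp U 0 y) x) := by
  have h : ∀ k i j, cvL₁₂ (dsym k (dsym i m)) (tens U i j) =ᵐ[volume]
      cv (dsym k (dsym i m)) (fun y => comp U i y * comp U j y) := fun k i j => by
    refine (coeFn_cvL₁₂ _ _).trans (EventuallyEq.of_eq ?_)
    exact conv_congr _ (memLp_tensor U i j).coeFn_toLp
  rw [eulerL, Fin.sum_univ_two]
  filter_upwards [Lp.coeFn_add (cvL₁₂ (dsym 0 (dsym 0 m)) (tens U 0 1) -
      cvL₁₂ (dsym 1 (dsym 0 m)) (tens U 0 0)) (cvL₁₂ (dsym 0 (dsym 1 m)) (tens U 1 1) -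
      cvL₁₂ (dsym 1 (dsym 1 m)) (tens U 1 0)),
    Lp.coeFn_sub (cvL₁₂ (dsym 0 (dsym 0 m)) (tens U 0 1)) (cvL₁₂ (dsym 1 (dsym 0 m)) (tens U 0 0)),
    Lp.coeFn_sub (cvL₁₂ (dsym 0 (dsym 1 m)) (tens U 1 1)) (cvL₁₂ (dsym 1 (dsym 1 m)) (tens U 1 0)),
    h 0 0 1, h 1 0 0, h 0 1 1, h 1 1 0] with x h1 h2 h3 h4 h5 h6 h7
  rw [h1, Pi.add_apply, h2, h3, Pi.sub_apply, Pi.sub_apply, h4, h5, h6, h7, Fin.sum_univ_two]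

section

variable {T : ℝ} {u : ℝ → VectorField}

theorem IsWeakSolution.intervalIntegrable_eulerL (h : IsWeakSolution T u) (hT : 0 ≤ T)
    (m : 𝓢(Plane, ℂ)) (a b : ℝ) :
    IntervalIntegrable (fun r => eulerL m (extendIcc hT u r)) volume a b := by
  simp only [eulerL, Fin.sum_univ_two]
  exact ((h.intervalIntegrable_comp hT _ _ _ a b).sub (h.intervalIntegrable_comp hT _ _ _ a b)).add
    ((h.intervalIntegrable_comp hT _ _ _ a b).sub (h.intervalIntegrable_comp hT _ _ _ a b))

theorem IsWeakSolution.exists_norm_eulerL_le (h : IsWeakSolution T u) (hT : 0 ≤ T)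
    (m : 𝓢(Plane, ℂ)) : ∃ K, 0 ≤ K ∧ ∀ r, ‖eulerL m (extendIcc hT u r)‖ ≤ K := by
  obtain ⟨M, hM0, hM⟩ := h.exists_norm_le hT
  have hb : ∀ (L : Lp ℂ 1 (volume : Measure Plane) →L[ℂ] Lp ℂ 2 (volume : Measure Plane)) i j r,
      ‖L (tens (extendIcc hT u r) i j)‖ ≤ ‖L‖ * M ^ 2 := fun L i j r =>
    (L.le_opNorm _).trans (mul_le_mul_of_nonneg_left ((norm_tens_le _ _ _).trans
      (pow_le_pow_left₀ (norm_nonneg _) (hM r) 2)) (norm_nonneg _))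
  have key : ∀ r, ‖eulerL m (extendIcc hT u r)‖ ≤ ∑ i, (‖cvL₁₂ (dsym 0 (dsym i m))‖ * M ^ 2 +
      ‖cvL₁₂ (dsym 1 (dsym i m))‖ * M ^ 2) := fun r =>
    norm_sum_le_of_le _ fun i _ => (norm_sub_le _ _).trans (add_le_add (hb _ _ _ r) (hb _ _ _ r))
  exact ⟨_, (norm_nonneg _).trans (key 0), key⟩

/-- The nonlinearity is Bochner integrable in L², so pairing with a test function commutes with the
time integral; injectivity of L² into distributions turns the weak identity into a strong one. -/
theorem IsWeakSolution.vortL_sub (h : IsWeakSolution T u) (hT : 0 ≤ T) (m : 𝓢(Plane, ℂ))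
    {a b : ℝ} (ha : a ∈ Icc 0 T) (hb : b ∈ Icc 0 T) :
    vortL m (u b) - vortL m (u a) = -∫ r in a..b, eulerL m (extendIcc hT u r) := by
  have hk := Lp.ker_toTemperedDistributionCLM_eq_bot (F := ℂ)
    (μ := (volume : Measure Plane)) (p := 2)
  refine LinearMap.ker_eq_bot.1 hk ?_
  have hi := h.intervalIntegrable_eulerL hT m a b
  change Lp.toTemperedDistributionCLM ℂ volume 2 _ = Lp.toTemperedDistributionCLM ℂ volume 2 _
  rw [map_sub, map_neg]
  change (vortL m (u b) : Distr) - (vortL m (u a) : Distr) = _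
  rw [vortL_coe, vortL_coe]
  ext θ
  set φ : 𝓢(Plane, ℂ) := 𝓕 (SchwartzMap.smulLeftCLM ℂ m (𝓕⁻ θ)) with hφ
  have h1 : ∀ S : Distr, mult m S θ = S φ := fun S => rfl
  have h2 := ContinuousLinearMap.intervalIntegral_comp_comm
    ((PointwiseConvergenceCLM.evalCLM (RingHom.id ℂ) ℂ θ) ∘L
      (Lp.toTemperedDistributionCLM ℂ volume 2)) hi
  have h3 : ∀ r, ((PointwiseConvergenceCLM.evalCLM (RingHom.id ℂ) ℂ θ) ∘L
      (Lp.toTemperedDistributionCLM ℂ volume 2)) (eulerL m (extendIcc hT u r)) =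
      eulerDistr (extendIcc hT u r) φ := fun r => by
    change (eulerL m (extendIcc hT u r) : Distr) θ = _
    rw [eulerL_coe, h1]
  simp only [h3] at h2
  rw [sub_apply, h1, h1, h.vorticity_sub hT φ ha hb, h2]
  rfl

end

/-! ### Energy estimate for curves in a Hilbert space -/

/-- ‖g(b)‖² - ‖g(a)‖² is the real part of ⟨g(b) + g(a), g(b) - g(a)⟩. Replacing g(b) + g(a) by 2g(r)
costs a Lipschitz error, quadratic in b - a after integration; no derivative in time is taken. -/
theorem ofReal_abs_norm_sq_sub_le {H : Type*} [NormedAddCommGroup H] [InnerProductSpace ℂ H]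
    [CompleteSpace H] {g N : ℝ → H} {K a b : ℝ} (hK : 0 ≤ K) (hN : ∀ r, ‖N r‖ ≤ K)
    (hNi : ∀ a b, IntervalIntegrable N volume a b) (hab : a ≤ b)
    (hg : ∀ s ∈ Icc a b, ∀ t ∈ Icc a b, g t - g s = -∫ r in s..t, N r) :
    ENNReal.ofReal |‖g b‖ ^ 2 - ‖g a‖ ^ 2| ≤ (∫⁻ r in Ioc a b, 2 * ‖inner ℂ (g r) (N r)‖ₑ) +
      ENNReal.ofReal (2 * K ^ 2 * (b - a) ^ 2) := by
  have ha : a ∈ Icc a b := left_mem_Icc.2 hab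
  have hb : b ∈ Icc a b := right_mem_Icc.2 hab
  have hL : ∀ s ∈ Icc a b, ∀ t ∈ Icc a b, ‖g t - g s‖ ≤ K * (b - a) := fun s hs t ht => by
    rw [hg s hs t ht, norm_neg]
    refine (intervalIntegral.norm_integral_le_of_norm_le_const fun r _ => hN r).trans ?_
    gcongr
    rw [abs_le]
    constructor <;> linarith [hs.1, hs.2, ht.1, ht.2]
  have h1 : ‖g b‖ ^ 2 - ‖g a‖ ^ 2 = (inner ℂ (g b + g a) (g b - g a)).re := by
    rw [inner_sub_right, inner_add_left, inner_add_left, Complex.sub_re, Complex.add_re,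
      Complex.add_re, ← inner_conj_symm (g a) (g b), Complex.conj_re]
    have := fun x : H => inner_self_eq_norm_sq (𝕜 := ℂ) x
    simp only [RCLike.re_to_complex] at this
    rw [this, this]
    ring
  have h2 : inner ℂ (g b + g a) (g b - g a) = -∫ r in a..b, inner ℂ (g b + g a) (N r) := by
    rw [hg a ha b hb, inner_neg_right]
    congr 1
    exact (ContinuousLinearMap.intervalIntegral_comp_comm (innerSL ℂ (g b + g a)) (hNi a b)).symm
  have h3 : ∀ r ∈ Ioc a b, ‖inner ℂ (g b + g a) (N r)‖ₑ ≤ 2 * ‖inner ℂ (g r) (N r)‖ₑ +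
      ENNReal.ofReal (2 * K ^ 2 * (b - a)) := fun r hr => by
    have hr' : r ∈ Icc a b := ⟨hr.1.le, hr.2⟩
    have e1 : inner ℂ (g b + g a) (N r) = (inner ℂ (g r) (N r) + inner ℂ (g r) (N r)) +
        inner ℂ ((g b - g r) + (g a - g r)) (N r) := by
      rw [← inner_add_left, ← inner_add_left]
      congr 1
      abel
    have e2 : ‖inner ℂ ((g b - g r) + (g a - g r)) (N r)‖ ≤ 2 * K ^ 2 * (b - a) := by
      refine (norm_inner_le_norm _ _).trans ?_
      have e3 : ‖(g b - g r) + (g a - g r)‖ ≤ K * (b - a) + K * (b - a) :=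
        (norm_add_le _ _).trans (add_le_add (hL r hr' b hb) (hL r hr' a ha))
      calc _ ≤ (K * (b - a) + K * (b - a)) * K :=
            mul_le_mul e3 (hN r) (norm_nonneg _) ((norm_nonneg _).trans e3)
        _ = _ := by ring
    rw [e1, two_mul]
    refine (enorm_add_le _ _).trans (add_le_add (enorm_add_le _ _) ?_)
    rw [← ofReal_norm]
    exact ENNReal.ofReal_le_ofReal e2
  have h4 : ENNReal.ofReal |‖g b‖ ^ 2 - ‖g a‖ ^ 2| ≤
      ∫⁻ r in Ioc a b, ‖inner ℂ (g b + g a) (N r)‖ₑ := by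
    refine le_trans ?_ (enorm_integral_le_lintegral_enorm _)
    rw [← intervalIntegral.integral_of_le hab, ← enorm_neg, ← h2, ← ofReal_norm, h1]
    exact ENNReal.ofReal_le_ofReal (Complex.abs_re_le_norm _)
  refine h4.trans ((setLIntegral_mono' measurableSet_Ioc h3).trans_eq ?_)
  rw [lintegral_add_right _ measurable_const, setLIntegral_const, Real.volume_Ioc,
    ← ENNReal.ofReal_mul (mul_nonneg (by positivity) (sub_nonneg.2 hab))]
  ring_nf

/-- If the increments of `X` are bounded by those of the integral of `F`, up to a quadratic error,
then they are bounded by those of the integral of `F`. -/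
theorem ofReal_abs_sub_le_lintegral {X : ℝ → ℝ} {F : ℝ → ℝ≥0∞} {C t : ℝ} (ht : 0 ≤ t)
    (hC : 0 ≤ C) (h : ∀ a b, 0 ≤ a → a ≤ b → b ≤ t → ENNReal.ofReal |X b - X a| ≤
      (∫⁻ r in Ioc a b, F r) + ENNReal.ofReal (C * (b - a) ^ 2)) :
    ENNReal.ofReal |X t - X 0| ≤ ∫⁻ r in Ioc 0 t, F r := by
  -- With n + 1 equal subintervals the quadratic errors add up to C t²/(n + 1).
  have hn : ∀ n : ℕ, ENNReal.ofReal |X t - X 0| ≤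
      (∫⁻ r in Ioc 0 t, F r) + ENNReal.ofReal (C * t ^ 2 * (1 / ((n : ℝ) + 1))) := fun n => by
    set δ := t / (n + 1) with hδ
    have hδ0 : 0 ≤ δ := by positivity
    have hδt : ((n : ℝ) + 1) * δ = t := by rw [hδ]; field_simp
    have hk : ∀ k : ℕ, k ≤ n + 1 → ENNReal.ofReal |X (k * δ) - X 0| ≤
        (∫⁻ r in Ioc 0 (k * δ), F r) + ENNReal.ofReal (k * (C * δ ^ 2)) := by
      intro k
      induction k with
      | zero => intro _; simp
      | succ k ih =>
        intro hk
        have hk' : ((k : ℝ) + 1) ≤ n + 1 := by exact_mod_cast hk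
        have i1 := ih (by omega)
        have i2 := h (k * δ) ((k + 1 : ℕ) * δ) (by positivity)
          (by push_cast; nlinarith) (by push_cast; rw [← hδt]; gcongr)
        have e1 : ((k + 1 : ℕ) : ℝ) * δ - k * δ = δ := by push_cast; ring
        rw [e1] at i2
        have e2 : Ioc 0 (((k + 1 : ℕ) : ℝ) * δ) = Ioc 0 (k * δ) ∪ Ioc (k * δ) ((k + 1 : ℕ) * δ) :=
          (Ioc_union_Ioc_eq_Ioc (by positivity) (by push_cast; nlinarith)).symm
        have e3 : Disjoint (Ioc 0 (k * δ)) (Ioc (k * δ) ((k + 1 : ℕ) * δ)) :=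
          Ioc_disjoint_Ioc_of_le le_rfl
        rw [e2, lintegral_union measurableSet_Ioc e3]
        calc ENNReal.ofReal |X ((k + 1 : ℕ) * δ) - X 0|
            ≤ ENNReal.ofReal (|X ((k + 1 : ℕ) * δ) - X (k * δ)| + |X (k * δ) - X 0|) :=
              ENNReal.ofReal_le_ofReal (abs_sub_le _ _ _)
          _ = ENNReal.ofReal |X ((k + 1 : ℕ) * δ) - X (k * δ)| +
              ENNReal.ofReal |X (k * δ) - X 0| := ENNReal.ofReal_add (abs_nonneg _) (abs_nonneg _)
          _ ≤ _ := add_le_add i2 i1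
          _ = (∫⁻ r in Ioc 0 (k * δ), F r) + (∫⁻ r in Ioc (k * δ) ((k + 1 : ℕ) * δ), F r) +
              (ENNReal.ofReal (k * (C * δ ^ 2)) + ENNReal.ofReal (C * δ ^ 2)) := by ring
          _ = _ := by
              rw [← ENNReal.ofReal_add (by positivity) (by positivity)]
              congr 2
              push_cast
              ring
    have := hk (n + 1) le_rfl
    push_cast at this
    rw [hδt] at this
    refine this.trans (le_of_eq ?_)
    congr 2
    rw [← hδt]
    field_simp
  have hlim : Tendsto (fun n : ℕ => (∫⁻ r in Ioc 0 t, F r) +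
      ENNReal.ofReal (C * t ^ 2 * (1 / ((n : ℝ) + 1)))) atTop
      (𝓝 ((∫⁻ r in Ioc 0 t, F r) + ENNReal.ofReal (C * t ^ 2 * 0))) :=
    tendsto_const_nhds.add (ENNReal.tendsto_ofReal
      (tendsto_one_div_add_atTop_nhds_zero_nat.const_mul _))
  have := ge_of_tendsto' hlim hn
  simpa using this

end

section

/-! ### Multipliers that preserve real functions -/

/-- Reality matters because the complex inner product conjugates the vorticity while the flux does
not. -/
theorem conj_fourierInv {m : 𝓢(Plane, ℂ)} (hm : ∀ ξ, (starRingEnd ℂ) (m ξ) = m (-ξ)) (x : Plane) :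
    (starRingEnd ℂ) ((𝓕⁻ m : 𝓢(Plane, ℂ)) x) = (𝓕⁻ m : 𝓢(Plane, ℂ)) x := by
  rw [SchwartzMap.fourierInv_coe, Real.fourierInv_eq, ← integral_conj,
    ← integral_neg_eq_self (fun v => Real.fourierChar (inner ℝ v x) • m v)]
  refine integral_congr_ae (ae_of_all _ fun v => ?_)
  simp only [Circle.smul_def, smul_eq_mul, map_mul, hm, inner_neg_left]
  rw [← Circle.coe_inv_eq_conj, ← AddChar.map_neg_eq_inv]

theorem conj_cv {m : 𝓢(Plane, ℂ)} (hm : ∀ ξ, (starRingEnd ℂ) (m ξ) = m (-ξ)) {f : Plane → ℂ}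
    (hf : ∀ᵐ x, (starRingEnd ℂ) (f x) = f x) (x : Plane) :
    (starRingEnd ℂ) (cv m f x) = cv m f x := by
  rw [cv, conv, ← integral_conj]
  refine integral_congr_ae (hf.mono fun y hy => ?_)
  simp only [map_mul, conj_fourierInv hm, hy]

theorem conj_dsym {m : 𝓢(Plane, ℂ)} (hm : ∀ ξ, (starRingEnd ℂ) (m ξ) = m (-ξ)) (k : Fin 2)
    (ξ : Plane) : (starRingEnd ℂ) (dsym k m ξ) = dsym k m (-ξ) := by
  have h2 : (starRingEnd ℂ) 2 = 2 := Complex.conj_ofReal 2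
  simp [dsym_apply, hm, h2]

theorem conj_comp (u : VectorField) (i : Fin 2) : ∀ᵐ x, (starRingEnd ℂ) (comp u i x) = comp u i x := by
  filter_upwards [component_ae_eq u i] with x hx
  rw [comp, hx, Complex.conj_ofReal]

theorem conj_curl {m : 𝓢(Plane, ℂ)} (hm : ∀ ξ, (starRingEnd ℂ) (m ξ) = m (-ξ)) (u : VectorField)
    (x : Plane) : (starRingEnd ℂ) (curl (comp u) m x) = curl (comp u) m x := by
  rw [curl, Pi.sub_apply, map_sub, conj_cv (conj_dsym hm 0) (conj_comp u 1),
    conj_cv (conj_dsym hm 1) (conj_comp u 0)]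

section

variable {χ : Plane → ℝ} (hχ : IsCutoff χ)

theorem conj_dil_cut (n : ℕ) (ξ : Plane) :
    (starRingEnd ℂ) (dil n (cut hχ) ξ) = dil n (cut hχ) (-ξ) := by
  simp only [dil_apply, cut_apply, Complex.conj_ofReal]
  congr 1
  exact hχ.radial _ _ (by rw [smul_neg, norm_neg])

/-- Two integrations by parts, so the signs cancel. -/
theorem integral_curl_mul_cv_dsym {u : Fin 2 → Plane → ℂ} (hu : ∀ i, MemLp (u i) 2 volume)
    (m : 𝓢(Plane, ℂ)) (i k : Fin 2) {f : Plane → ℂ} (hf : MemLp f 1 volume) :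
    ∫ x, cv (dsym k (dsym i m)) f x * curl u m x =
      ∫ x, cv m f x * curl u (dsym i (dsym k m)) x := by
  have hA : ∀ s, Nice (cv s f) := fun s => Nice.conv1 _ hf
  have hg : ∀ s, Nice (curl u s) := nice_curl hu
  have h1 := (hA m).integral_mul_pd (hg (dsym k m)) i
  have h2 := (hA (dsym i m)).integral_mul_pd (hg m) k
  rw [pd_curl hu, pd_cv _ hf] at h1 h2
  rw [h1, h2, neg_neg]

/-- The flux is the work of the nonlinearity against the mollified vorticity: both derivatives are
moved from S_Q(u ⊗ u) to S_Q ω, where they form ∇∇^⊥. -/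
theorem inner_vortL_eulerL (Q : ℕ) (u : VectorField) :
    inner ℂ (vortL (dil (Q + 1) (cut hχ)) u) (eulerL (dil (Q + 1) (cut hχ)) u) = flux χ Q u := by
  set s := dil (Q + 1) (cut hχ) with hs
  have hu := memLp_comp u
  have hsc : ∀ ξ, (starRingEnd ℂ) (s ξ) = s (-ξ) := conj_dil_cut hχ _
  have ht : ∀ i j, MemLp (fun y => comp u i y * comp u j y) 1 volume := memLp_tensor u
  have hA : ∀ m i j, Nice (cv m fun y => comp u i y * comp u j y) := fun m i j =>
    Nice.conv1 _ (memLp_tensor u i j)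
  have hi : ∀ m i j, Integrable fun x => cv m (fun y => comp u i y * comp u j y) x *
      curl (comp u) s x := fun m i j => (hA m i j).integrable_mul (nice_curl hu s)
  have h1 : inner ℂ (vortL s u) (eulerL s u) = ∫ x, ∑ i,
      (cv (dsym 0 (dsym i s)) (fun y => comp u i y * comp u 1 y) x * curl (comp u) s x -
        cv (dsym 1 (dsym i s)) (fun y => comp u i y * comp u 0 y) x * curl (comp u) s x) := by
    rw [L2.inner_def]
    refine integral_congr_ae ?_
    filter_upwards [coeFn_eulerL s u, (nice_curl hu s).memLp_two.coeFn_toLp] with x h2 h3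
    rw [vortL, h2, h3, RCLike.inner_apply, conj_curl hsc, Finset.sum_mul]
    simp only [sub_mul]
  have hsub : ∀ i, Integrable fun x =>
      cv (dsym 0 (dsym i s)) (fun y => comp u i y * comp u 1 y) x * curl (comp u) s x -
        cv (dsym 1 (dsym i s)) (fun y => comp u i y * comp u 0 y) x * curl (comp u) s x := fun i =>
    (hi _ _ _).sub (hi _ _ _)
  have h4 : flux χ Q u = ∫ x, ∑ i, ∑ j, cv s (fun y => comp u i y * comp u j y) x *
      hess (comp u) s i j x := integral_congr_ae (fluxDensity_ae_eq hχ Q u)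
  rw [h1, h4, integral_finsetSum _ fun i _ => hsub i, integral_finsetSum _ fun i _ =>
    integrable_finsetSum _ fun j _ => integrable_cv_mul_hess u s i j]
  refine Finset.sum_congr rfl fun i _ => ?_
  rw [integral_sub (hi _ _ _) (hi _ _ _), integral_finsetSum _ fun j _ =>
    integrable_cv_mul_hess u s i j, Fin.sum_univ_two,
    integral_curl_mul_cv_dsym hu _ _ _ (ht i 1),
    integral_curl_mul_cv_dsym hu _ _ _ (ht i 0)]
  simp only [hess, if_true, one_ne_zero, if_false]
  rw [add_comm, sub_eq_add_neg, ← integral_neg]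
  congr 2
  ext x
  ring

theorem IsWeakSolution.ofReal_abs_norm_vortL_sub_le {T : ℝ} {u : ℝ → VectorField}
    (h : IsWeakSolution T u) (Q : ℕ) {t : ℝ} (ht : t ∈ Icc 0 T) :
    ENNReal.ofReal |‖vortL (dil (Q + 1) (cut hχ)) (u t)‖ ^ 2 -
      ‖vortL (dil (Q + 1) (cut hχ)) (u 0)‖ ^ 2| ≤ ∫⁻ r in Ioc 0 t, 2 * ‖flux χ Q (u r)‖ₑ := by
  have hT : 0 ≤ T := ht.1.trans ht.2
  set s := dil (Q + 1) (cut hχ)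
  obtain ⟨K, hK, hb⟩ := h.exists_norm_eulerL_le hT s
  refine ofReal_abs_sub_le_lintegral (X := fun r => ‖vortL s (u r)‖ ^ 2) (C := 2 * K ^ 2) ht.1
    (by positivity) fun a b ha hab hbt => ?_
  have hsub : Icc a b ⊆ Icc 0 T := Icc_subset_Icc ha (hbt.trans ht.2)
  have h1 := ofReal_abs_norm_sq_sub_le (g := fun r => vortL s (u r)) hK hb
    (h.intervalIntegrable_eulerL hT s) hab
    (fun c hc d hd => h.vortL_sub hT s (hsub hc) (hsub hd))
  refine h1.trans_eq ?_
  congr 1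
  refine setLIntegral_congr_fun measurableSet_Ioc fun r hr => ?_
  rw [extendIcc_eq hT (hsub ⟨hr.1.le, hr.2⟩), inner_vortL_eulerL hχ]

end

end

section

/-! ### The enstrophy as the limit of the mollified enstrophies -/

/-- The Fourier transform of the vorticity, which is a function. -/
def vortHat (U : VectorField) (ξ : Plane) : ℂ :=
  (2 * Real.pi * Complex.I * ξ 0) * (𝓕 (component U 1) : Lp ℂ 2 (volume : Measure Plane)) ξ -
    (2 * Real.pi * Complex.I * ξ 1) * (𝓕 (component U 0) : Lp ℂ 2 (volume : Measure Plane)) ξ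

theorem measurable_vortHat (U : VectorField) : Measurable (vortHat U) := by
  have h : ∀ k, Measurable fun ξ : Plane => 2 * Real.pi * Complex.I * (ξ k : ℂ) := fun k => by
    have : Continuous fun ξ : Plane => 2 * Real.pi * Complex.I * (ξ k : ℂ) := by fun_prop
    exact this.measurable
  exact ((h 0).mul (Lp.stronglyMeasurable _).measurable).sub
    ((h 1).mul (Lp.stronglyMeasurable _).measurable)

theorem fourier_lineDeriv_Lp_apply (F : Lp ℂ 2 (volume : Measure Plane)) (k : Fin 2)
    (θ : 𝓢(Plane, ℂ)) : (∂_{e k} (F : Distr)) (𝓕 θ) =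
      ∫ ξ, dsym k θ ξ * (𝓕 F : Lp ℂ 2 (volume : Measure Plane)) ξ := by
  have h1 : dsym k θ = (2 * Real.pi * Complex.I) •
      SchwartzMap.smulLeftCLM ℂ (fun ξ : Plane => ((inner ℝ ξ (e k) : ℝ) : ℂ)) θ := by
    have ht : (fun ξ : Plane => ((inner ℝ ξ (e k) : ℝ) : ℂ)).HasTemperateGrowth := by fun_prop
    ext ξ
    rw [dsym_apply, smul_apply, SchwartzMap.smulLeftCLM_apply_apply ht]
    simp [e, EuclideanSpace.inner_single_right]
    ring
  rw [← TemperedDistribution.fourier_apply, TemperedDistribution.fourier_lineDerivOp_eq,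
    Lp.fourier_toTemperedDistribution_eq, ← (rep_Lp (𝓕 F : Lp ℂ 2 (volume : Measure Plane))).apply,
    h1, map_smul]
  rfl

theorem represents_vortHat (U : VectorField) : Represents (vortHat U) (𝓕 (vorticity U)) := by
  have hl : ∀ k (F : Lp ℂ 2 (volume : Measure Plane)), LocallyIntegrable fun ξ : Plane =>
      (2 * Real.pi * Complex.I * (ξ k : ℂ)) * F ξ := fun k F =>
    LocallyIntegrable.continuous_smul (g := fun ξ : Plane => 2 * Real.pi * Complex.I * (ξ k : ℂ))
      (by fun_prop) ((Lp.memLp F).locallyIntegrable (by norm_num))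
  have hi : ∀ k (F : Lp ℂ 2 (volume : Measure Plane)) (θ : 𝓢(Plane, ℂ)),
      Integrable fun ξ => dsym k θ ξ * F ξ := fun k F θ => integrable_schwartz_mul _ (Lp.memLp F)
  have he : ∀ θ : 𝓢(Plane, ℂ), (fun ξ => θ ξ * vortHat U ξ) = fun ξ =>
      dsym 0 θ ξ * (𝓕 (component U 1) : Lp ℂ 2 (volume : Measure Plane)) ξ -
        dsym 1 θ ξ * (𝓕 (component U 0) : Lp ℂ 2 (volume : Measure Plane)) ξ := fun θ => by
    ext ξ
    rw [vortHat, dsym_apply, dsym_apply]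
    ring
  refine ⟨(hl 0 _).sub (hl 1 _), fun θ => ?_⟩
  rw [he]
  refine ⟨(hi _ _ _).sub (hi _ _ _), ?_⟩
  rw [integral_sub (hi _ _ _) (hi _ _ _), TemperedDistribution.fourier_apply, vorticity, sub_apply,
    fourier_lineDeriv_Lp_apply, fourier_lineDeriv_Lp_apply]

/-- Plancherel in both directions: an L² vorticity transforms to `vortHat`, and a square-integrable
`vortHat` has an inverse transform equal to the vorticity. The value ∞ is thus covered. -/
theorem enstrophy_eq (U : VectorField) : enstrophy U = eLpNorm (vortHat U) 2 volume := by
  have key : ∀ F : Lp ℂ 2 (volume : Measure Plane), (F : Distr) = vorticity U →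
      ‖F‖ₑ = eLpNorm (vortHat U) 2 volume := fun F hF => by
    have h1 : Rep 2 (𝓕 F : Lp ℂ 2 (volume : Measure Plane)) (𝓕 (vorticity U)) := by
      rw [← hF, Lp.fourier_toTemperedDistribution_eq]
      exact rep_Lp _
    rw [eLpNorm_congr_ae ((represents_vortHat U).ae_eq h1.represents), ← Lp.enorm_def,
      ← ofReal_norm, ← ofReal_norm, Lp.norm_fourier_eq]
  refine le_antisymm ?_ (le_iInf₂ fun F hF => (key F hF).ge)
  by_cases h : eLpNorm (vortHat U) 2 volume = ⊤
  · rw [h]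
    exact le_top
  · have hm : MemLp (vortHat U) 2 volume :=
      ⟨(measurable_vortHat U).aestronglyMeasurable, lt_top_iff_ne_top.2 h⟩
    set G : Lp ℂ 2 (volume : Measure Plane) := hm.toLp with hG
    have h1 : (G : Distr) = 𝓕 (vorticity U) := by
      ext θ
      rw [(rep_toLp hm).apply, ((represents_vortHat U).2 θ).2]
    have h2 : ((𝓕⁻ G : Lp ℂ 2 (volume : Measure Plane)) : Distr) = vorticity U := by
      rw [← Lp.fourierInv_toTemperedDistribution_eq, h1, FourierTransform.fourierInv_fourier_eq]
    rw [← key _ h2, enstrophy, distNorm]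
    exact iInf_le_of_le _ (iInf_le_of_le h2 le_rfl)

theorem fourier_vortL (m : 𝓢(Plane, ℂ)) (U : VectorField) :
    (𝓕 (vortL m U) : Lp ℂ 2 (volume : Measure Plane)) =ᵐ[volume] fun ξ => m ξ * vortHat U ξ := by
  set A : Fin 2 → Fin 2 → Lp ℂ 2 (volume : Measure Plane) := fun k i =>
    (memLp_conv (by simp) (𝓕⁻ (dsym k m)) (Lp.memLp (component U i))).toLp with hA
  have h1 : vortL m U = A 0 1 - A 1 0 := by
    rw [hA, ← MemLp.toLp_sub]
    rfl
  have h2 : (𝓕 (A 0 1 - A 1 0) : Lp ℂ 2 (volume : Measure Plane)) = 𝓕 (A 0 1) - 𝓕 (A 1 0) :=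
    map_sub (FourierTransform.fourierCLE ℂ (Lp ℂ 2 (volume : Measure Plane))) _ _
  rw [h1, h2]
  filter_upwards [Lp.coeFn_sub (𝓕 (A 0 1) : Lp ℂ 2 (volume : Measure Plane)) (𝓕 (A 1 0)),
    Rep.cv_fourier (dsym 0 m) (component U 1), Rep.cv_fourier (dsym 1 m) (component U 0)]
    with ξ e1 e2 e3
  rw [e1, Pi.sub_apply, e2, e3, vortHat, dsym_apply, dsym_apply]
  ring

theorem enorm_vortL_sq (m : 𝓢(Plane, ℂ)) (U : VectorField) :
    ‖vortL m U‖ₑ ^ 2 = ∫⁻ ξ, ‖m ξ * vortHat U ξ‖ₑ ^ 2 := by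
  rw [← eLpNorm_two_pow, ← eLpNorm_congr_ae (fourier_vortL m U), ← Lp.enorm_def, ← ofReal_norm,
    ← ofReal_norm, Lp.norm_fourier_eq]

/-- The dilated cutoffs are eventually 1 at each frequency. Dominated convergence treats finite
enstrophy, Fatou's lemma the infinite case. -/
theorem tendsto_enorm_vortL_sq {χ : Plane → ℝ} (hχ : IsCutoff χ) (U : VectorField) :
    Tendsto (fun n => ‖vortL (dil n (cut hχ)) U‖ₑ ^ 2) atTop (𝓝 (enstrophy U ^ 2)) := by
  simp only [enorm_vortL_sq, enstrophy_eq, eLpNorm_two_pow]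
  have hm : ∀ n, Measurable fun ξ => ‖dil n (cut hχ) ξ * vortHat U ξ‖ₑ ^ 2 := fun n =>
    (((dil n (cut hχ)).continuous.measurable.mul (measurable_vortHat U)).enorm.pow_const 2)
  have hlim : ∀ ξ, Tendsto (fun n => ‖dil n (cut hχ) ξ * vortHat U ξ‖ₑ ^ 2) atTop
      (𝓝 (‖vortHat U ξ‖ₑ ^ 2)) := fun ξ => by
    refine tendsto_const_nhds.congr' ?_
    filter_upwards [eventually_dil_cut_eq_one hχ ξ] with n hn
    rw [hn, one_mul]
  by_cases h : ∫⁻ ξ, ‖vortHat U ξ‖ₑ ^ 2 = ⊤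
  · rw [h]
    refine tendsto_of_le_liminf_of_limsup_le ?_ le_top
    rw [← h]
    refine le_trans (le_of_eq ?_) (lintegral_liminf_le hm)
    exact lintegral_congr fun ξ => (hlim ξ).liminf_eq.symm
  · obtain ⟨A, hA, hb⟩ := exists_bound (cut hχ)
    refine tendsto_lintegral_of_dominated_convergence
      (fun ξ => ENNReal.ofReal A ^ 2 * ‖vortHat U ξ‖ₑ ^ 2) hm ?_ ?_ (ae_of_all _ hlim)
    · intro n
      refine ae_of_all _ fun ξ => ?_
      simp only
      rw [enorm_mul, mul_pow]
      gcongr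
      rw [← ofReal_norm]
      exact ENNReal.ofReal_le_ofReal (hb _)
    · rw [lintegral_const_mul' _ _ (ENNReal.pow_ne_top ENNReal.ofReal_ne_top)]
      exact ENNReal.mul_ne_top (ENNReal.pow_ne_top ENNReal.ofReal_ne_top) h

end

section

/-! ### The flux bound along an `L³` vorticity -/

section

variable {χ : Plane → ℝ} (hχ : IsCutoff χ)

theorem mult_coe_three (m : 𝓢(Plane, ℂ)) (F : Lp ℂ 3 (volume : Measure Plane)) :
    mult m (F : Distr) = (cvL 3 (by simp) m F : Distr) :=
  ((rep_Lp _).distribution_eq ((Rep.cv (by simp) m (rep_Lp F)).congr (coeFn_cvL 3 (by simp) m F).symm)).symm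

theorem distNorm_mult (m : 𝓢(Plane, ℂ)) (F : Lp ℂ 3 (volume : Measure Plane)) :
    distNorm 3 (mult m (F : Distr)) = ‖cvL 3 (by simp) m F‖ₑ := by
  rw [mult_coe_three, distNorm_coe]

theorem enorm_cvL_dil_le (m : 𝓢(Plane, ℂ)) (n : ℕ) (F : Lp ℂ 3 (volume : Measure Plane)) :
    ‖cvL 3 (by simp) (dil n m) F‖ₑ ≤ eLpNorm (𝓕⁻ m : 𝓢(Plane, ℂ)) 1 volume * ‖F‖ₑ := by
  rw [Lp.enorm_def, eLpNorm_congr_ae (coeFn_cvL 3 (by simp) (dil n m) F), Lp.enorm_def,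
    ← eLpNorm_one_fourierInv_dil n m]
  exact eLpNorm_conv_le (by simp) _ (Lp.memLp F)

/-- Convergence in L² together with a uniform sup bound gives convergence in L³ by interpolation. -/
theorem tendsto_eLpNorm_three_cv_dil_sub {f : Plane → ℂ} (hf : MemLp f 2 volume) {B : ℝ≥0∞}
    (hB : ∀ x, ‖f x‖ₑ ≤ B) (hBt : B ≠ ⊤) :
    Tendsto (fun n => eLpNorm (cv (dil n (cut hχ)) f - f) 3 volume) atTop (𝓝 0) := by
  set κ := eLpNorm (𝓕⁻ (cut hχ) : 𝓢(Plane, ℂ)) 1 volume with hκ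
  have hκt : κ ≠ ⊤ := (SchwartzMap.eLpNorm_lt_top _ _ volume).ne
  have ht : eLpNorm f ⊤ volume ≤ B := by
    rw [eLpNorm_exponent_top]
    exact essSup_le_of_ae_le _ (ae_of_all _ hB)
  have htm : MemLp f ⊤ volume := ⟨hf.1, ht.trans_lt (lt_top_iff_ne_top.2 hBt)⟩
  have h2 : ∀ n x, ‖(cv (dil n (cut hχ)) f - f) x‖ₑ ≤ (κ + 1) * B := fun n x => by
    have h := enorm_conv_le (𝓕⁻ (dil n (cut hχ))) htm x
    simp only [ENNReal.inv_top, tsub_zero, inv_one, eLpNorm_one_fourierInv_dil] at h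
    rw [Pi.sub_apply, add_mul, one_mul]
    exact enorm_sub_le.trans (add_le_add (h.trans (by gcongr)) (hB x))
  have hfin : (κ + 1) * B ≠ ⊤ := by finiteness
  have h3 : Tendsto (fun n => ((κ + 1) * B * eLpNorm (cv (dil n (cut hχ)) f - f) 2 volume ^ 2) ^
      (1 / 3 : ℝ)) atTop (𝓝 0) := by
    have h5 := ENNReal.Tendsto.const_mul (a := (κ + 1) * B)
      (ENNReal.Tendsto.pow (n := 2) (tendsto_eLpNorm_cv_dil_sub hχ hf)) (.inr hfin)
    have h6 := (ENNReal.continuous_rpow_const (y := 1 / 3)).tendsto _ |>.comp h5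
    rw [zero_pow two_ne_zero, mul_zero, ENNReal.zero_rpow_of_pos (by norm_num)] at h6
    exact h6
  refine tendsto_of_tendsto_of_tendsto_of_le_of_le tendsto_const_nhds h3 (fun _ => zero_le) ?_
  intro n
  have := eLpNorm_three_pow_le (h2 n) hfin
  calc eLpNorm (cv (dil n (cut hχ)) f - f) 3 volume
      = (eLpNorm (cv (dil n (cut hχ)) f - f) 3 volume ^ 3) ^ (1 / 3 : ℝ) := by
        rw [← ENNReal.rpow_natCast, ← ENNReal.rpow_mul]; norm_num
    _ ≤ _ := ENNReal.rpow_le_rpow this (by norm_num)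

/-- Density of Schwartz functions in L³ and the uniform operator bound, the L¹ norm of the kernel
being invariant under dilation. -/
theorem tendsto_cvL_dil (F : Lp ℂ 3 (volume : Measure Plane)) :
    Tendsto (fun n => ‖cvL 3 (by simp) (dil n (cut hχ)) F - F‖ₑ) atTop (𝓝 0) := by
  set κ := eLpNorm (𝓕⁻ (cut hχ) : 𝓢(Plane, ℂ)) 1 volume with hκ
  have hκt : κ ≠ ⊤ := (SchwartzMap.eLpNorm_lt_top _ _ volume).ne
  have hS : ∀ f : 𝓢(Plane, ℂ), Tendsto (fun n => ‖cvL 3 (by simp) (dil n (cut hχ))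
      (SchwartzMap.toLpCLM ℝ ℂ 3 volume f) - SchwartzMap.toLpCLM ℝ ℂ 3 volume f‖ₑ) atTop (𝓝 0) := by
    intro f
    set G := SchwartzMap.toLpCLM ℝ ℂ 3 volume f with hG
    have hGf : G =ᵐ[volume] (f : Plane → ℂ) := SchwartzMap.coeFn_toLp f 3 volume
    have h1 : ∀ n, ‖cvL 3 (by simp) (dil n (cut hχ)) G - G‖ₑ =
        eLpNorm (cv (dil n (cut hχ)) f - (f : Plane → ℂ)) 3 volume := fun n => by
      rw [Lp.enorm_def]
      refine eLpNorm_congr_ae ?_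
      filter_upwards [Lp.coeFn_sub (cvL 3 (by simp) (dil n (cut hχ)) G) G,
        coeFn_cvL 3 (by simp) (dil n (cut hχ)) G, hGf] with x e1 e2 e3
      rw [e1, Pi.sub_apply, Pi.sub_apply, e2, e3]
      congr 1
      exact congrFun (conv_congr _ hGf) x
    simp only [h1]
    obtain ⟨A, hA, hb⟩ := exists_bound f
    refine tendsto_eLpNorm_three_cv_dil_sub hχ (f.memLp 2) (B := ENNReal.ofReal A) (fun x => ?_)
      ENNReal.ofReal_ne_top
    rw [← ofReal_norm]
    exact ENNReal.ofReal_le_ofReal (hb x)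
  rw [ENNReal.tendsto_atTop_zero]
  intro ε hε
  set δ := ε / (3 * (κ + 1)) with hδ
  have hδ0 : 0 < δ := ENNReal.div_pos hε.ne' (by finiteness)
  obtain ⟨f, hf⟩ : ∃ f : 𝓢(Plane, ℂ), ‖F - SchwartzMap.toLpCLM ℝ ℂ 3 volume f‖ₑ < δ := by
    have := (SchwartzMap.denseRange_toLpCLM (F := ℂ) (p := 3) (μ := (volume : Measure Plane))
      (by simp)) F
    rw [EMetric.mem_closure_iff] at this
    obtain ⟨_, ⟨f, rfl⟩, h⟩ := this δ hδ0
    exact ⟨f, by rwa [edist_eq_enorm_sub] at h⟩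
  set G := SchwartzMap.toLpCLM ℝ ℂ 3 volume f
  obtain ⟨N, hN⟩ := (ENNReal.tendsto_atTop_zero.1 (hS f)) δ hδ0
  refine ⟨N, fun n hn => ?_⟩
  set L := cvL 3 (by simp) (dil n (cut hχ)) with hL
  have e1 : L F - F = L (F - G) + (L G - G) - (F - G) := by rw [map_sub]; abel
  have hδe : 3 * (κ + 1) * δ ≤ ε := ENNReal.mul_div_le
  rw [e1]
  calc ‖L (F - G) + (L G - G) - (F - G)‖ₑ ≤ κ * ‖F - G‖ₑ + ‖L G - G‖ₑ + ‖F - G‖ₑ := by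
        refine enorm_sub_le.trans ?_
        gcongr
        refine (enorm_add_le _ _).trans ?_
        gcongr
        exact enorm_cvL_dil_le _ _ _
    _ ≤ κ * δ + δ + δ := by
        gcongr
        exact hN n hn
    _ ≤ 3 * (κ + 1) * δ := by
        have : 3 * (κ + 1) * δ = κ * δ + δ + δ + (2 * κ * δ + δ) := by ring
        rw [this]
        exact le_self_add
    _ ≤ ε := hδe

theorem block_coe (n : ℕ) (F : Lp ℂ 3 (volume : Measure Plane)) :
    distNorm 3 (block χ ((n : ℤ) - 1) (F : Distr)) = ‖cvL 3 (by simp) (blk hχ n) F‖ₑ := by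
  rw [block_eq_mult hχ, distNorm_mult]

theorem cvL_blk_succ (n : ℕ) (F : Lp ℂ 3 (volume : Measure Plane)) :
    cvL 3 (by simp) (blk hχ (n + 1)) F =
      cvL 3 (by simp) (dil (n + 1) (cut hχ)) F - cvL 3 (by simp) (dil n (cut hχ)) F := by
  have hk := Lp.ker_toTemperedDistributionCLM_eq_bot (F := ℂ)
    (μ := (volume : Measure Plane)) (p := 3)
  refine LinearMap.ker_eq_bot.1 hk ?_
  change Lp.toTemperedDistributionCLM ℂ volume 3 _ = Lp.toTemperedDistributionCLM ℂ volume 3 _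
  rw [map_sub]
  change (cvL 3 (by simp) (blk hχ (n + 1)) F : Distr) = (cvL 3 (by simp) (dil (n + 1) (cut hχ)) F : Distr) -
    (cvL 3 (by simp) (dil n (cut hχ)) F : Distr)
  rw [← mult_coe_three, ← mult_coe_three, ← mult_coe_three, blk, eq_sub_iff_add_eq, ← mult_add,
    sub_add_cancel]

theorem distNorm_block_le (q : ℤ) (F : Lp ℂ 3 (volume : Measure Plane)) :
    distNorm 3 (block χ q (F : Distr)) ≤
      2 * eLpNorm (𝓕⁻ (cut hχ) : 𝓢(Plane, ℂ)) 1 volume * ‖F‖ₑ := by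
  set κ := eLpNorm (𝓕⁻ (cut hχ) : 𝓢(Plane, ℂ)) 1 volume with hκ
  by_cases hq : q < -1
  · rw [block_eq_zero hq, (Rep.zero (p := 3)).distNorm_eq]
    simp
  · obtain ⟨n, rfl⟩ : ∃ n : ℕ, q = (n : ℤ) - 1 := ⟨(q + 1).toNat, by omega⟩
    rw [block_coe hχ]
    cases n with
    | zero =>
      have := enorm_cvL_dil_le (cut hχ) 0 F
      have h0 : dil 0 (cut hχ) = blk hχ 0 := by ext; simp [dil_apply, blk]
      rw [h0] at this
      refine this.trans ?_
      gcongr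
      rw [two_mul]
      exact le_self_add
    | succ n =>
      rw [cvL_blk_succ]
      refine enorm_sub_le.trans ((add_le_add (enorm_cvL_dil_le _ _ _)
        (enorm_cvL_dil_le _ _ _)).trans_eq ?_)
      ring

theorem tendsto_distNorm_block (hχ : IsCutoff χ) (F : Lp ℂ 3 (volume : Measure Plane)) :
    Tendsto (fun q : ℤ => distNorm 3 (block χ q (F : Distr))) atTop (𝓝 0) := by
  have h1 : Tendsto (fun n : ℕ => distNorm 3 (block χ (((n + 1 : ℕ) : ℤ) - 1) (F : Distr))) atTop
      (𝓝 0) := by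
    have h := tendsto_cvL_dil hχ F
    have h2 := (h.comp (tendsto_add_atTop_nat 1)).add h
    rw [add_zero] at h2
    refine tendsto_of_tendsto_of_tendsto_of_le_of_le tendsto_const_nhds h2 (fun _ => zero_le) ?_
    intro n
    simp only [Function.comp_apply]
    rw [block_coe hχ, cvL_blk_succ]
    refine le_trans (le_of_eq ?_) enorm_sub_le
    congr 1
    abel
  have h3 : Tendsto (fun q : ℤ => q.toNat) atTop atTop :=
    tendsto_atTop.2 fun n => (eventually_ge_atTop (n : ℤ)).mono fun q hq => by omega
  refine (h1.comp h3).congr' ?_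
  filter_upwards [eventually_ge_atTop (0 : ℤ)] with q hq
  simp only [Function.comp_apply]
  congr 2
  omega

theorem distNorm_partialSum (Q : ℕ) (F : Lp ℂ 3 (volume : Measure Plane)) :
    distNorm 3 (partialSum χ Q (F : Distr)) = ‖cvL 3 (by simp) (dil (Q + 1) (cut hχ)) F‖ₑ := by
  rw [partialSum_eq_mult hχ, distNorm_mult]

theorem continuous_distNorm_block (hχ : IsCutoff χ) (q : ℤ) :
    Continuous fun F : Lp ℂ 3 (volume : Measure Plane) => distNorm 3 (block χ q (F : Distr)) := by
  by_cases hq : q < -1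
  · simp only [block_eq_zero hq]
    exact continuous_const
  · obtain ⟨n, rfl⟩ : ∃ n : ℕ, q = (n : ℤ) - 1 := ⟨(q + 1).toNat, by omega⟩
    simp only [block_coe hχ]
    exact (ContinuousLinearMap.continuous _).enorm

theorem W_nonneg (q : ℤ) : 0 ≤ W q := by
  rw [W]; split_ifs <;> simp only [lam] <;> positivity

theorem tsum_W_ne_top : ∑' q : ℤ, ENNReal.ofReal (W q) ≠ ⊤ := by
  have h : Summable W := by
    refine Summable.of_nat_of_neg ?_ ?_
    · refine Summable.of_nonneg_of_le (fun n => W_nonneg _) (fun n => ?_)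
        (summable_geometric_of_lt_one (r := (16 : ℝ)⁻¹) (by norm_num) (by norm_num))
      rw [W]
      split_ifs with h0
      · have : n = 0 := by omega
        simp [this, lam]
      · rw [lam, zpow_natCast, ← pow_mul, mul_comm, pow_mul, inv_pow]
        norm_num
    · refine Summable.of_nonneg_of_le (fun n => W_nonneg _) (fun n => ?_)
        (summable_geometric_of_lt_one (r := (4 : ℝ)⁻¹) (by norm_num) (by norm_num))
      rw [W, if_pos (by omega), lam, zpow_neg, zpow_natCast, inv_pow, ← pow_mul, mul_comm, pow_mul,
        inv_pow]
      norm_num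
  exact h.tsum_ofReal_ne_top

/-- The convolution `W * c²` for a vorticity in `L³`. -/
def WcL (χ : Plane → ℝ) (F : Lp ℂ 3 (volume : Measure Plane)) (Q : ℤ) : ℝ≥0∞ :=
  ∑' q : ℤ, ENNReal.ofReal (W q) * distNorm 3 (block χ (Q - q) (F : Distr)) ^ 2

/-- The reindexing q ↦ Q - q makes the weights independent of Q, as dominated convergence requires.
-/
theorem Wc_eq {u : VectorField} {F : Lp ℂ 3 (volume : Measure Plane)}
    (h : (F : Distr) = vorticity u) (Q : ℤ) : Wc χ u Q = WcL χ F Q := by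
  rw [Wc, WcL, ← (Equiv.subLeft Q).tsum_eq]
  simp [c, h]

theorem WcL_le (F : Lp ℂ 3 (volume : Measure Plane)) (Q : ℤ) :
    WcL χ F Q ≤ (∑' q : ℤ, ENNReal.ofReal (W q)) *
      (2 * eLpNorm (𝓕⁻ (cut hχ) : 𝓢(Plane, ℂ)) 1 volume * ‖F‖ₑ) ^ 2 := by
  rw [← ENNReal.tsum_mul_right]
  refine ENNReal.tsum_le_tsum fun q => ?_
  gcongr
  exact distNorm_block_le hχ _ _

/-- Dominated convergence for series: for each fixed offset the blocks tend to zero in L³, and W is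
summable. -/
theorem tendsto_WcL (hχ : IsCutoff χ) (F : Lp ℂ 3 (volume : Measure Plane)) :
    Tendsto (fun Q : ℕ => WcL χ F Q) atTop (𝓝 0) := by
  set κ := eLpNorm (𝓕⁻ (cut hχ) : 𝓢(Plane, ℂ)) 1 volume with hκ
  have hκt : κ ≠ ⊤ := (SchwartzMap.eLpNorm_lt_top _ _ volume).ne
  simp only [WcL, ← lintegral_count]
  have h0 : (0 : ℝ≥0∞) = ∫⁻ _ : ℤ, 0 ∂Measure.count := by simp
  rw [h0]
  refine tendsto_lintegral_of_dominated_convergence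
    (fun q => ENNReal.ofReal (W q) * (2 * κ * ‖F‖ₑ) ^ 2) (fun _ => measurable_from_top) ?_ ?_ ?_
  · intro Q
    refine ae_of_all _ fun q => ?_
    simp only
    gcongr
    exact distNorm_block_le hχ _ _
  · rw [lintegral_count, ENNReal.tsum_mul_right]
    have := tsum_W_ne_top
    finiteness
  · refine ae_of_all _ fun q => ?_
    have h1 : Tendsto (fun Q : ℕ => (Q : ℤ) - q) atTop atTop :=
      tendsto_atTop_add_const_right _ _ tendsto_natCast_atTop_atTop
    have h2 := ENNReal.Tendsto.const_mul (a := ENNReal.ofReal (W q))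
      (ENNReal.Tendsto.pow (n := 2) ((tendsto_distNorm_block hχ F).comp h1)) (.inr ENNReal.ofReal_ne_top)
    simpa using h2

end

end

section

/-! ### Conservation of enstrophy -/

section

variable {χ : Plane → ℝ} {T : ℝ} {u : ℝ → VectorField}

/-- The flux bound tends to zero at almost every time and is dominated by a multiple of ‖ω‖₃³; cubic
integrability in time is exactly what is needed. -/
theorem tendsto_lintegral_flux (hχ : IsCutoff χ) (h : IsWeakSolution T u)
    (hω : VorticityL3L3 T u) {t : ℝ} (ht : t ∈ Icc 0 T) :
    Tendsto (fun Q : ℕ => ∫⁻ r in Ioc 0 t, 2 * ‖flux χ Q (u r)‖ₑ) atTop (𝓝 0) := by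
  obtain ⟨w, hw, hwu⟩ := hω
  obtain ⟨C, hC⟩ := exists_enorm_flux_le hχ
  set κ := eLpNorm (𝓕⁻ (cut hχ) : 𝓢(Plane, ℂ)) 1 volume with hκ
  have hκt : κ ≠ ⊤ := (SchwartzMap.eLpNorm_lt_top _ _ volume).ne
  set S := ∑' q : ℤ, ENNReal.ofReal (W q)
  have hSt : S ≠ ⊤ := tsum_W_ne_top
  have hsub : Ioc 0 t ⊆ Icc 0 T := fun r hr => ⟨hr.1.le, hr.2.trans ht.2⟩
  have hle : volume.restrict (Ioc 0 t) ≤ volume.restrict (Icc 0 T) := Measure.restrict_mono hsub le_rfl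
  have hwm : AEStronglyMeasurable w (volume.restrict (Ioc 0 t)) := hw.1.mono_measure hle
  -- Dominated convergence is applied to this majorant, whose measurability in time follows from
  -- that of `w`.
  set Ψ : ℕ → ℝ → ℝ≥0∞ := fun Q r => 2 * (C * ((κ * ‖w r‖ₑ) ^ 2 * WcL χ (w r) Q ^ (1 / 2 : ℝ) +
    WcL χ (w r) Q ^ (3 / 2 : ℝ))) with hΨ
  have hflux : ∀ Q : ℕ, ∫⁻ r in Ioc 0 t, 2 * ‖flux χ Q (u r)‖ₑ ≤ ∫⁻ r in Ioc 0 t, Ψ Q r := fun Q => by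
    refine lintegral_mono_ae ?_
    filter_upwards [ae_mono hle hwu, ae_restrict_mem measurableSet_Ioc] with r hr hrt
    refine mul_le_mul_right ?_ 2
    refine (hC (u r) (h.divergenceFree r (hsub hrt)) Q).trans ?_
    rw [Wc_eq hr, ← hr, distNorm_partialSum hχ]
    gcongr
    exact enorm_cvL_dil_le _ _ _
  refine tendsto_of_tendsto_of_tendsto_of_le_of_le tendsto_const_nhds ?_ (fun _ => zero_le) hflux
  have hWm : ∀ Q : ℕ, AEMeasurable (fun r => WcL χ (w r) Q) (volume.restrict (Ioc 0 t)) := fun Q =>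
    AEMeasurable.tsum fun q =>
      ((((continuous_distNorm_block hχ _).comp_aestronglyMeasurable hwm).aemeasurable.pow_const
        2).const_mul _)
  have h0 : (0 : ℝ≥0∞) = ∫⁻ _ in Ioc 0 t, 0 := by simp
  have hpow : ∀ x y : ℝ≥0∞, (x * y ^ 2) ^ (1 / 2 : ℝ) = x ^ (1 / 2 : ℝ) * y ∧
      (x * y ^ 2) ^ (3 / 2 : ℝ) = x ^ (3 / 2 : ℝ) * y ^ 3 := fun x y => by
    rw [ENNReal.mul_rpow_of_nonneg _ _ (by norm_num), ENNReal.mul_rpow_of_nonneg _ _ (by norm_num),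
      ← ENNReal.rpow_natCast y 2, ← ENNReal.rpow_mul, ← ENNReal.rpow_mul, ← ENNReal.rpow_natCast y 3]
    norm_num
  -- Since W*c² is at most quadratic in ‖w‖, both terms of the bound are homogeneous of degree
  -- three.
  set D := 2 * (C * (κ ^ 2 * (S ^ (1 / 2 : ℝ) * (2 * κ)) + S ^ (3 / 2 : ℝ) * (2 * κ) ^ 3)) with hD
  have hDt : D ≠ ⊤ := by
    have h1 : S ^ (1 / 2 : ℝ) ≠ ⊤ := ENNReal.rpow_ne_top_of_nonneg (by norm_num) hSt
    have h2 : S ^ (3 / 2 : ℝ) ≠ ⊤ := ENNReal.rpow_ne_top_of_nonneg (by norm_num) hSt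
    finiteness
  rw [h0]
  refine tendsto_lintegral_of_dominated_convergence' (fun r => D * ‖w r‖ₑ ^ 3) ?_ ?_ ?_ ?_
  · intro Q
    exact ((((hwm.enorm.const_mul κ).pow_const 2).mul ((hWm Q).pow_const _)).add
      ((hWm Q).pow_const _)).const_mul _ |>.const_mul _
  · intro Q
    refine ae_of_all _ fun r => ?_
    have hW := WcL_le hχ (w r) Q
    calc Ψ Q r ≤ 2 * (C * ((κ * ‖w r‖ₑ) ^ 2 * (S * (2 * κ * ‖w r‖ₑ) ^ 2) ^ (1 / 2 : ℝ) +
          (S * (2 * κ * ‖w r‖ₑ) ^ 2) ^ (3 / 2 : ℝ))) := by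
          simp only [hΨ]
          gcongr
      _ = D * ‖w r‖ₑ ^ 3 := by
          rw [(hpow _ _).1, (hpow _ _).2, hD]
          ring
  · rw [lintegral_const_mul' _ _ hDt]
    refine ENNReal.mul_ne_top hDt (ne_top_of_le_ne_top (ENNReal.pow_ne_top hw.2.ne (n := 3)) ?_)
    rw [eLpNorm_three_pow]
    exact lintegral_mono' hle le_rfl
  · refine ae_of_all _ fun r => ?_
    have hW := tendsto_WcL hχ (w r)
    have h1 := (ENNReal.continuous_rpow_const (y := 1 / 2)).tendsto _ |>.comp hW
    have h2 := (ENNReal.continuous_rpow_const (y := 3 / 2)).tendsto _ |>.comp hW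
    rw [ENNReal.zero_rpow_of_pos (by norm_num)] at h1 h2
    have h3 := ENNReal.Tendsto.const_mul (a := (κ * ‖w r‖ₑ) ^ 2) h1 (.inr (by finiteness))
    have h4 := ENNReal.Tendsto.const_mul (a := 2) (ENNReal.Tendsto.const_mul (a := C) (h3.add h2)
      (.inr ENNReal.coe_ne_top)) (.inr (by simp))
    simp only [mul_zero, add_zero] at h4
    exact h4

/-- Weak solutions of the Euler equations whose vorticity is in `L³L³` conserve the enstrophy. -/
theorem IsWeakSolution.enstrophy_eq (h : IsWeakSolution T u) (hω : VorticityL3L3 T u) {t : ℝ}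
    (ht : t ∈ Icc 0 T) : enstrophy (u t) = enstrophy (u 0) := by
  obtain ⟨χ, hχ⟩ := exists_isCutoff
  have hle : ∀ x y : ℝ, 0 ≤ x → 0 ≤ y →
      ENNReal.ofReal x ^ 2 ≤ ENNReal.ofReal y ^ 2 + ENNReal.ofReal |x ^ 2 - y ^ 2| :=
    fun x y hx hy => by
      rw [← ENNReal.ofReal_pow hx, ← ENNReal.ofReal_pow hy,
        ← ENNReal.ofReal_add (by positivity) (abs_nonneg _)]
      refine ENNReal.ofReal_le_ofReal ?_
      linarith [le_abs_self (x ^ 2 - y ^ 2)]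
  have hlim : ∀ r, Tendsto (fun Q : ℕ => ‖vortL (dil (Q + 1) (cut hχ)) (u r)‖ₑ ^ 2) atTop
      (𝓝 (enstrophy (u r) ^ 2)) := fun r =>
    (tendsto_enorm_vortL_sq hχ (u r)).comp (tendsto_add_atTop_nat 1)
  have hflux := tendsto_lintegral_flux hχ h hω ht
  have key := fun Q => h.ofReal_abs_norm_vortL_sub_le hχ Q ht
  -- The two inequalities are passed to the limit separately in [0, ∞], so no infinite quantities
  -- are subtracted.
  have h1 : enstrophy (u t) ^ 2 ≤ enstrophy (u 0) ^ 2 := by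
    have h2 := (hlim 0).add hflux
    rw [add_zero] at h2
    refine le_of_tendsto_of_tendsto' (hlim t) h2 fun Q => ?_
    rw [← ofReal_norm, ← ofReal_norm]
    exact (hle _ _ (norm_nonneg _) (norm_nonneg _)).trans (add_le_add le_rfl (key Q))
  have h3 : enstrophy (u 0) ^ 2 ≤ enstrophy (u t) ^ 2 := by
    have h2 := (hlim t).add hflux
    rw [add_zero] at h2
    refine le_of_tendsto_of_tendsto' (hlim 0) h2 fun Q => ?_
    rw [← ofReal_norm, ← ofReal_norm]
    refine (hle _ _ (norm_nonneg _) (norm_nonneg _)).trans (add_le_add le_rfl ?_)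
    rw [abs_sub_comm]
    exact key Q
  exact le_antisymm ((ENNReal.pow_le_pow_left_iff two_ne_zero).1 h1)
    ((ENNReal.pow_le_pow_left_iff two_ne_zero).1 h3)

end

end

end Enstrophy

end

theorem mainTheorem7 :
    (∀ χ : Enstrophy.Plane → ℝ, Enstrophy.IsCutoff χ →
      ∃ C : ℝ≥0, ∀ u : Enstrophy.VectorField, Enstrophy.DivergenceFree u → ∀ Q : ℕ,
        Integrable (Enstrophy.fluxDensity χ Q u) ∧
        ‖Enstrophy.flux χ Q u‖ₑ ≤
          C * (Enstrophy.distNorm 3 (Enstrophy.partialSum χ Q (Enstrophy.vorticity u)) ^ 2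
                * Enstrophy.Wc χ u Q ^ (1 / 2 : ℝ)
              + Enstrophy.Wc χ u Q ^ (3 / 2 : ℝ))) ∧
    (∀ (T : ℝ) (u : ℝ → Enstrophy.VectorField), 0 < T →
      Enstrophy.IsWeakSolution T u → Enstrophy.VorticityL3L3 T u →
      ∀ t ∈ Icc 0 T, Enstrophy.enstrophy (u t) = Enstrophy.enstrophy (u 0)) := by
  refine ⟨fun χ hχ => ?_, fun T u _ h hω t ht => h.enstrophy_eq hω ht⟩
  obtain ⟨C, hC⟩ := Enstrophy.exists_enorm_flux_le hχ
  exact ⟨C, fun u hu Q => ⟨Enstrophy.integrable_fluxDensity hχ Q u, hC u hu Q⟩⟩
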